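/- Let $T\ge 0$, $n,m\in\mathbb N$. A continuous-time hidden Markov model $(Q,r,\pi_0)$ on $[0,T]$ is a pair of processes $X_t\in\{1,\dots,n\}$, $Y_t\in\{1,\dots,m\}$, $t\in[0,T]$, on a probability space, such that: (i) $X$ is a time-homogeneous Markov process whose paths are right-continuous step functions with finitely many jumps, with $\Pr\{X_0=i\}=\pi_0(i)$ and generator $Q\in\mathbb R^{n\times n}$, i.e. $Q_{ij}=\lim_{h\downarrow0}\Pr\{X_{t+h}=j\mid X_t=i\}/h$ for $i\ne j$, and $Q_{ii}=-\sum_{j\ne i}Q_{ij}$; (ii) if $0=\tilde\tau_0<\tilde\tau_1<\dots<\tilde\tau_{\tilde S}\le T$ are time $0$ and the jump times of $X$, then, conditionally on the path of $X$, the values $Y_{\tilde\tau_0},\dots,Y_{\tilde\tau_{\tilde S}}$ are independent, $Y_{\tilde\tau_s}$ having the probability distribution $r_i(\cdot)$ on $\{1,\dots,m\}$ where $i=X_{\tilde\tau_s}$, and $Y$ is constant on each $[\tilde\tau_s,\tilde\tau_{s+1})$, $s<\tilde S$, and on $[\tilde\tau_{\tilde S},T]$. Put $D=\operatorname{diag}(Q_{11},\dots,Q_{nn})$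 and $R(y)=\operatorname{diag}(r_1(y),\dots,r_n(y))$. For a right-continuous step function $y:[0,T]\to\{1,\dots,m\}$ let $0=\tau_0$ and let $\tau_1<\dots<\tau_S\le T$ be its discontinuities; let $I_s=[\tau_s,\tau_{s+1})$ for $s<S$ and $I_S=[\tau_S,T]$. Consider the forward equation for a row vector $\alpha_t\in\mathbb R^{1\times n}$, $$\alpha_0=\pi_0R(y_0),\qquad \dot\alpha_t=\alpha_t\,[D+(Q-D)R(y_{\tau_s})]\ \ (t\in I_s,\ 0\le s\le S),\qquad \alpha_{\tau_s}=\alpha_{\tau_s^-}(Q-D)R(y_{\tau_s})\ \ (1\le s\le S),$$ and the backward equation for a column vector $\beta_t\in\mathbb R^{n\times1}$, $$\beta_T=(1,\dots,1)^{\intercal},\qquad \dot\beta_t=-[D+(Q-D)R(y_{\tau_s})]\,\beta_t\ \ (t\in I_s,\ 0\le s\le S),\qquad \beta_{\tau_s^-}=(Q-D)R(y_{\tau_s})\beta_{\tau_s}\ \ (1\le s\le S),$$ where $\dot{}$ denotes the derivative relative to $I_s$, and $\alpha_{\tau_s^-}$, $\beta_{\tau_s^-}$ are left limits. Then, for a continuous-time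 hidden Markov model $(Q,r,\pi_0)$: 1. Every path of $Y$ is a right-continuous step function. For every right-continuous step function $y$, each of the two equations has exactly one solution on $[0,T]$, and $\alpha_t\cdot\beta_t=\sum_{i=1}^n\alpha_t(i)\beta_t(i)$ does not depend on $t\in[0,T]$. 2. If $\alpha,\beta$ denote the solutions along the observed path $y=Y$, then almost surely $\alpha_0\cdot\beta_0>0$, and for every $t\in[0,T]$ and $i\in\{1,\dots,n\}$, almost surely $$\Pr\{X_t=i\mid Y_s,\ s\in[0,T]\}=\frac{\alpha_t(i)\,\beta_t(i)}{\alpha_0\cdot\beta_0}.$$ -/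

import Mathlib

open MeasureTheory ProbabilityTheory Filter Topology Set

noncomputable section

namespace CTHMM

/-- The `s`-th piece of the partition `τ 0 < ... < τ S` of `[0, T]`: it is `[τ s, τ (s+1))` for
`s < S`, and the last piece `[τ S, T]` contains the endpoint `T`. -/
def piece (T : ℝ) (S : ℕ) (τ : ℕ → ℝ) (s : ℕ) : Set ℝ :=
  if s < S then Ico (τ s) (τ (s + 1)) else Icc (τ s) T

/-- The path `y` is constant on each piece of the partition. -/
def ConstOnPieces {E : Type*} (T : ℝ) (y : ℝ → E) (S : ℕ) (τ : ℕ → ℝ) : Prop :=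
  ∀ s ≤ S, ∀ t ∈ piece T S τ s, y t = y (τ s)

/-- On `[0, T]` the path `y` is a right-continuous step function whose successive discontinuities
are exactly `τ 1 < ... < τ S` (and `τ 0 = 0`). The values `τ s` with `s > S` play no role. -/
structure IsJumpPartition {E : Type*} (T : ℝ) (y : ℝ → E) (S : ℕ) (τ : ℕ → ℝ) : Prop where
  zero : τ 0 = 0
  lt : ∀ s < S, τ s < τ (s + 1)
  le : τ S ≤ T
  const : ConstOnPieces T y S τ
  ne : ∀ s < S, y (τ (s + 1)) ≠ y (τ s)

/-- The σ-algebra generated by `Z u`, `u ∈ [0, t]`. -/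
abbrev pathSigma {Ω E : Type*} (Z : ℝ → Ω → E) (t : ℝ) : MeasurableSpace Ω :=
  ⨆ u ∈ Icc (0 : ℝ) t, MeasurableSpace.comap (Z u) ⊤

variable {Ω : Type*} [MeasurableSpace Ω] {n m : ℕ}

/-- `X` is, on `[0, T]`, a (time-homogeneous, Markov) jump process with values in `Fin n`, initial
distribution `π₀` and generator `Q`. -/
structure IsJumpProcess (μ : Measure Ω) (T : ℝ) (Q : Matrix (Fin n) (Fin n) ℝ)
    (π₀ : Fin n → ℝ) (X : ℝ → Ω → Fin n) : Prop where
  measurable : ∀ t ∈ Icc 0 T, Measurable (X t)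
  /-- every path is a right-continuous step function with finitely many jumps -/
  path : ∀ ω, ∃ S τ, IsJumpPartition T (fun t => X t ω) S τ
  init : ∀ i, μ.real {ω | X 0 ω = i} = π₀ i
  /-- The Markov property with transition probabilities
  `P h i j = Pr{X (t + h) = j | X t = i}`, and `Q i j = lim P h i j / h` for `h ↓ 0`, `i ≠ j`. -/
  markov : ∃ P : ℝ → Matrix (Fin n) (Fin n) ℝ,
    (∀ h, 0 ≤ h → P h ∈ Matrix.rowStochastic ℝ (Fin n)) ∧
    (∀ s t, 0 ≤ s → s ≤ t → t ≤ T → ∀ A, MeasurableSet[pathSigma X s] A → ∀ i j,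
      μ.real (A ∩ {ω | X s ω = i} ∩ {ω | X t ω = j}) =
        μ.real (A ∩ {ω | X s ω = i}) * P (t - s) i j) ∧
    ∀ i j, i ≠ j → Tendsto (fun h => P h i j / h) (𝓝[>] 0) (𝓝 (Q i j))
  diag : ∀ i, Q i i = -∑ j ∈ Finset.univ.erase i, Q i j

/-- `(X, Y)` is, on `[0, T]`, a continuous-time hidden Markov model `(Q, r, π₀)`. -/
structure IsCTHMM (μ : Measure Ω) (T : ℝ) (Q : Matrix (Fin n) (Fin n) ℝ)
    (r : Fin n → Fin m → ℝ) (π₀ : Fin n → ℝ) (X : ℝ → Ω → Fin n) (Y : ℝ → Ω → Fin m) :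
    Prop where
  hidden : IsJumpProcess μ T Q π₀ X
  emission : ∀ i, r i ∈ stdSimplex ℝ (Fin m)
  measurable : ∀ t ∈ Icc 0 T, Measurable (Y t)
  /-- between successive jump times of the hidden path the observation is held constant -/
  held : ∀ ω S τ, IsJumpPartition T (fun t => X t ω) S τ →
    ConstOnPieces T (fun t => Y t ω) S τ
  /-- Given the whole hidden path, the observations at time `0` and at the hidden jump times are
  independent, the one drawn when the hidden state is `i` having distribution `r i`. -/
  observe : ∀ A, MeasurableSet[pathSigma X T] A →
    ∀ (S : ℕ) (x : ℕ → Fin n) (y : ℕ → Fin m),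
      μ.real (A ∩ {ω | ∃ τ, IsJumpPartition T (fun t => X t ω) S τ ∧
          ∀ s ≤ S, X (τ s) ω = x s ∧ Y (τ s) ω = y s}) =
        μ.real (A ∩ {ω | ∃ τ, IsJumpPartition T (fun t => X t ω) S τ ∧
          ∀ s ≤ S, X (τ s) ω = x s}) * ∏ s ∈ Finset.range (S + 1), r (x s) (y s)

/-- `D = diag(Q₁₁, ..., Qₙₙ)`. -/
def D (Q : Matrix (Fin n) (Fin n) ℝ) : Matrix (Fin n) (Fin n) ℝ :=
  Matrix.diagonal fun i => Q i i

/-- `R(y) = diag(r₁(y), ..., rₙ(y))`. -/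
def R (r : Fin n → Fin m → ℝ) (y : Fin m) : Matrix (Fin n) (Fin n) ℝ :=
  Matrix.diagonal fun i => r i y

open scoped Matrix

/-- The forward piecewise ODE on `[0, T]` along the step path `y` with discontinuities
`τ 1, ..., τ S`. -/
structure IsForwardSolution (T : ℝ) (Q : Matrix (Fin n) (Fin n) ℝ) (r : Fin n → Fin m → ℝ)
    (π₀ : Fin n → ℝ) (y : ℝ → Fin m) (S : ℕ) (τ : ℕ → ℝ) (α : ℝ → Fin n → ℝ) : Prop where
  init : α 0 = π₀ ᵥ* R r (y 0)
  ode : ∀ s ≤ S, ∀ t ∈ piece T S τ s,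
    HasDerivWithinAt α (α t ᵥ* (D Q + (Q - D Q) * R r (y (τ s)))) (piece T S τ s) t
  jump : ∀ s, 1 ≤ s → s ≤ S → ∃ a : Fin n → ℝ,
    Tendsto α (𝓝[<] (τ s)) (𝓝 a) ∧ α (τ s) = a ᵥ* ((Q - D Q) * R r (y (τ s)))

/-- The backward piecewise ODE on `[0, T]` along the step path `y` with discontinuities
`τ 1, ..., τ S`. -/
structure IsBackwardSolution (T : ℝ) (Q : Matrix (Fin n) (Fin n) ℝ) (r : Fin n → Fin m → ℝ)
    (y : ℝ → Fin m) (S : ℕ) (τ : ℕ → ℝ) (β : ℝ → Fin n → ℝ) : Prop where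
  final : β T = fun _ => 1
  ode : ∀ s ≤ S, ∀ t ∈ piece T S τ s,
    HasDerivWithinAt β (-((D Q + (Q - D Q) * R r (y (τ s))) *ᵥ β t)) (piece T S τ s) t
  jump : ∀ s, 1 ≤ s → s ≤ S →
    Tendsto β (𝓝[<] (τ s)) (𝓝 (((Q - D Q) * R r (y (τ s))) *ᵥ β (τ s)))

end CTHMM

end

/-! Sample the model on the uniform grid with `K` cells. The hidden states at the grid points form a
Markov chain with transition matrix `P (T / K)`. If the grid sees every hidden jump, each cell
contains at most one, and the grid observations behave as in a discrete model: a cell whose end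
states agree emits nothing new, a cell whose end states differ emits once. For that discrete model
the posterior is given exactly by a forward-backward recursion (`sum_pathWeight_indicator`), whose
one-step matrix is `heldRate (P (T / K))` when the observation is the same at both ends of the cell
and `jumpRate (P (T / K))` when it changes.

Two limits lead back to continuous time. Analytically, `heldRate (P (T / K))` is `1 + (T / K) •
heldRate Q + o(T / K)`, so products over runs of cells tend to matrix exponentials
(`tendsto_pow_exp`), while each observed jump contributes a factor of order `T / K` whose
coefficient tends to `jumpRate Q`. Divided by the right powers of `T / K`, the recursions converge
to the solutions of the two equations (`tendsto_discForward`, `tendsto_discBackward`); the powers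
cancel in the normalized posterior (`tendsto_discPosterior`). Probabilistically, the joint law on
the grid is within `2 * μ.real (fineSet T X K)ᶜ` of the discrete model in total mass
(`IsCTHMM.sum_abs_sub_le`), and this tends to zero because every path has finitely many jumps.
Dominated convergence then gives the defining integral identity of the conditional probability on
finite-dimensional events, and a π-λ argument extends it to the whole observed σ-algebra.

The normalization is legitimate because almost surely the hidden path uses only transitions of
positive rate and emissions of positive probability, so the forward solution keeps positive mass at
the current hidden state (`IsForwardSolution.pos_of_path`). Existence, uniqueness and constancy of
the pairing are linear algebra: on each piece the solutions are exponentials, and the two equations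
are adjoint to each other. -/

open NormedSpace Asymptotics
open scoped Matrix

namespace CTHMM

noncomputable section

/-! ### Exponentials in Banach algebras: limits of powers and linear ODEs -/

section Exponential

/-- Telescoping. The exponent `j` in place of the sharp `j - 1` avoids truncated subtraction and
costs only `1 ≤ c`. -/
theorem norm_pow_sub_pow_le {𝔸 : Type*} [NormedRing 𝔸] [NormOneClass 𝔸] (B C : 𝔸) (c : ℝ)
    (hB : ‖B‖ ≤ c) (hC : ‖C‖ ≤ c) (hc : 1 ≤ c) (j : ℕ) :
    ‖B ^ j - C ^ j‖ ≤ j * ‖B - C‖ * c ^ j := by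
  induction j with
  | zero => simp
  | succ j ih =>
    have h : B ^ (j + 1) - C ^ (j + 1) = B ^ j * (B - C) + (B ^ j - C ^ j) * C := by
      rw [pow_succ, pow_succ]; noncomm_ring
    have h1 : ‖B ^ j‖ ≤ c ^ j := (norm_pow_le B j).trans (by gcongr)
    have h0 : 0 ≤ c := by linarith
    calc ‖B ^ (j + 1) - C ^ (j + 1)‖ ≤ ‖B ^ j‖ * ‖B - C‖ + ‖B ^ j - C ^ j‖ * ‖C‖ := by
          rw [h]; exact le_trans (norm_add_le _ _) <| add_le_add (norm_mul_le _ _) (norm_mul_le _ _)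
      _ ≤ c ^ j * ‖B - C‖ + (j * ‖B - C‖ * c ^ j) * c := by gcongr
      _ ≤ c ^ (j + 1) * ‖B - C‖ + (j * ‖B - C‖ * c ^ j) * c := by
          gcongr
          omega
      _ = _ := by push_cast; ring

theorem exp_smul_sub_isLittleO {𝔸 : Type*} [NormedRing 𝔸] [NormedAlgebra ℝ 𝔸] [CompleteSpace 𝔸]
    (A : 𝔸) : (fun t : ℝ => exp (t • A) - 1 - t • A) =o[𝓝 0] fun t => t := by
  have h := (hasDerivAt_exp_smul_const (𝕂 := ℝ) A 0).isLittleO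
  simpa using h

/-- Both `B K` and `exp (d K • A)` are `1 + d K • A + o(d K)`, so they differ by `o(d K)`;
telescoping over `j K` factors multiplies this by `j K`, and `j K * d K` is bounded. -/
theorem tendsto_pow_exp {𝔸 : Type*} [NormedRing 𝔸] [NormOneClass 𝔸] [NormedAlgebra ℝ 𝔸]
    [CompleteSpace 𝔸] (A : 𝔸) {B : ℕ → 𝔸} {d : ℕ → ℝ} {j : ℕ → ℕ} {t : ℝ}
    (hd : Tendsto d atTop (𝓝 0)) (hd0 : ∀ K, 0 ≤ d K)
    (hB : (fun K => B K - 1 - d K • A) =o[atTop] d)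
    (hj : Tendsto (fun K => j K * d K) atTop (𝓝 t)) :
    Tendsto (fun K => B K ^ j K) atTop (𝓝 (exp (t • A))) := by
  let _ : NormedAlgebra ℚ 𝔸 := .restrictScalars ℚ ℝ 𝔸
  have hC : (fun K => exp (d K • A) - 1 - d K • A) =o[atTop] d :=
    (exp_smul_sub_isLittleO A).comp_tendsto hd
  have hBC : (fun K => B K - exp (d K • A)) =o[atTop] d := by
    refine (hB.sub hC).congr_left fun K => by abel
  have hCj : Tendsto (fun K => exp (d K • A) ^ j K) atTop (𝓝 (exp (t • A))) := by
    have h1 : ∀ K, exp (d K • A) ^ j K = exp ((j K * d K) • A) := fun K => by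
      rw [← exp_nsmul, ← Nat.cast_smul_eq_nsmul ℝ, smul_smul]
    simp_rw [h1]
    exact ((exp_continuous (𝔸 := 𝔸)).tendsto _).comp (hj.smul_const A)
  have key : Tendsto (fun K => B K ^ j K - exp (d K • A) ^ j K) atTop (𝓝 0) := by
    -- The error term is eventually at most `d K`, so the norm is at most `1 + d K * (‖A‖ + 1)`,
    -- hence at most the exponential.
    have hc : ∀ {F : ℕ → 𝔸}, (fun K => F K - 1 - d K • A) =o[atTop] d →
        ∀ᶠ K in atTop, ‖F K‖ ≤ Real.exp (d K * (‖A‖ + 1)) := fun {F} hF => by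
      filter_upwards [hF.bound one_pos] with K hK
      have h1 : F K = (F K - 1 - d K • A) + 1 + d K • A := by abel
      have h2 : ‖F K‖ ≤ ‖F K - 1 - d K • A‖ + ‖(1 : 𝔸)‖ + ‖d K • A‖ := by
        conv_lhs => rw [h1]
        exact norm_add₃_le
      rw [norm_one, norm_smul, Real.norm_of_nonneg (hd0 K)] at h2
      rw [Real.norm_of_nonneg (hd0 K)] at hK
      have := Real.add_one_le_exp (d K * (‖A‖ + 1))
      linarith
    have hbound : Tendsto (fun K => (j K * d K) * (‖B K - exp (d K • A)‖ / d K) *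
        Real.exp ((j K * d K) * (‖A‖ + 1))) atTop (𝓝 0) := by
      have h2 : Tendsto (fun K => ‖B K - exp (d K • A)‖ / d K) atTop (𝓝 0) :=
        hBC.norm_left.tendsto_div_nhds_zero
      have h3 : Tendsto (fun K => Real.exp ((j K * d K) * (‖A‖ + 1))) atTop
          (𝓝 (Real.exp (t * (‖A‖ + 1)))) :=
        (Real.continuous_exp.tendsto _).comp (hj.mul_const _)
      simpa using (hj.mul h2).mul h3
    refine squeeze_zero_norm' ?_ hbound
    filter_upwards [hc hB, hc hC, hBC.bound one_pos] with K h1 h2 h3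
    refine (norm_pow_sub_pow_le _ _ _ h1 h2 (Real.one_le_exp ?_) _).trans (le_of_eq ?_)
    · have := hd0 K; positivity
    · rw [← Real.exp_nat_mul]
      -- If `d K = 0` the quotient by `d K` is the default value `0`, but then the `o(d K)` bound
      -- forces the two elements to coincide. This case arises for `T = 0`.
      rcases (hd0 K).eq_or_lt with h | h
      · rw [← h] at h3 ⊢
        simp only [norm_zero, mul_zero] at h3
        have := le_antisymm h3 (norm_nonneg _)
        rw [this]; simp
      · field_simp
  simpa using key.add hCj

variable {V : Type*} [NormedAddCommGroup V] [NormedSpace ℝ V] [CompleteSpace V]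

theorem exp_smul_apply_exp_smul_apply (L : V →L[ℝ] V) (a b : ℝ) (v : V) :
    exp (a • L) (exp (b • L) v) = exp ((a + b) • L) v := by
  let _ : NormedAlgebra ℚ (V →L[ℝ] V) := .restrictScalars ℚ ℝ _
  rw [add_smul, exp_add_of_commute]
  · rfl
  · exact ((Commute.refl L).smul_left a).smul_right b

theorem continuous_exp_smul_apply (L : V →L[ℝ] V) :
    Continuous fun p : ℝ × V => exp (p.1 • L) p.2 := by
  let _ : NormedAlgebra ℚ (V →L[ℝ] V) := .restrictScalars ℚ ℝ _
  have h : Continuous fun p : ℝ × V => exp (p.1 • L) :=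
    (exp_continuous (𝔸 := V →L[ℝ] V)).comp (continuous_fst.smul continuous_const)
  exact h.clm_apply continuous_snd

theorem hasDerivAt_exp_apply (L : V →L[ℝ] V) (v : V) (a t : ℝ) :
    HasDerivAt (fun t : ℝ => exp ((t - a) • L) v) (L (exp ((t - a) • L) v)) t := by
  have h := (hasDerivAt_exp_smul_const' (𝕂 := ℝ) L (t - a)).scomp t ((hasDerivAt_id t).sub_const a)
  simpa using h.clm_apply (hasDerivAt_const t v)

/-- The integrating factor `exp ((x - a) • (-L))` turns `u` into a function with zero derivative on
a convex set. -/
theorem eq_exp_apply_of_hasDerivWithinAt (L : V →L[ℝ] V) {s : Set ℝ} (hs : Convex ℝ s)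
    {u : ℝ → V} (hu : ∀ t ∈ s, HasDerivWithinAt u (L (u t)) s t) {a t : ℝ} (ha : a ∈ s)
    (ht : t ∈ s) : u t = exp ((t - a) • L) (u a) := by
  have hd : ∀ x ∈ s, HasDerivWithinAt (fun x => exp ((x - a) • (-L)) (u x)) 0 s x := fun x hx => by
    have h := ((hasDerivAt_exp_smul_const (𝕂 := ℝ) (-L) (x - a)).scomp x
      ((hasDerivAt_id x).sub_const a)).hasDerivWithinAt (s := s)
    simpa using h.clm_apply (hu x hx)
  have h := hs.norm_image_sub_le_of_norm_hasDerivWithin_le hd (C := 0) (by simp) ha ht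
  have h1 : exp ((t - a) • (-L)) (u t) = u a := by
    simpa [sub_eq_zero] using h
  rw [← h1, smul_neg, ← neg_smul, exp_smul_apply_exp_smul_apply]
  simp

end Exponential

/-! ### Matrices acting on row and column vectors; positivity and adjointness of their exponentials
-/

section MatrixOperators

variable {n : ℕ}

/-- Right multiplication of row vectors by a matrix, as a continuous linear map. -/
def rowOp (A : Matrix (Fin n) (Fin n) ℝ) : (Fin n → ℝ) →L[ℝ] (Fin n → ℝ) :=
  LinearMap.toContinuousLinearMap A.vecMulLinear

/-- Left multiplication of column vectors by a matrix, as a continuous linear map. -/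
def colOp (A : Matrix (Fin n) (Fin n) ℝ) : (Fin n → ℝ) →L[ℝ] (Fin n → ℝ) :=
  LinearMap.toContinuousLinearMap A.mulVecLin

@[simp] theorem rowOp_apply (A : Matrix (Fin n) (Fin n) ℝ) (v : Fin n → ℝ) :
    rowOp A v = v ᵥ* A := rfl

@[simp] theorem colOp_apply (A : Matrix (Fin n) (Fin n) ℝ) (v : Fin n → ℝ) :
    colOp A v = A *ᵥ v := rfl

theorem colOp_neg (A : Matrix (Fin n) (Fin n) ℝ) : colOp (-A) = -colOp A := by
  ext1 v; simp [Matrix.neg_mulVec]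

/-- Write `u • L = -(c * u) + N` with `N = u • (L + c • 1)`. The scalar part commutes and factors
out, `N` preserves the nonnegative cone, and the left side keeps only the first two terms of the
series of `exp N v`. -/
theorem exp_smul_apply_ge (L : (Fin n → ℝ) →L[ℝ] (Fin n → ℝ)) (c : ℝ)
    (hL : ∀ v, 0 ≤ v → 0 ≤ L v + c • v) {u : ℝ} (hu : 0 ≤ u) {v : Fin n → ℝ} (hv : 0 ≤ v) :
    Real.exp (-(c * u)) • (v + u • (L v + c • v)) ≤ exp (u • L) v := by
  let _ : NormedAlgebra ℚ ((Fin n → ℝ) →L[ℝ] (Fin n → ℝ)) := .restrictScalars ℚ ℝ _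
  set N : (Fin n → ℝ) →L[ℝ] (Fin n → ℝ) := u • (L + c • 1) with hN
  have hNv : ∀ w, N w = u • (L w + c • w) := fun w => by simp [hN]
  have hpos : ∀ k : ℕ, 0 ≤ (N ^ k) v := fun k => by
    induction k with
    | zero => simpa using hv
    | succ k ih =>
      rw [pow_succ']
      change 0 ≤ N ((N ^ k) v)
      rw [hNv]
      exact smul_nonneg hu (hL _ ih)
  have hsplit : u • L = algebraMap ℝ _ (-(c * u)) + N := by
    rw [hN, Algebra.algebraMap_eq_smul_one]; module
  have hexp : exp (u • L) v = Real.exp (-(c * u)) • exp N v := by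
    rw [hsplit, exp_add_of_commute (Algebra.commutes _ _), ← algebraMap_exp_comm,
      Algebra.algebraMap_eq_smul_one, Real.exp_eq_exp_ℝ]
    simp
  have hsum : HasSum (fun k : ℕ => ((k.factorial : ℝ)⁻¹ • N ^ k) v) (exp N v) := by
    have := exp_series_hasSum_exp' (𝕂 := ℝ) N
    exact this.mapL (ContinuousLinearMap.apply ℝ (Fin n → ℝ) v)
  rw [hexp]
  refine smul_le_smul_of_nonneg_left ?_ (Real.exp_pos _).le
  have hterm : ∀ k ∉ Finset.range 2, 0 ≤ ((k.factorial : ℝ)⁻¹ • N ^ k) v := fun k _ =>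
    smul_nonneg (by positivity : (0 : ℝ) ≤ (k.factorial : ℝ)⁻¹) (hpos k)
  have := sum_le_hasSum (Finset.range 2) hterm hsum
  simpa [Finset.sum_range_succ, hNv] using this

variable {A : Matrix (Fin n) (Fin n) ℝ}

/-- Quantitative positivity of the semigroup: order zero of the series keeps the mass at `j`, order
one moves mass from `i` to `j`. The shift `c = ∑ k, |A k k|` makes the diagonal of `A + c`
nonnegative. -/
theorem exp_rowOp_ge (hA : ∀ i j, i ≠ j → 0 ≤ A i j) {u : ℝ} (hu : 0 ≤ u) {v : Fin n → ℝ}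
    (hv : 0 ≤ v) : ∃ e > 0, ∀ i j, e * v j ≤ (exp (u • rowOp A) v) j ∧
      (i ≠ j → e * (u * (v i * A i j)) ≤ (exp (u • rowOp A) v) j) := by
  set c := ∑ k, |A k k| with hc
  have hcj : ∀ j, 0 ≤ A j j + c := fun j => by
    have := Finset.single_le_sum (f := fun k => |A k k|) (fun k _ => abs_nonneg _)
      (Finset.mem_univ j)
    have := neg_abs_le (A j j)
    linarith
  have hcoord : ∀ w : Fin n → ℝ, ∀ j, (rowOp A w + c • w) j =
      w j * (A j j + c) + ∑ k ∈ Finset.univ.erase j, w k * A k j := fun w j => by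
    have : (w ᵥ* A) j = ∑ k, w k * A k j := rfl
    simp only [Pi.add_apply, rowOp_apply, this, Pi.smul_apply, smul_eq_mul,
      ← Finset.add_sum_erase _ _ (Finset.mem_univ j)]
    ring
  have hL : ∀ w, 0 ≤ w → 0 ≤ rowOp A w + c • w := fun w hw j => by
    rw [hcoord]
    exact add_nonneg (mul_nonneg (hw j) (hcj j)) (Finset.sum_nonneg fun k hk =>
      mul_nonneg (hw k) (hA k j (Finset.ne_of_mem_erase hk)))
  have key := exp_smul_apply_ge (rowOp A) c hL hu hv
  refine ⟨_, Real.exp_pos (-(c * u)), fun i j => ?_⟩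
  have hj := key j
  have hLj : 0 ≤ (rowOp A v + c • v) j := hL v hv j
  simp only [Pi.smul_apply, Pi.add_apply (f := v), smul_eq_mul] at hj
  constructor
  · refine le_trans ?_ hj
    gcongr
    nlinarith
  · intro hij
    refine le_trans ?_ hj
    gcongr
    have : v i * A i j ≤ (rowOp A v + c • v) j := by
      rw [hcoord]
      have h1 := Finset.single_le_sum (f := fun k => v k * A k j) (fun k hk =>
        mul_nonneg (hv k) (hA k j (Finset.ne_of_mem_erase hk)))
        (Finset.mem_erase.2 ⟨hij, Finset.mem_univ i⟩)
      have h2 := mul_nonneg (hv j) (hcj j)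
      linarith
    have hvj : 0 ≤ v j := hv j
    nlinarith [mul_le_mul_of_nonneg_left this hu]

theorem exp_rowOp_nonneg (hA : ∀ i j, i ≠ j → 0 ≤ A i j) {u : ℝ} (hu : 0 ≤ u) {v : Fin n → ℝ}
    (hv : 0 ≤ v) : 0 ≤ exp (u • rowOp A) v := fun j => by
  obtain ⟨e, he, h⟩ := exp_rowOp_ge hA hu hv
  exact (mul_nonneg he.le (hv j)).trans (h j j).1

theorem exp_rowOp_pos_self (hA : ∀ i j, i ≠ j → 0 ≤ A i j) {u : ℝ} (hu : 0 ≤ u)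
    {v : Fin n → ℝ} (hv : 0 ≤ v) {i : Fin n} (hi : 0 < v i) : 0 < (exp (u • rowOp A) v) i := by
  obtain ⟨e, he, h⟩ := exp_rowOp_ge hA hu hv
  exact (mul_pos he hi).trans_le (h i i).1

theorem exp_rowOp_pos_of_pos (hA : ∀ i j, i ≠ j → 0 ≤ A i j) {u : ℝ} (hu : 0 < u)
    {v : Fin n → ℝ} (hv : 0 ≤ v) {i j : Fin n} (hi : 0 < v i) (hij : i ≠ j) (hAij : 0 < A i j) :
    0 < (exp (u • rowOp A) v) j := by
  obtain ⟨e, he, h⟩ := exp_rowOp_ge hA hu.le hv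
  exact (by positivity : 0 < e * (u * (v i * A i j))).trans_le ((h i j).2 hij)

/-- The derivative of the pairing in `t` is `(v A) ⬝ w - v ⬝ (A w)` along the flow, which vanishes.
-/
theorem exp_rowOp_dotProduct (t : ℝ) (v w : Fin n → ℝ) :
    exp (t • rowOp A) v ⬝ᵥ exp (t • colOp (-A)) w = v ⬝ᵥ w := by
  have hd : ∀ x ∈ univ, HasDerivWithinAt
      (fun x : ℝ => exp ((x - 0) • rowOp A) v ⬝ᵥ exp ((x - 0) • colOp (-A)) w) 0 univ x := by
    intro x _
    have h1 := hasDerivAt_pi.1 (hasDerivAt_exp_apply (rowOp A) v 0 x)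
    have h2 := hasDerivAt_pi.1 (hasDerivAt_exp_apply (colOp (-A)) w 0 x)
    have h3 := HasDerivAt.fun_sum (u := Finset.univ) fun i _ => (h1 i).mul (h2 i)
    refine (h3.congr_deriv ?_).hasDerivWithinAt
    rw [Finset.sum_add_distrib]
    change (exp ((x - 0) • rowOp A) v ᵥ* A) ⬝ᵥ exp ((x - 0) • colOp (-A)) w +
      exp ((x - 0) • rowOp A) v ⬝ᵥ ((-A) *ᵥ exp ((x - 0) • colOp (-A)) w) = 0
    rw [Matrix.dotProduct_mulVec, Matrix.vecMul_neg, neg_dotProduct, add_neg_cancel]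
  have h := convex_univ.norm_image_sub_le_of_norm_hasDerivWithin_le hd (C := 0) (by simp)
    (mem_univ 0) (mem_univ t)
  simpa [sub_eq_zero] using h

theorem exp_rowOp_dotProduct_eq (t : ℝ) (v w : Fin n → ℝ) :
    exp (t • rowOp A) v ⬝ᵥ w = v ⬝ᵥ exp (t • colOp A) w := by
  rw [← exp_rowOp_dotProduct (A := A) t v, colOp_neg, smul_neg, ← neg_smul,
    exp_smul_apply_exp_smul_apply]
  simp

end MatrixOperators

end

end CTHMM

namespace CTHMM

noncomputable section

/-! ### Step paths, their partitions, and how a uniform grid sees their jumps -/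

section StepPaths

variable {E : Type*} {T : ℝ} {y : ℝ → E} {S : ℕ} {τ : ℕ → ℝ}

theorem strictMonoOn_of_lt_succ (hlt : ∀ s < S, τ s < τ (s + 1)) {s s' : ℕ} (h : s < s')
    (hs' : s' ≤ S) : τ s < τ s' := by
  induction s', h using Nat.le_induction with
  | base => exact hlt s (by omega)
  | succ k hk ih => exact (ih (by omega)).trans (hlt k (by omega))

theorem monoOn_of_lt_succ (hlt : ∀ s < S, τ s < τ (s + 1)) {s s' : ℕ} (h : s ≤ s')
    (hs' : s' ≤ S) : τ s ≤ τ s' := by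
  rcases h.eq_or_lt with rfl | h
  · rfl
  · exact (strictMonoOn_of_lt_succ hlt h hs').le

theorem mem_piece_iff (hlt : ∀ s < S, τ s < τ (s + 1)) (hle : τ S ≤ T) {s : ℕ} {t : ℝ} :
    t ∈ piece T S τ s ↔ τ s ≤ t ∧ t ≤ T ∧ (s < S → t < τ (s + 1)) := by
  unfold piece
  split_ifs with h
  · have := monoOn_of_lt_succ hlt h le_rfl
    simp only [mem_Ico, h, forall_const]
    constructor
    · rintro ⟨h1, h2⟩
      exact ⟨h1, by linarith, h2⟩
    · rintro ⟨h1, -, h2⟩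
      exact ⟨h1, h2⟩
  · simp [h]

theorem convex_piece (s : ℕ) : Convex ℝ (piece T S τ s) := by
  unfold piece
  split_ifs
  · exact convex_Ico _ _
  · exact convex_Icc _ _

/-- A right-continuous step function has a partition consisting of its discontinuities. -/
theorem exists_isJumpPartition (S : ℕ) : ∀ τ : ℕ → ℝ, τ 0 = 0 → (∀ s < S, τ s < τ (s + 1)) →
    τ S ≤ T → ConstOnPieces T y S τ → ∃ S' τ', IsJumpPartition T y S' τ' := by
  induction S with
  | zero => exact fun τ h0 hlt hle hc => ⟨0, τ, h0, hlt, hle, hc, by simp⟩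
  | succ S ih =>
    intro τ h0 hlt hle hc
    by_cases hne : ∀ s < S + 1, y (τ (s + 1)) ≠ y (τ s)
    · exact ⟨S + 1, τ, h0, hlt, hle, hc, hne⟩
    push Not at hne
    obtain ⟨q, hq, hyq⟩ := hne
    -- The node `τ (q + 1)`, across which `y` does not change, is deleted; pieces `q` and `q + 1`
    -- merge and the number of nodes drops.
    set τ' : ℕ → ℝ := fun k => if k ≤ q then τ k else τ (k + 1) with hτ'
    have hlt' : ∀ s < S, τ' s < τ' (s + 1) := fun s hs => by
      simp only [hτ']
      split_ifs
      · exact hlt s (by omega)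
      · exact (hlt s (by omega)).trans (hlt (s + 1) (by omega))
      · omega
      · exact hlt (s + 1) (by omega)
    have hle' : τ' S ≤ T := by
      simp only [hτ']
      split_ifs
      · exact (hlt S (by omega)).le.trans hle
      · exact hle
    refine ih τ' (by simp [hτ', h0]) hlt' hle' ?_
    intro s hs t ht
    rw [mem_piece_iff hlt' hle'] at ht
    obtain ⟨h1, h2, h3⟩ := ht
    simp only [hτ'] at h1 h3 ⊢
    rcases lt_trichotomy s q with hsq | rfl | hsq
    · rw [if_pos hsq.le] at h1 ⊢
      rw [if_pos (by omega : s + 1 ≤ q)] at h3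
      exact hc s (by omega) t ((mem_piece_iff hlt hle).2 ⟨h1, h2, fun _ => h3 (by omega)⟩)
    · rw [if_pos le_rfl] at h1 ⊢
      rw [if_neg (by omega : ¬ s + 1 ≤ s)] at h3
      rcases lt_or_ge t (τ (s + 1)) with h | h
      · exact hc s (by omega) t ((mem_piece_iff hlt hle).2 ⟨h1, h2, fun _ => h⟩)
      · rw [hc (s + 1) (by omega) t ((mem_piece_iff hlt hle).2
          ⟨h, h2, fun _ => h3 (by omega)⟩), hyq]
    · rw [if_neg (by omega : ¬ s ≤ q)] at h1 ⊢
      rw [if_neg (by omega : ¬ s + 1 ≤ q)] at h3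
      exact hc (s + 1) (by omega) t ((mem_piece_iff hlt hle).2
        ⟨h1, h2, fun _ => h3 (by omega)⟩)

/-- The index of the piece that contains `t`. -/
def pieceIndex (S : ℕ) (τ : ℕ → ℝ) (t : ℝ) : ℕ :=
  open Classical in Nat.findGreatest (fun s => τ s ≤ t) S

theorem pieceIndex_le (t : ℝ) : pieceIndex S τ t ≤ S := by
  classical exact Nat.findGreatest_le _

theorem le_pieceIndex {s : ℕ} (hs : s ≤ S) {t : ℝ} (h : τ s ≤ t) : s ≤ pieceIndex S τ t := by
  classical exact Nat.le_findGreatest hs h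

theorem lt_of_pieceIndex_lt {s : ℕ} (hs : s ≤ S) {t : ℝ} (h : pieceIndex S τ t < s) :
    t < τ s := by
  by_contra hc
  exact absurd (le_pieceIndex hs (not_lt.1 hc)) (not_le.2 h)

namespace IsJumpPartition

theorem nonneg (hp : IsJumpPartition T y S τ) {s : ℕ} (hs : s ≤ S) : 0 ≤ τ s :=
  hp.zero ▸ monoOn_of_lt_succ hp.lt (Nat.zero_le s) hs

theorem le_T (hp : IsJumpPartition T y S τ) {s : ℕ} (hs : s ≤ S) : τ s ≤ T :=
  (monoOn_of_lt_succ hp.lt hs le_rfl).trans hp.le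

theorem mem_Icc (hp : IsJumpPartition T y S τ) {s : ℕ} (hs : s ≤ S) :
    τ s ∈ Icc 0 T := ⟨hp.nonneg hs, hp.le_T hs⟩

theorem mem_piece_iff (hp : IsJumpPartition T y S τ) {s : ℕ} {t : ℝ} :
    t ∈ piece T S τ s ↔ τ s ≤ t ∧ t ≤ T ∧ (s < S → t < τ (s + 1)) :=
  CTHMM.mem_piece_iff hp.lt hp.le

theorem left_mem_piece (hp : IsJumpPartition T y S τ) {s : ℕ} (hs : s ≤ S) : τ s ∈ piece T S τ s :=
  hp.mem_piece_iff.2 ⟨le_rfl, hp.le_T hs, hp.lt s⟩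

theorem le_of_pieceIndex (hp : IsJumpPartition T y S τ) {t : ℝ} (ht : 0 ≤ t) : τ
    (pieceIndex S τ t) ≤ t := by
  classical
  exact Nat.findGreatest_spec (P := fun s => τ s ≤ t) (Nat.zero_le S) (by rw [hp.zero]; exact ht)

theorem mem_piece (hp : IsJumpPartition T y S τ) {t : ℝ} (ht : t ∈ Icc 0 T) : t ∈ piece T S τ
    (pieceIndex S τ t) :=
  hp.mem_piece_iff.2
    ⟨hp.le_of_pieceIndex ht.1, ht.2, fun h => lt_of_pieceIndex_lt h (Nat.lt_succ_self _)⟩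

theorem eq_pieceIndex (hp : IsJumpPartition T y S τ) {t : ℝ} (ht : t ∈ Icc 0 T) : y t = y
    (τ (pieceIndex S τ t)) :=
  hp.const _ (pieceIndex_le t) t (hp.mem_piece ht)

theorem pieceIndex_eq (hp : IsJumpPartition T y S τ) {s : ℕ} (hs : s ≤ S) {t : ℝ}
    (ht : t ∈ piece T S τ s) :
    pieceIndex S τ t = s := by
  obtain ⟨h1, h2, h3⟩ := hp.mem_piece_iff.1 ht
  refine le_antisymm ?_ (le_pieceIndex hs h1)
  by_contra hc
  have h4 := hp.le_of_pieceIndex ((hp.nonneg hs).trans h1)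
  have h5 := monoOn_of_lt_succ hp.lt (not_le.1 hc : s + 1 ≤ _) (pieceIndex_le t)
  have h6 := h3 (by have := pieceIndex_le (S := S) (τ := τ) t; omega)
  linarith

theorem pieceIndex_zero (hp : IsJumpPartition T y S τ) : pieceIndex S τ 0 = 0 :=
  hp.pieceIndex_eq (Nat.zero_le S) (by have := hp.left_mem_piece (Nat.zero_le S); rwa [hp.zero] at this)

theorem pieceIndex_last (hp : IsJumpPartition T y S τ) : pieceIndex S τ T = S :=
  hp.pieceIndex_eq le_rfl (hp.mem_piece_iff.2 ⟨hp.le, le_rfl, fun h => absurd h (lt_irrefl _)⟩)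

theorem pieceIndex_mono (hp : IsJumpPartition T y S τ) {t t' : ℝ} (ht : 0 ≤ t) (h : t ≤ t') :
    pieceIndex S τ t ≤ pieceIndex S τ t' :=
  le_pieceIndex (pieceIndex_le t) ((hp.le_of_pieceIndex ht).trans h)

theorem pieceIndex_ne_of_ne (hp : IsJumpPartition T y S τ) {t t' : ℝ} (ht : t ∈ Icc 0 T)
    (ht' : t' ∈ Icc 0 T) (h : y t ≠ y t') :
    pieceIndex S τ t ≠ pieceIndex S τ t' := fun he =>
  h (by rw [hp.eq_pieceIndex ht, hp.eq_pieceIndex ht', he])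

end IsJumpPartition

/-- The `k`-th point of the uniform grid with `K` cells on `[0, T]`. -/
def grid (T : ℝ) (K k : ℕ) : ℝ := k * T / K

/-- The index of the first grid point to the right of `t`. -/
def gridCeil (T : ℝ) (K : ℕ) (t : ℝ) : ℕ := ⌈t * K / T⌉₊

/-- The number of indices `l < k` at which the sequence changes value. -/
def changes [DecidableEq E] (x : ℕ → E) (k : ℕ) : ℕ :=
  ∑ l ∈ Finset.range k, if x l = x (l + 1) then 0 else 1

theorem changes_succ [DecidableEq E] (x : ℕ → E) (k : ℕ) :
    changes x (k + 1) = changes x k + if x k = x (k + 1) then 0 else 1 :=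
  Finset.sum_range_succ _ _

@[simp] theorem changes_zero [DecidableEq E] (x : ℕ → E) : changes x 0 = 0 := by
  simp [changes]

section Grid

variable {K : ℕ}

@[simp] theorem grid_zero : grid T K 0 = 0 := by simp [grid]

theorem grid_self (hK : 0 < K) : grid T K K = T := by
  have : (K : ℝ) ≠ 0 := by positivity
  rw [grid]; field_simp

theorem grid_mono (hT : 0 ≤ T) {k l : ℕ} (h : k ≤ l) : grid T K k ≤ grid T K l := by
  unfold grid; gcongr

theorem grid_mem (hT : 0 ≤ T) (hK : 0 < K) {k : ℕ} (hk : k ≤ K) : grid T K k ∈ Icc 0 T :=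
  ⟨by unfold grid; positivity, (grid_mono hT hk).trans_eq (grid_self hK)⟩

theorem grid_succ (k : ℕ) : grid T K (k + 1) = grid T K k + T / K := by
  unfold grid; push_cast; ring

/-- The adjunction through which `gridCeil` is used. -/
theorem gridCeil_le_iff (hK : 0 < K) {t : ℝ} (ht : t ∈ Icc 0 T) {k : ℕ} :
    gridCeil T K t ≤ k ↔ t ≤ grid T K k := by
  have hK' : (0 : ℝ) < K := by positivity
  rw [gridCeil, grid, Nat.ceil_le]
  -- For `T = 0` the division by zero returns `0`, which is the right index for the only possible
  -- time `t = 0`.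
  rcases (ht.1.trans ht.2).eq_or_lt with h | h
  · subst h
    have : t = 0 := le_antisymm ht.2 ht.1
    subst this
    simp
  · rw [div_le_iff₀ h, le_div_iff₀ hK']

theorem gridCeil_le (hK : 0 < K) {t : ℝ} (ht : t ∈ Icc 0 T) : gridCeil T K t ≤ K :=
  (gridCeil_le_iff hK ht).2 (by rw [grid_self hK]; exact ht.2)

theorem le_grid_gridCeil (hK : 0 < K) {t : ℝ} (ht : t ∈ Icc 0 T) :
    t ≤ grid T K (gridCeil T K t) := (gridCeil_le_iff hK ht).1 le_rfl

theorem grid_gridCeil_le (hK : 0 < K) {t : ℝ} (ht : t ∈ Icc 0 T) :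
    grid T K (gridCeil T K t) ≤ t + T / K := by
  have h0 : 0 ≤ T / K := div_nonneg (ht.1.trans ht.2) (Nat.cast_nonneg K)
  rcases Nat.eq_zero_or_pos (gridCeil T K t) with h | h
  · rw [h, grid_zero]
    exact add_nonneg ht.1 h0
  · obtain ⟨k, hk⟩ := Nat.exists_eq_succ_of_ne_zero h.ne'
    have : ¬ t ≤ grid T K k := by rw [← gridCeil_le_iff hK ht]; omega
    rw [hk, Nat.succ_eq_add_one, grid_succ]
    linarith

theorem tendsto_mesh (T : ℝ) : Tendsto (fun K : ℕ => T / K) atTop (𝓝 0) :=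
  tendsto_const_div_atTop_nhds_zero_nat T

theorem tendsto_grid_gridCeil {t : ℝ} (ht : t ∈ Icc 0 T) :
    Tendsto (fun K => grid T K (gridCeil T K t)) atTop (𝓝 t) := by
  have h : Tendsto (fun K : ℕ => t + T / K) atTop (𝓝 t) := by
    simpa using (tendsto_mesh T).const_add t
  refine tendsto_of_tendsto_of_tendsto_of_le_of_le' tendsto_const_nhds h ?_ ?_
  · filter_upwards [eventually_gt_atTop 0] with K hK using le_grid_gridCeil hK ht
  · filter_upwards [eventually_gt_atTop 0] with K hK using grid_gridCeil_le hK ht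

theorem gridCeil_zero : gridCeil T K 0 = 0 := by simp [gridCeil]

end Grid

namespace IsJumpPartition

variable {K : ℕ}

/-- The sampling point is at or to the right of `t` and tends to `t`, so right-continuity puts it
into the piece of `t`. This is why grid indices are rounded up. -/
theorem eventually_pieceIndex_gridCeil (hp : IsJumpPartition T y S τ) (hT : 0 ≤ T) {t : ℝ}
    (ht : t ∈ Icc 0 T) :
    ∀ᶠ K in atTop, pieceIndex S τ (grid T K (gridCeil T K t)) = pieceIndex S τ t := by
  have h : ∀ᶠ K in atTop, pieceIndex S τ t < S →
      grid T K (gridCeil T K t) < τ (pieceIndex S τ t + 1) := by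
    by_cases hS : pieceIndex S τ t < S
    · filter_upwards [(tendsto_grid_gridCeil ht).eventually_lt_const
        (lt_of_pieceIndex_lt hS (Nat.lt_succ_self _))] with K hK _ using hK
    · exact Eventually.of_forall fun K h => absurd h hS
  filter_upwards [eventually_gt_atTop 0, h] with K hK hlt
  exact hp.pieceIndex_eq (pieceIndex_le t) (hp.mem_piece_iff.2
    ⟨(hp.le_of_pieceIndex ht.1).trans (le_grid_gridCeil hK ht),
      (grid_mem hT hK (gridCeil_le hK ht)).2, hlt⟩)

theorem eventually_grid_gridCeil (hp : IsJumpPartition T y S τ) (hT : 0 ≤ T) {t : ℝ}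
    (ht : t ∈ Icc 0 T) :
    ∀ᶠ K in atTop, y (grid T K (gridCeil T K t)) = y t := by
  filter_upwards [eventually_gt_atTop 0, hp.eventually_pieceIndex_gridCeil hT ht] with K hK h
  rw [hp.eq_pieceIndex (grid_mem hT hK (gridCeil_le hK ht)), h, ← hp.eq_pieceIndex ht]

/-- A change of value across a cell requires at least one node in it, so `changes` never grows
faster than `pieceIndex`. The additive form avoids subtraction in `ℕ`. -/
theorem changes_add_pieceIndex_le (hp : IsJumpPartition T y S τ) (hT : 0 ≤ T) [DecidableEq E]
    (hK : 0 < K) {k k' : ℕ} (h : k ≤ k')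
    (hk' : k' ≤ K) :
    changes (fun l => y (grid T K l)) k' + pieceIndex S τ (grid T K k) ≤
      changes (fun l => y (grid T K l)) k + pieceIndex S τ (grid T K k') := by
  induction k', h using Nat.le_induction with
  | base => rfl
  | succ l hl ih =>
    have h1 := ih (by omega)
    have hm := grid_mem hT hK (by omega : l ≤ K)
    have h2 := hp.pieceIndex_mono hm.1 (grid_mono (K := K) hT (Nat.le_succ l))
    rw [changes_succ]
    split_ifs with he
    · simp only [Nat.succ_eq_add_one] at h2; omega
    · have h3 := hp.pieceIndex_ne_of_ne hm (grid_mem hT hK hk') he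
      simp only [Nat.succ_eq_add_one] at h2; omega

/-- Once the total counts agree, the inequality between increments must be an equality on `[0, k]`
and on `[k, K]`; no bound on the mesh is needed. -/
theorem changes_eq_pieceIndex (hp : IsJumpPartition T y S τ) (hT : 0 ≤ T) [DecidableEq E]
    (hK : 0 < K)
    (hS : changes (fun l => y (grid T K l)) K = S) {k : ℕ} (hk : k ≤ K) :
    changes (fun l => y (grid T K l)) k = pieceIndex S τ (grid T K k) := by
  have h1 := hp.changes_add_pieceIndex_le hT hK (Nat.zero_le k) hk
  have h2 := hp.changes_add_pieceIndex_le hT hK hk le_rfl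
  rw [grid_self hK, hp.pieceIndex_last, hS] at h2
  simp only [grid_zero, changes_zero, hp.pieceIndex_zero] at h1
  omega

theorem eventually_mesh_lt (hp : IsJumpPartition T y S τ) : ∀ᶠ K :
    ℕ in atTop, 0 < K ∧ ∀ s < S, T / K < τ (s + 1) - τ s := by
  refine (eventually_gt_atTop 0).and ?_
  have : ∀ᶠ K : ℕ in atTop, ∀ s ∈ Finset.range S, T / K < τ (s + 1) - τ s := by
    rw [Filter.eventually_all_finset]
    intro s hs
    exact (tendsto_mesh T).eventually_lt_const (sub_pos.2 (hp.lt s (Finset.mem_range.1 hs)))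
  filter_upwards [this] with K hK s hs using hK s (Finset.mem_range.2 hs)

theorem pieceIndex_grid_succ_le (hp : IsJumpPartition T y S τ) (hT : 0 ≤ T) (hK : 0 < K)
    (hm : ∀ s < S, T / K < τ (s + 1) - τ s) {k : ℕ}
    (hk : k < K) :
    pieceIndex S τ (grid T K (k + 1)) ≤ pieceIndex S τ (grid T K k) + 1 := by
  by_contra hc
  push Not at hc
  set s := pieceIndex S τ (grid T K k) with hs
  have hle := pieceIndex_le (S := S) (τ := τ) (grid T K (k + 1))
  have h1 : grid T K k < τ (s + 1) := lt_of_pieceIndex_lt (by omega) (Nat.lt_succ_self _)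
  have h2 := hp.le_of_pieceIndex (grid_mem hT hK hk).1
  have h3 := monoOn_of_lt_succ hp.lt (hc : s + 1 + 1 ≤ _) hle
  have h4 := hm (s + 1) (by omega)
  rw [Nat.succ_eq_add_one, grid_succ] at *
  linarith

/-- A mesh below every gap leaves at most one node per cell, so the value cannot jump away and
return unseen inside a cell. -/
theorem changes_eq_pieceIndex_of_mesh_lt (hp : IsJumpPartition T y S τ) (hT : 0 ≤ T)
    [DecidableEq E] (hK : 0 < K)
    (hm : ∀ s < S, T / K < τ (s + 1) - τ s) {k : ℕ} (hk : k ≤ K) :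
    changes (fun l => y (grid T K l)) k = pieceIndex S τ (grid T K k) := by
  induction k with
  | zero => simp [hp.pieceIndex_zero]
  | succ k ih =>
    have h1 := hp.pieceIndex_grid_succ_le hT hK hm hk
    have hmem := grid_mem hT hK (by omega : k ≤ K)
    have h2 := hp.pieceIndex_mono hmem.1 (grid_mono (K := K) hT (Nat.le_succ k))
    rw [changes_succ, ih (by omega)]
    simp only [Nat.succ_eq_add_one] at h2
    split_ifs with he
    · rw [hp.eq_pieceIndex hmem, hp.eq_pieceIndex (grid_mem hT hK hk)] at he
      by_contra hc
      have h3 : pieceIndex S τ (grid T K (k + 1)) = pieceIndex S τ (grid T K k) + 1 := by omega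
      rw [h3] at he
      exact hp.ne _ (by have := pieceIndex_le (S := S) (τ := τ) (grid T K (k + 1)); omega) he.symm
    · have h3 := hp.pieceIndex_ne_of_ne hmem (grid_mem hT hK hk) he
      omega

theorem eventually_changes_eq (hp : IsJumpPartition T y S τ) (hT : 0 ≤ T) [DecidableEq E] :
    ∀ᶠ K in atTop, changes (fun l => y (grid T K l)) K = S := by
  filter_upwards [hp.eventually_mesh_lt] with K hK
  rw [hp.changes_eq_pieceIndex_of_mesh_lt hT hK.1 hK.2 le_rfl, grid_self hK.1, hp.pieceIndex_last]

end IsJumpPartition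

end StepPaths

end

end CTHMM

open NormedSpace
open scoped Matrix

namespace CTHMM

noncomputable section

/-! ### Existence, uniqueness and pairing of the forward and backward solutions -/

section Solutions

variable {n m : ℕ} {T : ℝ} {Q : Matrix (Fin n) (Fin n) ℝ} {r : Fin n → Fin m → ℝ}
  {π₀ : Fin n → ℝ} {y : ℝ → Fin m} {S : ℕ} {τ : ℕ → ℝ} {α β : ℝ → Fin n → ℝ}

/-- The coefficient matrix of both equations while the observation is `y`. -/
abbrev heldRate (Q : Matrix (Fin n) (Fin n) ℝ) (r : Fin n → Fin m → ℝ) (y : Fin m) :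
    Matrix (Fin n) (Fin n) ℝ := D Q + (Q - D Q) * R r y

/-- The matrix applied when the observation jumps to `y`. -/
abbrev jumpRate (Q : Matrix (Fin n) (Fin n) ℝ) (r : Fin n → Fin m → ℝ) (y : Fin m) :
    Matrix (Fin n) (Fin n) ℝ := (Q - D Q) * R r y

theorem piece_mem_nhdsLT (hp : IsJumpPartition T y S τ) {s : ℕ} (hs : s < S) :
    piece T S τ s ∈ 𝓝[<] (τ (s + 1)) := by
  rw [piece, if_pos hs]
  exact Ico_mem_nhdsLT (hp.lt s hs)

section Forward

theorem IsForwardSolution.eq_exp (h : IsForwardSolution T Q r π₀ y S τ α) {s : ℕ} (hs : s ≤ S)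
    {t u : ℝ} (ht : t ∈ piece T S τ s) (hu : u ∈ piece T S τ s) :
    α t = exp ((t - u) • rowOp (heldRate Q r (y (τ s)))) (α u) :=
  eq_exp_apply_of_hasDerivWithinAt _ (convex_piece s) (h.ode s hs) hu ht

theorem tendsto_exp_apply_nhdsLT (L : (Fin n → ℝ) →L[ℝ] (Fin n → ℝ)) (a b : ℝ) (v : Fin n → ℝ) :
    Tendsto (fun t => exp ((t - a) • L) v) (𝓝[<] b) (𝓝 (exp ((b - a) • L) v)) :=
  (hasDerivAt_exp_apply L v a b).continuousAt.tendsto.mono_left nhdsWithin_le_nhds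

theorem IsForwardSolution.tendsto_left (hp : IsJumpPartition T y S τ)
    (h : IsForwardSolution T Q r π₀ y S τ α) {s : ℕ} (hs : s < S) :
    Tendsto α (𝓝[<] (τ (s + 1)))
      (𝓝 (exp ((τ (s + 1) - τ s) • rowOp (heldRate Q r (y (τ s)))) (α (τ s)))) := by
  refine (tendsto_exp_apply_nhdsLT _ _ _ _).congr' ?_
  filter_upwards [piece_mem_nhdsLT hp hs] with t ht
  exact (h.eq_exp hs.le ht (hp.left_mem_piece hs.le)).symm

theorem IsForwardSolution.apply_succ (hp : IsJumpPartition T y S τ)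
    (h : IsForwardSolution T Q r π₀ y S τ α) {s : ℕ} (hs : s < S) :
    α (τ (s + 1)) = exp ((τ (s + 1) - τ s) • rowOp (heldRate Q r (y (τ s)))) (α (τ s)) ᵥ*
      jumpRate Q r (y (τ (s + 1))) := by
  obtain ⟨a, ha, hαa⟩ := h.jump (s + 1) (by omega) hs
  rw [hαa, tendsto_nhds_unique ha (h.tendsto_left hp hs)]

theorem IsForwardSolution.eqOn (hp : IsJumpPartition T y S τ) {α' : ℝ → Fin n → ℝ}
    (h : IsForwardSolution T Q r π₀ y S τ α) (h' : IsForwardSolution T Q r π₀ y S τ α') :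
    EqOn α' α (Icc 0 T) := by
  have key : ∀ s ≤ S, α' (τ s) = α (τ s) := fun s hs => by
    induction s with
    | zero => rw [hp.zero, h.init, h'.init]
    | succ s ih => rw [h.apply_succ hp hs, h'.apply_succ hp hs, ih (by omega)]
  intro t ht
  have hs := pieceIndex_le (S := S) (τ := τ) t
  rw [h.eq_exp hs (hp.mem_piece ht) (hp.left_mem_piece hs),
    h'.eq_exp hs (hp.mem_piece ht) (hp.left_mem_piece hs), key _ hs]

/-- The values at the discontinuities of the solution of the forward equation. -/
def forwardNode (Q : Matrix (Fin n) (Fin n) ℝ) (r : Fin n → Fin m → ℝ) (π₀ : Fin n → ℝ)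
    (y : ℝ → Fin m) (τ : ℕ → ℝ) : ℕ → Fin n → ℝ
  | 0 => π₀ ᵥ* R r (y 0)
  | s + 1 => exp ((τ (s + 1) - τ s) • rowOp (heldRate Q r (y (τ s))))
      (forwardNode Q r π₀ y τ s) ᵥ* jumpRate Q r (y (τ (s + 1)))

/-- The solution of the forward equation. -/
def forward (Q : Matrix (Fin n) (Fin n) ℝ) (r : Fin n → Fin m → ℝ) (π₀ : Fin n → ℝ)
    (y : ℝ → Fin m) (S : ℕ) (τ : ℕ → ℝ) (t : ℝ) : Fin n → ℝ :=
  exp ((t - τ (pieceIndex S τ t)) • rowOp (heldRate Q r (y (τ (pieceIndex S τ t)))))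
    (forwardNode Q r π₀ y τ (pieceIndex S τ t))

theorem isForwardSolution_forward (hp : IsJumpPartition T y S τ) :
    IsForwardSolution T Q r π₀ y S τ (forward Q r π₀ y S τ) := by
  have hpiece : ∀ s ≤ S, ∀ t ∈ piece T S τ s, forward Q r π₀ y S τ t =
      exp ((t - τ s) • rowOp (heldRate Q r (y (τ s)))) (forwardNode Q r π₀ y τ s) :=
    fun s hs t ht => by rw [forward, hp.pieceIndex_eq hs ht]
  have hnode : ∀ s ≤ S, forward Q r π₀ y S τ (τ s) = forwardNode Q r π₀ y τ s := fun s hs => by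
    rw [hpiece s hs _ (hp.left_mem_piece hs)]; simp
  refine ⟨?_, fun s hs t ht => ?_, fun s hs1 hs => ?_⟩
  · have := hnode 0 (Nat.zero_le S)
    rwa [hp.zero] at this
  · rw [hpiece s hs t ht]
    exact (hasDerivAt_exp_apply _ _ _ _).hasDerivWithinAt.congr (hpiece s hs) (hpiece s hs t ht)
  · obtain ⟨s, rfl⟩ := Nat.exists_eq_add_of_le' hs1
    refine ⟨_, (tendsto_exp_apply_nhdsLT (rowOp (heldRate Q r (y (τ s)))) (τ s) _
      (forwardNode Q r π₀ y τ s)).congr' ?_, ?_⟩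
    · filter_upwards [piece_mem_nhdsLT hp hs] with t ht
      exact (hpiece s (by omega) t ht).symm
    · rw [hnode _ hs, forwardNode]

end Forward

section Backward

theorem IsBackwardSolution.eq_exp (h : IsBackwardSolution T Q r y S τ β) {s : ℕ} (hs : s ≤ S)
    {t u : ℝ} (ht : t ∈ piece T S τ s) (hu : u ∈ piece T S τ s) :
    β t = exp ((u - t) • colOp (heldRate Q r (y (τ s)))) (β u) := by
  rw [eq_exp_apply_of_hasDerivWithinAt (-colOp (heldRate Q r (y (τ s)))) (convex_piece s)
    (h.ode s hs) hu ht, smul_neg, ← neg_smul, neg_sub]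

theorem IsBackwardSolution.apply_last (hp : IsJumpPartition T y S τ)
    (h : IsBackwardSolution T Q r y S τ β) {t : ℝ} (ht : t ∈ piece T S τ S) :
    β t = exp ((T - t) • colOp (heldRate Q r (y (τ S)))) fun _ => 1 := by
  rw [h.eq_exp le_rfl ht (u := T) (hp.mem_piece_iff.2 ⟨hp.le, le_rfl, by simp⟩), h.final]

/-- On the piece, `β t` is an exponential applied to `β u` for every later `u`; let `u` tend to the
right end and insert the jump condition. -/
theorem IsBackwardSolution.apply_of_lt (hp : IsJumpPartition T y S τ)
    (h : IsBackwardSolution T Q r y S τ β) {s : ℕ} (hs : s < S) {t : ℝ}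
    (ht : t ∈ piece T S τ s) :
    β t = exp ((τ (s + 1) - t) • colOp (heldRate Q r (y (τ s))))
      (jumpRate Q r (y (τ (s + 1))) *ᵥ β (τ (s + 1))) := by
  have h1 : Tendsto (fun u : ℝ => exp ((u - t) • colOp (heldRate Q r (y (τ s)))) (β u))
      (𝓝[<] (τ (s + 1))) (𝓝 (exp ((τ (s + 1) - t) • colOp (heldRate Q r (y (τ s))))
      (jumpRate Q r (y (τ (s + 1))) *ᵥ β (τ (s + 1))))) := by
    have h2 : Tendsto (fun u : ℝ => u - t) (𝓝[<] (τ (s + 1))) (𝓝 (τ (s + 1) - t)) :=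
      ((continuous_id.sub continuous_const).tendsto _).mono_left nhdsWithin_le_nhds
    exact ((continuous_exp_smul_apply _).tendsto (_, _)).comp
      (h2.prodMk_nhds (h.jump (s + 1) (by omega) hs))
  refine tendsto_nhds_unique (tendsto_const_nhds.congr' ?_) h1
  filter_upwards [piece_mem_nhdsLT hp hs] with u hu
  exact h.eq_exp hs.le ht hu

theorem IsBackwardSolution.eqOn (hp : IsJumpPartition T y S τ) {β' : ℝ → Fin n → ℝ}
    (h : IsBackwardSolution T Q r y S τ β) (h' : IsBackwardSolution T Q r y S τ β') :
    EqOn β' β (Icc 0 T) := by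
  have key : ∀ k s, s + k = S → ∀ t ∈ piece T S τ s, β' t = β t := fun k => by
    induction k with
    | zero =>
      rintro s rfl t ht
      rw [h.apply_last hp ht, h'.apply_last hp ht]
    | succ k ih =>
      intro s hs t ht
      rw [h.apply_of_lt hp (by omega) ht, h'.apply_of_lt hp (by omega) ht,
        ih (s + 1) (by omega) _ (hp.left_mem_piece (by omega))]
  intro t ht
  have hs := pieceIndex_le (S := S) (τ := τ) t
  exact key (S - pieceIndex S τ t) _ (by omega) t (hp.mem_piece ht)

/-- The right end of the `s`-th piece. -/
def pieceEnd (T : ℝ) (S : ℕ) (τ : ℕ → ℝ) (s : ℕ) : ℝ := if s < S then τ (s + 1) else T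

/-- The left limit of the solution of the backward equation at the right end of the piece with
index `S - k`. -/
def backwardNode (T : ℝ) (Q : Matrix (Fin n) (Fin n) ℝ) (r : Fin n → Fin m → ℝ)
    (y : ℝ → Fin m) (S : ℕ) (τ : ℕ → ℝ) : ℕ → Fin n → ℝ
  | 0 => fun _ => 1
  | k + 1 => jumpRate Q r (y (τ (S - k))) *ᵥ
      exp ((pieceEnd T S τ (S - k) - τ (S - k)) • colOp (heldRate Q r (y (τ (S - k)))))
        (backwardNode T Q r y S τ k)

/-- The solution of the backward equation. -/
def backward (T : ℝ) (Q : Matrix (Fin n) (Fin n) ℝ) (r : Fin n → Fin m → ℝ)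
    (y : ℝ → Fin m) (S : ℕ) (τ : ℕ → ℝ) (t : ℝ) : Fin n → ℝ :=
  exp ((pieceEnd T S τ (pieceIndex S τ t) - t) •
    colOp (heldRate Q r (y (τ (pieceIndex S τ t)))))
    (backwardNode T Q r y S τ (S - pieceIndex S τ t))

theorem hasDerivAt_exp_apply_sub (L : (Fin n → ℝ) →L[ℝ] (Fin n → ℝ)) (v : Fin n → ℝ) (b t : ℝ) :
    HasDerivAt (fun t : ℝ => exp ((b - t) • L) v) (-L (exp ((b - t) • L) v)) t := by
  have h := hasDerivAt_exp_apply (-L) v b t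
  have he : ∀ t : ℝ, (t - b) • (-L) = (b - t) • L := fun t => by module
  simpa [he] using h

theorem isBackwardSolution_backward (hp : IsJumpPartition T y S τ) :
    IsBackwardSolution T Q r y S τ (backward T Q r y S τ) := by
  have hpiece : ∀ s ≤ S, ∀ t ∈ piece T S τ s, backward T Q r y S τ t =
      exp ((pieceEnd T S τ s - t) • colOp (heldRate Q r (y (τ s))))
        (backwardNode T Q r y S τ (S - s)) :=
    fun s hs t ht => by rw [backward, hp.pieceIndex_eq hs ht]
  refine ⟨?_, fun s hs t ht => ?_, fun s hs1 hs => ?_⟩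
  · rw [backward, hp.pieceIndex_last]
    simp [pieceEnd, backwardNode]
  · rw [hpiece s hs t ht]
    exact (hasDerivAt_exp_apply_sub _ _ _ _).hasDerivWithinAt.congr (hpiece s hs) (hpiece s hs t ht)
  · obtain ⟨s, rfl⟩ := Nat.exists_eq_add_of_le' hs1
    have hend : pieceEnd T S τ s = τ (s + 1) := if_pos hs
    have hval : jumpRate Q r (y (τ (s + 1))) *ᵥ backward T Q r y S τ (τ (s + 1)) =
        backwardNode T Q r y S τ (S - s) := by
      obtain ⟨k, hk⟩ : ∃ k, S - s = k + 1 := ⟨S - s - 1, by omega⟩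
      have hsk : S - k = s + 1 := by omega
      have hks : S - (s + 1) = k := by omega
      rw [hpiece (s + 1) hs _ (hp.left_mem_piece hs), hk, backwardNode, hsk, hks]
    rw [hval]
    have hlim := (hasDerivAt_exp_apply_sub (colOp (heldRate Q r (y (τ s))))
      (backwardNode T Q r y S τ (S - s)) (τ (s + 1))
      (τ (s + 1))).continuousAt.tendsto.mono_left (nhdsWithin_le_nhds (s := Iio (τ (s + 1))))
    simp only [sub_self, zero_smul, exp_zero, one_apply_eq_self] at hlim
    refine hlim.congr' ?_
    filter_upwards [piece_mem_nhdsLT hp hs] with t ht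
    rw [hpiece s (by omega) t ht, hend]

end Backward

theorem dotProduct_eq_of_mem_piece (hp : IsJumpPartition T y S τ)
    (hα : IsForwardSolution T Q r π₀ y S τ α) (hβ : IsBackwardSolution T Q r y S τ β) {s : ℕ}
    (hs : s ≤ S) {t : ℝ} (ht : t ∈ piece T S τ s) : α t ⬝ᵥ β t = α (τ s) ⬝ᵥ β (τ s) := by
  have hmem := hp.left_mem_piece hs
  rw [hα.eq_exp hs ht hmem, exp_rowOp_dotProduct_eq, hβ.eq_exp hs hmem ht]

/-- Within a piece the exponential moves from one factor of the pairing to the other. At a node the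
same `jumpRate` matrix acts on the row `α` from the right and on the column `β` from the left. -/
theorem dotProduct_eq (hp : IsJumpPartition T y S τ)
    (hα : IsForwardSolution T Q r π₀ y S τ α) (hβ : IsBackwardSolution T Q r y S τ β) {t : ℝ}
    (ht : t ∈ Icc 0 T) : α t ⬝ᵥ β t = α 0 ⬝ᵥ β 0 := by
  have key : ∀ s ≤ S, α (τ s) ⬝ᵥ β (τ s) = α 0 ⬝ᵥ β 0 := fun s hs => by
    induction s with
    | zero => rw [hp.zero]
    | succ s ih =>
      rw [← ih (by omega), hα.apply_succ hp hs, ← Matrix.dotProduct_mulVec,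
        exp_rowOp_dotProduct_eq, ← hβ.apply_of_lt hp hs (hp.left_mem_piece (by omega))]
  have hs := pieceIndex_le (S := S) (τ := τ) t
  rw [dotProduct_eq_of_mem_piece hp hα hβ hs (hp.mem_piece ht), key _ hs]

end Solutions

end

end CTHMM

open NormedSpace Asymptotics
open scoped Matrix

namespace CTHMM

noncomputable section

/-! ### One-step matrices of the discretized model and their first-order expansion -/

section Discretization

variable {n m : ℕ}

/-- Stated for a general matrix because it serves both `Q` and `P (T / K)`. In the latter a diagonal
entry stands for staying put without a new emission, an off-diagonal entry for a jump that emits `y`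
again. -/
theorem heldRate_apply (Q : Matrix (Fin n) (Fin n) ℝ) (r : Fin n → Fin m → ℝ) (y : Fin m)
    (i j : Fin n) : heldRate Q r y i j = if i = j then Q i i else Q i j * r j y := by
  simp only [heldRate, D, R, Matrix.add_apply, Matrix.mul_diagonal, Matrix.sub_apply,
    Matrix.diagonal_apply]
  split_ifs with h
  · subst h; ring
  · ring

theorem jumpRate_apply (Q : Matrix (Fin n) (Fin n) ℝ) (r : Fin n → Fin m → ℝ) (y : Fin m)
    (i j : Fin n) : jumpRate Q r y i j = if i = j then 0 else Q i j * r j y := by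
  simp only [jumpRate, D, R, Matrix.mul_diagonal, Matrix.sub_apply, Matrix.diagonal_apply]
  split_ifs with h
  · subst h; ring
  · ring

/-- The transition matrix of the hidden state over one grid cell whose end points carry the
observations `y` and `z`, when at most one hidden jump happens in the cell. -/
def stepMatrix (P : Matrix (Fin n) (Fin n) ℝ) (r : Fin n → Fin m → ℝ) (y z : Fin m) :
    Matrix (Fin n) (Fin n) ℝ :=
  if y = z then heldRate P r y else jumpRate P r z

/-- The discrete forward recursion. -/
def discForward (N : ℕ → Matrix (Fin n) (Fin n) ℝ) (v : Fin n → ℝ) : ℕ → Fin n → ℝ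
  | 0 => v
  | k + 1 => discForward N v k ᵥ* N k

/-- The discrete backward recursion, over `j` steps starting at `k`. -/
def discBackward (N : ℕ → Matrix (Fin n) (Fin n) ℝ) : ℕ → ℕ → Fin n → ℝ
  | 0, _ => fun _ => 1
  | j + 1, k => N k *ᵥ discBackward N j (k + 1)

theorem discForward_add {N : ℕ → Matrix (Fin n) (Fin n) ℝ} {v : Fin n → ℝ}
    {B : Matrix (Fin n) (Fin n) ℝ} {l j : ℕ} (h : ∀ k, l ≤ k → k < l + j → N k = B) :
    discForward N v (l + j) = (rowOp B ^ j) (discForward N v l) := by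
  induction j with
  | zero => simp
  | succ j ih =>
    rw [← add_assoc, discForward, ih fun k h1 h2 => h k h1 (by omega),
      h (l + j) (by omega) (by omega), pow_succ']
    rfl

theorem discBackward_add {N : ℕ → Matrix (Fin n) (Fin n) ℝ}
    {B : Matrix (Fin n) (Fin n) ℝ} {l j i : ℕ} (h : ∀ k, l ≤ k → k < l + j → N k = B) :
    discBackward N (j + i) l = (colOp B ^ j) (discBackward N i (l + j)) := by
  induction j generalizing l with
  | zero => simp
  | succ j ih =>
    rw [show j + 1 + i = (j + i) + 1 by omega, discBackward, h l le_rfl (by omega),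
      ih fun k h1 h2 => h k (by omega) (by omega), pow_succ',
      show l + 1 + j = l + (j + 1) by omega]
    rfl

/-- Expansion in matrix units carries entrywise estimates to operator norms. -/
theorem isLittleO_linearMap {W : Type*} [NormedAddCommGroup W] [NormedSpace ℝ W]
    (Φ : Matrix (Fin n) (Fin n) ℝ →ₗ[ℝ] W) {M : ℕ → Matrix (Fin n) (Fin n) ℝ} {d : ℕ → ℝ}
    (h : ∀ i j, (fun K => M K i j) =o[atTop] d) : (fun K => Φ (M K)) =o[atTop] d := by
  have : ∀ K, Φ (M K) = ∑ i, ∑ j, M K i j • Φ (Matrix.single i j 1) := fun K => by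
    conv_lhs => rw [Matrix.matrix_eq_sum_single (M K)]
    simp only [map_sum, ← map_smul, Matrix.smul_single, smul_eq_mul, mul_one]
  simp_rw [this]
  refine IsLittleO.fun_sum fun i _ => IsLittleO.fun_sum fun j _ => ?_
  refine IsBigO.trans_isLittleO (IsBigO.of_bound ‖Φ (Matrix.single i j 1)‖
    (Eventually.of_forall fun K => ?_)) (h i j)
  rw [norm_smul, mul_comm]

theorem tendsto_operator_pow {L : (Fin n → ℝ) →L[ℝ] (Fin n → ℝ)}
    {B : ℕ → (Fin n → ℝ) →L[ℝ] (Fin n → ℝ)} {d : ℕ → ℝ} {j : ℕ → ℕ} {u : ℝ}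
    {x : ℕ → Fin n → ℝ} {x₀ : Fin n → ℝ} (hd : Tendsto d atTop (𝓝 0)) (hd0 : ∀ K, 0 ≤ d K)
    (hB : (fun K => B K - 1 - d K • L) =o[atTop] d)
    (hj : Tendsto (fun K => j K * d K) atTop (𝓝 u)) (hx : Tendsto x atTop (𝓝 x₀)) :
    Tendsto (fun K => (B K ^ j K) (x K)) atTop (𝓝 (exp (u • L) x₀)) := by
  -- For `n = 0` the operator algebra is trivial and `‖1‖ = 1` fails, but there is only one vector.
  rcases Nat.eq_zero_or_pos n with rfl | hn
  · convert tendsto_const_nhds (x := exp (u • L) x₀)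
  · have : Nonempty (Fin n) := ⟨⟨0, hn⟩⟩
    have h := tendsto_pow_exp L hd hd0 hB hj
    exact ((continuous_fst.clm_apply continuous_snd).tendsto
      ((exp (u • L), x₀) : ((Fin n → ℝ) →L[ℝ] (Fin n → ℝ)) × (Fin n → ℝ))).comp (h.prodMk_nhds hx)

/-- `P` is a family of stochastic matrices with `P 0 = 1` and right derivative `Q` at `0`. -/
structure HasGenerator (P : ℝ → Matrix (Fin n) (Fin n) ℝ) (Q : Matrix (Fin n) (Fin n) ℝ) :
    Prop where
  zero : P 0 = 1
  stochastic : ∀ h, 0 ≤ h → P h ∈ Matrix.rowStochastic ℝ (Fin n)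
  tendsto : ∀ i j, i ≠ j → Tendsto (fun h => P h i j / h) (𝓝[>] 0) (𝓝 (Q i j))
  diag : ∀ i, Q i i = -∑ j ∈ Finset.univ.erase i, Q i j

namespace HasGenerator

variable {P : ℝ → Matrix (Fin n) (Fin n) ℝ} {Q : Matrix (Fin n) (Fin n) ℝ} {T : ℝ}

theorem apply_nonneg (hP : HasGenerator P Q) {h : ℝ} (hh : 0 ≤ h) (i j : Fin n) : 0 ≤ P h i j :=
  Matrix.nonneg_of_mem_rowStochastic (hP.stochastic h hh)

theorem sum_apply (hP : HasGenerator P Q) {h : ℝ} (hh : 0 ≤ h) (i : Fin n) : ∑ j, P h i j = 1 :=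
  Matrix.sum_row_of_mem_rowStochastic (hP.stochastic h hh) i

theorem rate_nonneg (hP : HasGenerator P Q) {i j : Fin n} (hij : i ≠ j) : 0 ≤ Q i j := by
  refine ge_of_tendsto (hP.tendsto i j hij) ?_
  filter_upwards [self_mem_nhdsWithin] with h hh
  exact div_nonneg (hP.apply_nonneg (le_of_lt hh) i j) (le_of_lt hh)

theorem tendsto_mesh_nhdsGT (hT : 0 < T) :
    Tendsto (fun K : ℕ => T / K) atTop (𝓝[>] 0) := by
  refine tendsto_nhdsWithin_iff.2 ⟨tendsto_mesh T, ?_⟩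
  filter_upwards [eventually_gt_atTop 0] with K hK
  exact div_pos hT (by positivity)

/-- Off the diagonal this is the definition of the rates. On the diagonal it follows since the rows
of `P` sum to one and those of `Q` to zero. -/
theorem isLittleO_apply (hP : HasGenerator P Q) (hT : 0 ≤ T) (i j : Fin n) :
    (fun K : ℕ => (P (T / K) - 1 - (T / K) • Q) i j) =o[atTop] fun K : ℕ => T / K := by
  -- For `T = 0` every mesh is `0`, and the claim rests on `P 0 = 1`.
  rcases hT.eq_or_lt with rfl | hT
  · simp [hP.zero]
  have hoff : ∀ i j, i ≠ j → (fun K : ℕ => P (T / K) i j - T / K * Q i j) =o[atTop]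
      fun K : ℕ => T / K := fun i j hij => by
    have h1 := (hP.tendsto i j hij).comp (tendsto_mesh_nhdsGT hT)
    rw [isLittleO_iff_tendsto']
    · have h2 := h1.sub_const (Q i j)
      rw [sub_self] at h2
      refine h2.congr' ?_
      filter_upwards [eventually_gt_atTop 0] with K hK
      have : T / K ≠ 0 := by positivity
      simp only [Function.comp]
      field_simp
    · filter_upwards [eventually_gt_atTop 0] with K hK h0
      exact absurd h0 (by positivity)
  by_cases hij : i = j
  · subst hij
    have h := (IsLittleO.fun_sum fun k (hk : k ∈ Finset.univ.erase i) =>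
      hoff i k (Finset.ne_of_mem_erase hk).symm).neg_left
    refine h.congr_left fun K => ?_
    have h1 := hP.sum_apply (by positivity : 0 ≤ T / (K : ℝ)) i
    rw [← Finset.add_sum_erase _ _ (Finset.mem_univ i)] at h1
    simp only [Finset.sum_sub_distrib, ← Finset.mul_sum, Matrix.sub_apply, Matrix.smul_apply,
      Matrix.one_apply_eq, smul_eq_mul, hP.diag i]
    linarith
  · refine (hoff i j hij).congr_left fun K => ?_
    simp [Matrix.one_apply_ne hij]

theorem isLittleO_heldRate_apply (hP : HasGenerator P Q) (hT : 0 ≤ T) (r : Fin n → Fin m → ℝ)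
    (y : Fin m) (i j : Fin n) :
    (fun K : ℕ => (heldRate (P (T / K)) r y - 1 - (T / K) • heldRate Q r y) i j) =o[atTop]
      fun K : ℕ => T / K := by
  have h := hP.isLittleO_apply hT i j
  by_cases hij : i = j
  · subst hij
    simpa only [Matrix.sub_apply, Matrix.smul_apply, heldRate_apply, if_true] using h
  · refine (h.mul_isBigO (isBigO_refl (fun _ : ℕ => r j y) atTop)).congr_left
      (fun K => ?_) |>.trans_isBigO (IsBigO.of_bound ‖r j y‖ (Eventually.of_forall fun K => ?_))
    · simp only [Matrix.sub_apply, Matrix.smul_apply, heldRate_apply, if_neg hij,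
        Matrix.one_apply_ne hij, smul_eq_mul]
      ring
    · rw [norm_mul, mul_comm]

theorem isLittleO_rowOp (hP : HasGenerator P Q) (hT : 0 ≤ T) (r : Fin n → Fin m → ℝ)
    (y : Fin m) :
    (fun K : ℕ => rowOp (heldRate (P (T / K)) r y) - 1 - (T / K) • rowOp (heldRate Q r y))
      =o[atTop] fun K : ℕ => T / K := by
  let Φ : Matrix (Fin n) (Fin n) ℝ →ₗ[ℝ] ((Fin n → ℝ) →L[ℝ] (Fin n → ℝ)) :=
    { toFun := rowOp
      map_add' := fun A B => by ext1 v; simp [Matrix.vecMul_add]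
      map_smul' := fun c A => by ext1 v; simp [Matrix.vecMul_smul] }
  refine (isLittleO_linearMap Φ (hP.isLittleO_heldRate_apply hT r y)).congr_left fun K => ?_
  have h1 : Φ 1 = 1 := by ext1 v; simp [Φ]
  rw [map_sub, map_sub, map_smul, h1]
  rfl

theorem isLittleO_colOp (hP : HasGenerator P Q) (hT : 0 ≤ T) (r : Fin n → Fin m → ℝ)
    (y : Fin m) :
    (fun K : ℕ => colOp (heldRate (P (T / K)) r y) - 1 - (T / K) • colOp (heldRate Q r y))
      =o[atTop] fun K : ℕ => T / K := by
  let Φ : Matrix (Fin n) (Fin n) ℝ →ₗ[ℝ] ((Fin n → ℝ) →L[ℝ] (Fin n → ℝ)) :=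
    { toFun := colOp
      map_add' := fun A B => by ext1 v; simp [Matrix.add_mulVec]
      map_smul' := fun c A => by ext1 v; simp [Matrix.smul_mulVec] }
  refine (isLittleO_linearMap Φ (hP.isLittleO_heldRate_apply hT r y)).congr_left fun K => ?_
  have h1 : Φ 1 = 1 := by ext1 v; simp [Φ]
  rw [map_sub, map_sub, map_smul, h1]
  rfl

/-- An observed jump within a cell has weight of order `T / K`; this is the source of the rescaling
powers below. -/
theorem tendsto_jumpRate (hP : HasGenerator P Q) (hT : 0 < T) (r : Fin n → Fin m → ℝ)
    (y : Fin m) :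
    Tendsto (fun K : ℕ => (T / K : ℝ)⁻¹ • jumpRate (P (T / K)) r y) atTop
      (𝓝 (jumpRate Q r y)) := by
  refine tendsto_pi_nhds.2 fun i => tendsto_pi_nhds.2 fun j => ?_
  by_cases hij : i = j
  · simp [jumpRate_apply, hij]
  · have h1 := ((hP.tendsto i j hij).comp (tendsto_mesh_nhdsGT hT)).mul_const (r j y)
    simp only [Matrix.smul_apply, jumpRate_apply, if_neg hij]
    refine h1.congr fun K => ?_
    simp only [Function.comp, smul_eq_mul]
    ring

end HasGenerator

end Discretization

end

end CTHMM

open NormedSpace Asymptotics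
open scoped Matrix

namespace CTHMM

noncomputable section

/-! ### Convergence of the discrete recursions to the solutions of the ODEs -/

section Convergence

variable {n m : ℕ} {T : ℝ} {Q : Matrix (Fin n) (Fin n) ℝ} {r : Fin n → Fin m → ℝ}
  {π₀ : Fin n → ℝ} {y : ℝ → Fin m} {S : ℕ} {τ : ℕ → ℝ} {α β : ℝ → Fin n → ℝ}
  {P : ℝ → Matrix (Fin n) (Fin n) ℝ}

/-- The one-step matrices along the values of a path on the grid with `K` cells. -/
def gridStep (P : ℝ → Matrix (Fin n) (Fin n) ℝ) (r : Fin n → Fin m → ℝ) (T : ℝ)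
    (y : ℝ → Fin m) (K l : ℕ) : Matrix (Fin n) (Fin n) ℝ :=
  stepMatrix (P (T / K)) r (y (grid T K l)) (y (grid T K (l + 1)))

theorem gridStep_of_pieceIndex (hp : IsJumpPartition T y S τ) (hT : 0 ≤ T) {K l : ℕ}
    (hK : 0 < K) (hl : l + 1 ≤ K) {s : ℕ} (h1 : pieceIndex S τ (grid T K l) = s)
    (h2 : pieceIndex S τ (grid T K (l + 1)) = s) :
    gridStep P r T y K l = heldRate (P (T / K)) r (y (τ s)) := by
  rw [gridStep, stepMatrix, hp.eq_pieceIndex (grid_mem hT hK (by omega : l ≤ K)),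
    hp.eq_pieceIndex (grid_mem hT hK hl), h1, h2, if_pos rfl]

theorem gridStep_of_pieceIndex_succ (hp : IsJumpPartition T y S τ) (hT : 0 ≤ T) {K l : ℕ}
    (hK : 0 < K) (hl : l + 1 ≤ K) {s : ℕ} (hs : s < S) (h1 : pieceIndex S τ (grid T K l) = s)
    (h2 : pieceIndex S τ (grid T K (l + 1)) = s + 1) :
    gridStep P r T y K l = jumpRate (P (T / K)) r (y (τ (s + 1))) := by
  rw [gridStep, stepMatrix, hp.eq_pieceIndex (grid_mem hT hK (by omega : l ≤ K)),
    hp.eq_pieceIndex (grid_mem hT hK hl), h1, h2, if_neg (hp.ne s hs).symm]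

theorem gridStep_eq_of_le (hp : IsJumpPartition T y S τ) (hT : 0 ≤ T) {K a b : ℕ}
    (hK : 0 < K) (hb : b ≤ K) {s : ℕ} (h1 : pieceIndex S τ (grid T K a) = s)
    (h2 : pieceIndex S τ (grid T K b) = s) {l : ℕ} (hal : a ≤ l) (hlb : l < b) :
    gridStep P r T y K l = heldRate (P (T / K)) r (y (τ s)) := by
  have key : ∀ k, a ≤ k → k ≤ b → pieceIndex S τ (grid T K k) = s := fun k hak hkb => by
    refine le_antisymm ?_ ?_
    · rw [← h2]
      exact hp.pieceIndex_mono (grid_mem hT hK (by omega)).1 (grid_mono hT hkb)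
    · rw [← h1]
      exact hp.pieceIndex_mono (grid_mem hT hK (by omega)).1 (grid_mono hT hak)
  exact gridStep_of_pieceIndex hp hT hK (by omega) (key l hal hlb.le) (key (l + 1) (by omega) hlb)

theorem grid_sub_grid {K a b : ℕ} (h : a ≤ b) :
    ((b - a : ℕ) : ℝ) * (T / K) = grid T K b - grid T K a := by
  rw [grid, grid, Nat.cast_sub h]; ring

/-- Between `a K` and `b K` no discontinuity is met, so all one-step matrices are equal and their
product is a power converging to an exponential. The scalar `c K` is a placeholder for the rescaling
by earlier jumps. -/
theorem tendsto_discForward_run (hP : HasGenerator P Q) (hT : 0 ≤ T)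
    (hp : IsJumpPartition T y S τ) {v : Fin n → ℝ} {s : ℕ} {a b : ℕ → ℕ} {c : ℕ → ℝ}
    {x₀ : Fin n → ℝ} {t u : ℝ} (hab : ∀ᶠ K in atTop, a K ≤ b K ∧ b K ≤ K)
    (ha : ∀ᶠ K in atTop, pieceIndex S τ (grid T K (a K)) = s)
    (hb : ∀ᶠ K in atTop, pieceIndex S τ (grid T K (b K)) = s)
    (hat : Tendsto (fun K => grid T K (a K)) atTop (𝓝 t))
    (hbu : Tendsto (fun K => grid T K (b K)) atTop (𝓝 u))
    (hx : Tendsto (fun K => c K • discForward (gridStep P r T y K) v (a K)) atTop (𝓝 x₀)) :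
    Tendsto (fun K => c K • discForward (gridStep P r T y K) v (b K)) atTop
      (𝓝 (exp ((u - t) • rowOp (heldRate Q r (y (τ s)))) x₀)) := by
  have hj : Tendsto (fun K => ((b K - a K : ℕ) : ℝ) * (T / K)) atTop (𝓝 (u - t)) := by
    refine (hbu.sub hat).congr' ?_
    filter_upwards [hab] with K hK using (grid_sub_grid hK.1).symm
  refine (tendsto_operator_pow (tendsto_mesh T) (fun K => by positivity)
    (hP.isLittleO_rowOp hT r (y (τ s))) hj hx).congr' ?_
  filter_upwards [eventually_gt_atTop 0, hab, ha, hb] with K hK h1 h2 h3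
  have := discForward_add (N := gridStep P r T y K) (v := v) (l := a K) (j := b K - a K)
    fun k hk1 hk2 => gridStep_eq_of_le hp hT hK h1.2 h2 h3 hk1 (by omega)
  rw [show a K + (b K - a K) = b K by omega] at this
  rw [this, map_smul]

theorem tendsto_discBackward_run (hP : HasGenerator P Q) (hT : 0 ≤ T)
    (hp : IsJumpPartition T y S τ) {s : ℕ} {a b : ℕ → ℕ} {c : ℕ → ℝ}
    {x₀ : Fin n → ℝ} {t u : ℝ} (hab : ∀ᶠ K in atTop, a K ≤ b K ∧ b K ≤ K)
    (ha : ∀ᶠ K in atTop, pieceIndex S τ (grid T K (a K)) = s)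
    (hb : ∀ᶠ K in atTop, pieceIndex S τ (grid T K (b K)) = s)
    (hat : Tendsto (fun K => grid T K (a K)) atTop (𝓝 t))
    (hbu : Tendsto (fun K => grid T K (b K)) atTop (𝓝 u))
    (hx : Tendsto (fun K => c K • discBackward (gridStep P r T y K) (K - b K) (b K)) atTop
      (𝓝 x₀)) :
    Tendsto (fun K => c K • discBackward (gridStep P r T y K) (K - a K) (a K)) atTop
      (𝓝 (exp ((u - t) • colOp (heldRate Q r (y (τ s)))) x₀)) := by
  have hj : Tendsto (fun K => ((b K - a K : ℕ) : ℝ) * (T / K)) atTop (𝓝 (u - t)) := by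
    refine (hbu.sub hat).congr' ?_
    filter_upwards [hab] with K hK using (grid_sub_grid hK.1).symm
  refine (tendsto_operator_pow (tendsto_mesh T) (fun K => by positivity)
    (hP.isLittleO_colOp hT r (y (τ s))) hj hx).congr' ?_
  filter_upwards [eventually_gt_atTop 0, hab, ha, hb] with K hK h1 h2 h3
  have := discBackward_add (N := gridStep P r T y K) (l := a K) (j := b K - a K) (i := K - b K)
    fun k hk1 hk2 => gridStep_eq_of_le hp hT hK h1.2 h2 h3 hk1 (by omega)
  rw [show a K + (b K - a K) = b K by omega,
    show b K - a K + (K - b K) = K - a K by omega] at this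
  rw [this, map_smul]

theorem gridCeil_mono {K : ℕ} (hK : 0 < K) {t u : ℝ} (ht : t ∈ Icc 0 T) (hu : u ∈ Icc 0 T)
    (h : t ≤ u) : gridCeil T K t ≤ gridCeil T K u :=
  (gridCeil_le_iff hK ht).2 (h.trans (le_grid_gridCeil hK hu))

/-- The last grid point before a discontinuity lies in the preceding piece. -/
theorem eventually_gridCeil_pred (hp : IsJumpPartition T y S τ) (hT : 0 ≤ T) {s : ℕ}
    (hs : s < S) :
    ∀ᶠ K in atTop, gridCeil T K (τ (s + 1)) - 1 + 1 = gridCeil T K (τ (s + 1)) ∧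
      pieceIndex S τ (grid T K (gridCeil T K (τ (s + 1)) - 1)) = s ∧
      pieceIndex S τ (grid T K (gridCeil T K (τ (s + 1)))) = s + 1 := by
  have hmem : τ (s + 1) ∈ Icc 0 T := hp.mem_Icc hs
  have hidx := hp.eventually_pieceIndex_gridCeil hT hmem
  rw [hp.pieceIndex_eq hs (hp.left_mem_piece hs)] at hidx
  filter_upwards [hp.eventually_mesh_lt, hidx] with K ⟨hK, hm⟩ hi
  have hne : gridCeil T K (τ (s + 1)) ≠ 0 := fun h0 => by
    have := (gridCeil_le_iff hK hmem).1 h0.le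
    rw [grid_zero] at this
    have h1 := hp.lt s hs
    have h2 := hp.nonneg hs.le
    linarith
  have hpred : gridCeil T K (τ (s + 1)) - 1 + 1 = gridCeil T K (τ (s + 1)) := by omega
  refine ⟨hpred, ?_, hi⟩
  have h1 : grid T K (gridCeil T K (τ (s + 1)) - 1) < τ (s + 1) := by
    by_contra hc
    have := (gridCeil_le_iff hK hmem).2 (not_lt.1 hc)
    omega
  have h2 : τ (s + 1) ≤ grid T K (gridCeil T K (τ (s + 1)) - 1) + T / K := by
    rw [← grid_succ, hpred]
    exact le_grid_gridCeil hK hmem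
  have h3 := hm s hs
  exact hp.pieceIndex_eq hs.le (hp.mem_piece_iff.2 ⟨by linarith, by linarith [hmem.2], fun _ => h1⟩)

theorem tendsto_grid_gridCeil_pred (hp : IsJumpPartition T y S τ) (hT : 0 ≤ T) {s : ℕ}
    (hs : s < S) :
    Tendsto (fun K => grid T K (gridCeil T K (τ (s + 1)) - 1)) atTop (𝓝 (τ (s + 1))) := by
  have h := (tendsto_grid_gridCeil (hp.mem_Icc hs)).sub (tendsto_mesh T)
  rw [sub_zero] at h
  refine h.congr' ?_
  filter_upwards [eventually_gridCeil_pred hp hT hs] with K hK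
  rw [← hK.1, grid_succ, hK.1]
  ring

/-- Induction over the observed jumps: a run up to the last grid point before `τ (s + 1)`, then one
jump cell, which contributes one more factor `T / K`. -/
theorem tendsto_discForward_node (hP : HasGenerator P Q) (hT : 0 ≤ T)
    (hp : IsJumpPartition T y S τ) (hα : IsForwardSolution T Q r π₀ y S τ α) {s : ℕ}
    (hs : s ≤ S) :
    Tendsto (fun K : ℕ => ((T / K : ℝ) ^ s)⁻¹ •
      discForward (gridStep P r T y K) (π₀ ᵥ* R r (y 0)) (gridCeil T K (τ s))) atTop
      (𝓝 (α (τ s))) := by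
  induction s with
  | zero =>
    simp only [hp.zero, gridCeil_zero, discForward, pow_zero, inv_one, one_smul, hα.init]
    exact tendsto_const_nhds
  | succ s ih =>
    have hs' : s < S := hs
    have hpred := eventually_gridCeil_pred hp hT hs'
    have hTpos : 0 < T :=
      (hp.nonneg hs'.le).trans_lt ((hp.lt s hs').trans_le (hp.le_T hs))
    have hidx := hp.eventually_pieceIndex_gridCeil hT (hp.mem_Icc hs'.le)
    rw [hp.pieceIndex_eq hs'.le (hp.left_mem_piece hs'.le)] at hidx
    have hrun := tendsto_discForward_run (a := fun K => gridCeil T K (τ s))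
      (b := fun K => gridCeil T K (τ (s + 1)) - 1) hP hT hp (s := s) ?_ hidx
      (hpred.mono fun K h => h.2.1) (tendsto_grid_gridCeil (hp.mem_Icc hs'.le))
      (tendsto_grid_gridCeil_pred hp hT hs') (ih hs'.le)
    · have hcont : Continuous fun p : (Fin n → ℝ) × Matrix (Fin n) (Fin n) ℝ => p.1 ᵥ* p.2 :=
        continuous_fst.matrix_vecMul continuous_snd
      rw [hα.apply_succ hp hs']
      refine ((hcont.tendsto (_, _)).comp (hrun.prodMk_nhds
        (hP.tendsto_jumpRate hTpos r (y (τ (s + 1)))))).congr' ?_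
      filter_upwards [eventually_gt_atTop 0, hpred] with K hK h
      have hstep := gridStep_of_pieceIndex_succ (P := P) (r := r) hp hT hK
        (h.1.trans_le (gridCeil_le hK (hp.mem_Icc hs))) hs' h.2.1 (by rw [h.1]; exact h.2.2)
      have hfwd : discForward (gridStep P r T y K) (π₀ ᵥ* R r (y 0)) (gridCeil T K (τ (s + 1))) =
          discForward (gridStep P r T y K) (π₀ ᵥ* R r (y 0)) (gridCeil T K (τ (s + 1)) - 1) ᵥ*
            jumpRate (P (T / K)) r (y (τ (s + 1))) := by
        conv_lhs => rw [← h.1]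
        rw [discForward, hstep]
      simp only [Function.comp]
      rw [hfwd, Matrix.smul_vecMul, Matrix.vecMul_smul, smul_smul, pow_succ, mul_inv]
    · filter_upwards [eventually_gt_atTop 0, hpred] with K hK h
      have h1 := gridCeil_le hK (hp.mem_Icc hs)
      refine ⟨?_, by omega⟩
      rw [gridCeil_le_iff hK (hp.mem_Icc hs'.le)]
      have h2 := hp.le_of_pieceIndex (grid_mem hT hK
        (by omega : gridCeil T K (τ (s + 1)) - 1 ≤ K)).1
      rwa [h.2.1] at h2

theorem tendsto_discForward (hP : HasGenerator P Q) (hT : 0 ≤ T)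
    (hp : IsJumpPartition T y S τ) (hα : IsForwardSolution T Q r π₀ y S τ α) {t : ℝ}
    (ht : t ∈ Icc 0 T) :
    Tendsto (fun K : ℕ => ((T / K : ℝ) ^ pieceIndex S τ t)⁻¹ •
      discForward (gridStep P r T y K) (π₀ ᵥ* R r (y 0)) (gridCeil T K t)) atTop
      (𝓝 (α t)) := by
  set s := pieceIndex S τ t with hs_def
  have hs : s ≤ S := pieceIndex_le t
  have hidx := hp.eventually_pieceIndex_gridCeil hT (hp.mem_Icc hs)
  rw [hp.pieceIndex_eq hs (hp.left_mem_piece hs)] at hidx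
  rw [hα.eq_exp hs (hp.mem_piece ht) (hp.left_mem_piece hs)]
  refine tendsto_discForward_run hP hT hp (a := fun K => gridCeil T K (τ s))
    ?_ hidx (hp.eventually_pieceIndex_gridCeil hT ht) (tendsto_grid_gridCeil (hp.mem_Icc hs))
    (tendsto_grid_gridCeil ht) (tendsto_discForward_node hP hT hp hα hs)
  filter_upwards [eventually_gt_atTop 0] with K hK
  exact ⟨gridCeil_mono hK (hp.mem_Icc hs) ht (hp.le_of_pieceIndex ht.1), gridCeil_le hK ht⟩

/-- Induction on the number of observed jumps after `t`, which is also the power of `T / K` to be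
divided out. -/
theorem tendsto_discBackward (hP : HasGenerator P Q) (hT : 0 ≤ T)
    (hp : IsJumpPartition T y S τ) (hβ : IsBackwardSolution T Q r y S τ β) {t : ℝ}
    (ht : t ∈ Icc 0 T) :
    Tendsto (fun K : ℕ => ((T / K : ℝ) ^ (S - pieceIndex S τ t))⁻¹ •
      discBackward (gridStep P r T y K) (K - gridCeil T K t) (gridCeil T K t)) atTop
      (𝓝 (β t)) := by
  obtain ⟨k, hk⟩ : ∃ k, S - pieceIndex S τ t = k := ⟨_, rfl⟩
  induction k generalizing t with
  | zero =>
    have hs : pieceIndex S τ t = S := by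
      have := pieceIndex_le (S := S) (τ := τ) t
      omega
    have hpt := hp.mem_piece ht
    rw [hs] at hpt
    have hidx := hp.eventually_pieceIndex_gridCeil hT ht
    rw [hs] at hidx
    rw [hk, hβ.apply_last hp hpt]
    refine tendsto_discBackward_run hP hT hp (b := fun K => K) (u := T) ?_ hidx ?_
      (tendsto_grid_gridCeil ht) ?_ ?_
    · filter_upwards [eventually_gt_atTop 0] with K hK using ⟨gridCeil_le hK ht, le_rfl⟩
    · filter_upwards [eventually_gt_atTop 0] with K hK
      rw [grid_self hK, hp.pieceIndex_last]
    · refine tendsto_const_nhds.congr' ?_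
      filter_upwards [eventually_gt_atTop 0] with K hK using (grid_self hK).symm
    · simp [discBackward]
  | succ k ih =>
    set s := pieceIndex S τ t with hs_def
    have hs : s < S := by omega
    have hmem := hp.mem_Icc (show s + 1 ≤ S from hs)
    have hnode : pieceIndex S τ (τ (s + 1)) = s + 1 := hp.pieceIndex_eq hs (hp.left_mem_piece hs)
    have hpred := eventually_gridCeil_pred hp hT hs
    have hTpos : 0 < T := (hp.nonneg hs.le).trans_lt ((hp.lt s hs).trans_le (hp.le_T hs))
    have hnext := ih hmem (by omega)
    rw [hnode] at hnext
    have hcont : Continuous fun p : Matrix (Fin n) (Fin n) ℝ × (Fin n → ℝ) => p.1 *ᵥ p.2 :=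
      continuous_fst.matrix_mulVec continuous_snd
    have hjump : Tendsto (fun K : ℕ => ((T / K : ℝ) ^ (S - s))⁻¹ •
        discBackward (gridStep P r T y K) (K - (gridCeil T K (τ (s + 1)) - 1))
          (gridCeil T K (τ (s + 1)) - 1)) atTop
        (𝓝 (jumpRate Q r (y (τ (s + 1))) *ᵥ β (τ (s + 1)))) := by
      refine ((hcont.tendsto (_, _)).comp ((hP.tendsto_jumpRate hTpos r
        (y (τ (s + 1)))).prodMk_nhds hnext)).congr' ?_
      filter_upwards [eventually_gt_atTop 0, hpred] with K hK h
      have hle := gridCeil_le hK hmem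
      have hstep := gridStep_of_pieceIndex_succ (P := P) (r := r) hp hT hK
        (h.1.trans_le hle) hs h.2.1 (by rw [h.1]; exact h.2.2)
      rw [show K - (gridCeil T K (τ (s + 1)) - 1) = (K - gridCeil T K (τ (s + 1))) + 1 by omega,
        discBackward, hstep, h.1]
      simp only [Function.comp]
      rw [Matrix.mulVec_smul, Matrix.smul_mulVec, smul_smul,
        show S - s = (S - (s + 1)) + 1 by omega, pow_succ, mul_inv]
    rw [hβ.apply_of_lt hp hs (hp.mem_piece ht)]
    refine tendsto_discBackward_run hP hT hp (b := fun K => gridCeil T K (τ (s + 1)) - 1) ?_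
      (hp.eventually_pieceIndex_gridCeil hT ht) (hpred.mono fun K h => h.2.1)
      (tendsto_grid_gridCeil ht) (tendsto_grid_gridCeil_pred hp hT hs) hjump
    have hlt : t < τ (s + 1) := (hp.mem_piece_iff.1 (hp.mem_piece ht)).2.2 hs
    filter_upwards [eventually_gt_atTop 0, hpred,
      hp.eventually_pieceIndex_gridCeil hT ht] with K hK h hidx
    have hle := gridCeil_le hK hmem
    have hmono := gridCeil_mono hK ht hmem hlt.le
    have hne : gridCeil T K t ≠ gridCeil T K (τ (s + 1)) := fun he => by
      rw [he, h.2.2] at hidx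
      omega
    exact ⟨by omega, by omega⟩

/-- The posterior probability of the state `i` at the `k`-th grid point computed from the discrete
recursions. -/
def discPosterior (N : ℕ → Matrix (Fin n) (Fin n) ℝ) (v : Fin n → ℝ) (K k : ℕ) (i : Fin n) : ℝ :=
  discForward N v k i * discBackward N (K - k) k i /
    (discForward N v k ⬝ᵥ discBackward N (K - k) k)

/-- The forward and backward rescalings enter numerator and denominator alike and cancel; positivity
of the pairing keeps the limit of the denominator away from zero. -/
theorem tendsto_discPosterior (hP : HasGenerator P Q) (hT : 0 ≤ T)
    (hp : IsJumpPartition T y S τ) (hα : IsForwardSolution T Q r π₀ y S τ α)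
    (hβ : IsBackwardSolution T Q r y S τ β) (hpos : 0 < α 0 ⬝ᵥ β 0) {t : ℝ}
    (ht : t ∈ Icc 0 T) (i : Fin n) :
    Tendsto (fun K : ℕ => discPosterior (gridStep P r T y K) (π₀ ᵥ* R r (y 0)) K
      (gridCeil T K t) i) atTop (𝓝 (α t i * β t i / (α 0 ⬝ᵥ β 0))) := by
  have ha := tendsto_discForward hP hT hp hα ht
  have hb := tendsto_discBackward hP hT hp hβ ht
  have hdot := dotProduct_eq hp hα hβ ht
  have hcont : Continuous fun p : (Fin n → ℝ) × (Fin n → ℝ) => p.1 ⬝ᵥ p.2 :=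
    continuous_fst.dotProduct continuous_snd
  have hlim := (((tendsto_pi_nhds.1 ha i).mul (tendsto_pi_nhds.1 hb i)).div
    ((hcont.tendsto (_, _)).comp (ha.prodMk_nhds hb)) (by rw [hdot]; exact hpos.ne'))
  rw [hdot] at hlim
  refine hlim.congr' ?_
  filter_upwards [eventually_gt_atTop 0] with K hK
  -- A positive exponent forces a discontinuity, hence `T > 0`; for `T = 0` only the power `0`
  -- occurs.
  have hc : ∀ k ≤ S, ((T / K : ℝ) ^ k)⁻¹ ≠ 0 := fun k hk => by
    rcases Nat.eq_zero_or_pos k with rfl | hk0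
    · simp
    · have : 0 < T := (hp.nonneg (Nat.zero_le S)).trans_lt
        (hp.zero ▸ (strictMonoOn_of_lt_succ hp.lt (hk0.trans_le hk) le_rfl).trans_le hp.le)
      positivity
  have h1 := hc _ (pieceIndex_le (S := S) (τ := τ) t)
  have h2 := hc _ (Nat.sub_le S (pieceIndex S τ t))
  simp only [Pi.div_apply, Function.comp, Pi.smul_apply, smul_eq_mul, smul_dotProduct,
    dotProduct_smul, discPosterior]
  generalize ((T / K : ℝ) ^ pieceIndex S τ t)⁻¹ = c at h1 ⊢
  generalize ((T / K : ℝ) ^ (S - pieceIndex S τ t))⁻¹ = c' at h2 ⊢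
  rw [mul_mul_mul_comm, mul_left_comm c', ← mul_assoc c c' (_ ⬝ᵥ _),
    mul_div_mul_left _ _ (mul_ne_zero h1 h2)]

end Convergence

end

end CTHMM

open NormedSpace
open scoped Matrix

namespace CTHMM

noncomputable section

/-! ### Positivity of the normalizing constant along an admissible hidden path -/

section Positivity

variable {n m : ℕ} {T : ℝ} {Q : Matrix (Fin n) (Fin n) ℝ} {r : Fin n → Fin m → ℝ}
  {π₀ : Fin n → ℝ} {y : ℝ → Fin m} {S : ℕ} {τ : ℕ → ℝ} {α : ℝ → Fin n → ℝ}
  {x : ℝ → Fin n} {S' : ℕ} {σ : ℕ → ℝ}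

/-- The observation can change only when the hidden state does: a discontinuity of `y` inside a
piece of `x` would contradict constancy there. -/
theorem pieceIndex_eq_of_constOnPieces (hp : IsJumpPartition T y S τ)
    (hx : IsJumpPartition T x S' σ) (hc : ConstOnPieces T y S' σ) {s : ℕ} (hs : s ≤ S') {u : ℝ}
    (hu : u ∈ piece T S' σ s) : pieceIndex S τ u = pieceIndex S τ (σ s) := by
  obtain ⟨h1, h2, h3⟩ := hx.mem_piece_iff.1 hu
  have h0 := hx.mem_Icc hs
  refine le_antisymm ?_ (hp.pieceIndex_mono h0.1 h1)
  by_contra hlt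
  set q := pieceIndex S τ (σ s) with hq
  have hqS : q < S := lt_of_lt_of_le (not_le.1 hlt) (pieceIndex_le u)
  have h4 : τ (q + 1) ≤ u := (monoOn_of_lt_succ hp.lt (not_le.1 hlt) (pieceIndex_le u)).trans
    (hp.le_of_pieceIndex (h0.1.trans h1))
  have h5 : σ s < τ (q + 1) := lt_of_pieceIndex_lt hqS (Nat.lt_succ_self _)
  have h6 := hc s hs (τ (q + 1)) (hx.mem_piece_iff.2
    ⟨h5.le, h4.trans h2, fun h => h4.trans_lt (h3 h)⟩)
  rw [hp.eq_pieceIndex h0] at h6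
  exact hp.ne q hqS h6

/-- Along a hidden path all of whose transitions and emissions have positive rates, the forward
solution charges the current hidden state. -/
theorem IsForwardSolution.pos_of_path (hp : IsJumpPartition T y S τ)
    (hα : IsForwardSolution T Q r π₀ y S τ α) (hx : IsJumpPartition T x S' σ)
    (hc : ConstOnPieces T y S' σ) (hQ : ∀ i j, i ≠ j → 0 ≤ Q i j) (hr : ∀ i z, 0 ≤ r i z)
    (hπ : 0 ≤ π₀) (hinit : 0 < π₀ (x 0)) (hjump : ∀ s < S', 0 < Q (x (σ s)) (x (σ (s + 1))))
    (hemit : ∀ s ≤ S', 0 < r (x (σ s)) (y (σ s))) :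
    0 ≤ α T ∧ 0 < α T (x T) := by
  have hA : ∀ z i j, i ≠ j → 0 ≤ heldRate Q r z i j := fun z i j hij => by
    rw [heldRate_apply, if_neg hij]
    exact mul_nonneg (hQ i j hij) (hr j z)
  have hJ : ∀ z i j, 0 ≤ jumpRate Q r z i j := fun z i j => by
    rw [jumpRate_apply]
    split_ifs with hij
    · exact le_rfl
    · exact mul_nonneg (hQ i j hij) (hr j z)
  have key : ∀ s ≤ S', 0 ≤ α (σ s) ∧ 0 < α (σ s) (x (σ s)) := fun s hs => by
    induction s with
    | zero =>
      have h0 := hemit 0 (Nat.zero_le _)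
      rw [hx.zero] at h0 ⊢
      rw [hα.init]
      have happ : ∀ i, (π₀ ᵥ* R r (y 0)) i = π₀ i * r i (y 0) := fun i => by
        simp [R, Matrix.vecMul_diagonal]
      refine ⟨fun i => ?_, ?_⟩
      · rw [happ]; exact mul_nonneg (hπ i) (hr _ _)
      · rw [happ]; exact mul_pos hinit h0
    | succ s ih =>
      obtain ⟨ih0, ih1⟩ := ih (by omega)
      have hs' : s < S' := hs
      have hmem := hx.mem_Icc hs'.le
      have hmem' := hx.mem_Icc hs
      have hlt := hx.lt s hs'
      set q := pieceIndex S τ (σ s) with hq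
      have hqS : q ≤ S := pieceIndex_le _
      have hrate := hjump s hs'
      have hre := hemit (s + 1) hs
      have hne : x (σ s) ≠ x (σ (s + 1)) := (hx.ne s hs').symm
      -- Either the hidden jump repeats the observed value, and the exponential itself moves mass to
      -- the new state in positive time; or the observation jumps too, and the exponential keeps the
      -- mass at the old state until `jumpRate` moves it.
      rcases (hp.pieceIndex_mono hmem.1 hlt.le).eq_or_lt with he | hgt
      · have hpc := hp.mem_piece hmem'
        rw [← he] at hpc
        have hyv := hp.const q hqS _ hpc
        rw [hα.eq_exp hqS hpc (hp.mem_piece hmem)]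
        refine ⟨exp_rowOp_nonneg (hA _) (sub_nonneg.2 hlt.le) ih0,
          exp_rowOp_pos_of_pos (hA _) (sub_pos.2 hlt) ih0 ih1 hne ?_⟩
        rw [heldRate_apply, if_neg hne, ← hyv]
        exact mul_pos hrate hre
      · have hqlt : q < S := lt_of_lt_of_le hgt (pieceIndex_le _)
        have hle : τ (q + 1) ≤ σ (s + 1) :=
          (monoOn_of_lt_succ hp.lt hgt (pieceIndex_le _)).trans (hp.le_of_pieceIndex hmem'.1)
        -- An observed discontinuity strictly before `σ (s + 1)` would fall inside a piece of the
        -- hidden path.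
        have heq : τ (q + 1) = σ (s + 1) := by
          refine le_antisymm hle (not_lt.1 fun hcon => ?_)
          have h1 : σ s < τ (q + 1) := lt_of_pieceIndex_lt hqlt (Nat.lt_succ_self _)
          have h2 := pieceIndex_eq_of_constOnPieces hp hx hc hs'.le (u := τ (q + 1))
            (hx.mem_piece_iff.2 ⟨h1.le, hp.le_T hqlt, fun _ => hcon⟩)
          rw [hp.pieceIndex_eq hqlt (hp.left_mem_piece hqlt)] at h2
          omega
        have hval : α (σ (s + 1)) = exp ((σ (s + 1) - σ s) • rowOp (heldRate Q r (y (τ q))))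
            (α (σ s)) ᵥ* jumpRate Q r (y (σ (s + 1))) := by
          rw [← heq, hα.apply_succ hp hqlt,
            hα.eq_exp hqS (hp.mem_piece hmem) (hp.left_mem_piece hqS),
            exp_smul_apply_exp_smul_apply, sub_add_sub_cancel]
        have hv0 := exp_rowOp_nonneg (hA (y (τ q))) (sub_nonneg.2 hlt.le) ih0
        have hv1 := exp_rowOp_pos_self (hA (y (τ q))) (sub_nonneg.2 hlt.le) ih0 ih1
        rw [hval]
        refine ⟨fun j => Finset.sum_nonneg (s := Finset.univ) fun i _ =>
          mul_nonneg (hv0 i) (hJ (y (σ (s + 1))) i j), ?_⟩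
        refine lt_of_lt_of_le ?_ (Finset.single_le_sum (s := Finset.univ)
          (fun i _ => mul_nonneg (hv0 i) (hJ _ i _)) (Finset.mem_univ (x (σ s))))
        refine mul_pos hv1 ?_
        rw [jumpRate_apply, if_neg hne]
        exact mul_pos hrate hre
  obtain ⟨h0, h1⟩ := key S' le_rfl
  have hT : T ∈ piece T S' σ S' := hx.mem_piece_iff.2 ⟨hx.le, le_rfl, by simp⟩
  have hidx := pieceIndex_eq_of_constOnPieces hp hx hc le_rfl hT
  have hmem := hx.mem_Icc le_rfl
  have hpc := hp.mem_piece (t := T) ⟨hmem.1.trans hmem.2, le_rfl⟩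
  rw [hidx] at hpc
  rw [hα.eq_exp (pieceIndex_le _) hpc (hp.mem_piece hmem), hx.const S' le_rfl T hT]
  exact ⟨exp_rowOp_nonneg (hA _) (sub_nonneg.2 hmem.2) h0,
    exp_rowOp_pos_self (hA _) (sub_nonneg.2 hmem.2) h0 h1⟩

/-- The pairing is evaluated at `T`, where `β` is identically one. -/
theorem dotProduct_pos_of_path {β : ℝ → Fin n → ℝ} (hp : IsJumpPartition T y S τ)
    (hα : IsForwardSolution T Q r π₀ y S τ α) (hβ : IsBackwardSolution T Q r y S τ β)
    (h : 0 ≤ α T ∧ 0 < α T (x T)) (hT : 0 ≤ T) : 0 < α 0 ⬝ᵥ β 0 := by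
  rw [← dotProduct_eq hp hα hβ (t := T) ⟨hT, le_rfl⟩, hβ.final]
  refine lt_of_lt_of_le ?_ (Finset.single_le_sum (s := Finset.univ)
    (fun i _ => mul_nonneg (h.1 i) zero_le_one) (Finset.mem_univ (x T)))
  simpa using h.2

end Positivity

end

end CTHMM

open scoped Matrix

namespace CTHMM

noncomputable section

/-! ### Sums over finite hidden paths: the discrete forward-backward identity -/

section PathSums

variable {n : ℕ}

theorem discForward_congr {N N' : ℕ → Matrix (Fin n) (Fin n) ℝ} (v : Fin n → ℝ) {k : ℕ}
    (h : ∀ l < k, N l = N' l) : discForward N v k = discForward N' v k := by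
  induction k with
  | zero => rfl
  | succ k ih =>
    rw [discForward, discForward, ih fun l hl => h l (by omega), h k (Nat.lt_succ_self k)]

theorem discBackward_congr {N N' : ℕ → Matrix (Fin n) (Fin n) ℝ} {j k : ℕ}
    (h : ∀ l, k ≤ l → l < k + j → N l = N' l) : discBackward N j k = discBackward N' j k := by
  induction j generalizing k with
  | zero => rfl
  | succ j ih =>
    rw [discBackward, discBackward, ih fun l hl hl' => h l (by omega) (by omega),
      h k le_rfl (by omega)]

theorem discForward_shift (N : ℕ → Matrix (Fin n) (Fin n) ℝ) (v : Fin n → ℝ) (k : ℕ) :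
    discForward (fun l => N (l + 1)) (v ᵥ* N 0) k = discForward N v (k + 1) := by
  induction k with
  | zero => rfl
  | succ k ih => exact congrArg (· ᵥ* N (k + 1)) ih

theorem discBackward_shift (N : ℕ → Matrix (Fin n) (Fin n) ℝ) (j k : ℕ) :
    discBackward (fun l => N (l + 1)) j k = discBackward N j (k + 1) := by
  induction j generalizing k with
  | zero => rfl
  | succ j ih => rw [discBackward, ih, discBackward]

theorem discForward_nonneg {N : ℕ → Matrix (Fin n) (Fin n) ℝ} {v : Fin n → ℝ}
    (hN : ∀ l i j, 0 ≤ N l i j) (hv : 0 ≤ v) (k : ℕ) : 0 ≤ discForward N v k := by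
  induction k with
  | zero => exact hv
  | succ k ih =>
    exact fun j => Finset.sum_nonneg (s := Finset.univ) fun i _ => mul_nonneg (ih i) (hN k i j)

theorem discBackward_nonneg {N : ℕ → Matrix (Fin n) (Fin n) ℝ}
    (hN : ∀ l i j, 0 ≤ N l i j) (j k : ℕ) : 0 ≤ discBackward N j k := by
  induction j generalizing k with
  | zero => exact fun _ => zero_le_one
  | succ j ih =>
    exact fun i => Finset.sum_nonneg (s := Finset.univ) fun l _ =>
      mul_nonneg (hN k i l) (ih (k + 1) l)

theorem discBackward_eq_one {N : ℕ → Matrix (Fin n) (Fin n) ℝ}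
    (hN : ∀ l i, ∑ j, N l i j = 1) (j k : ℕ) : discBackward N j k = fun _ => 1 := by
  induction j generalizing k with
  | zero => rfl
  | succ j ih =>
    rw [discBackward, ih]
    ext i
    simpa [Matrix.mulVec, dotProduct] using hN k i

/-- The weight of a path: the initial weight times the product of the transition weights. -/
def pathWeight (v : Fin n → ℝ) (N : ℕ → Matrix (Fin n) (Fin n) ℝ) (K : ℕ)
    (x : Fin (K + 1) → Fin n) : ℝ :=
  v (x 0) * ∏ k : Fin K, N k (x k.castSucc) (x k.succ)

/-- Summing out the first state absorbs the first transition matrix into the initial vector; this is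
the induction step for the sums below. -/
theorem sum_cons_pathWeight (v : Fin n → ℝ) (N : ℕ → Matrix (Fin n) (Fin n) ℝ) (K : ℕ)
    (f : (Fin (K + 1) → Fin n) → ℝ) :
    ∑ x : Fin (K + 2) → Fin n, pathWeight v N (K + 1) x * f (Fin.tail x) =
      ∑ x : Fin (K + 1) → Fin n, pathWeight (v ᵥ* N 0) (fun l => N (l + 1)) K x * f x := by
  rw [← (Fin.consEquiv fun _ : Fin (K + 2) => Fin n).sum_comp, Fintype.sum_prod_type,
    Finset.sum_comm]
  refine Finset.sum_congr rfl fun x _ => ?_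
  have hw : ∀ a, pathWeight v N (K + 1) (Fin.cons a x : Fin (K + 2) → Fin n) =
      v a * N 0 a (x 0) * ∏ k : Fin K, N (k + 1) (x k.castSucc) (x k.succ) := fun a => by
    simp only [pathWeight, Fin.prod_univ_succ, Fin.cons_zero, Fin.cons_succ, Fin.castSucc_zero,
      Fin.val_zero, Fin.val_succ, mul_assoc, Fin.castSucc_succ]
  have ht : ∀ a, pathWeight v N (K + 1) (Fin.consEquiv (fun _ : Fin (K + 2) => Fin n) (a, x)) *
      f (Fin.tail (Fin.consEquiv (fun _ : Fin (K + 2) => Fin n) (a, x))) =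
      v a * N 0 a (x 0) * (∏ k : Fin K, N (k + 1) (x k.castSucc) (x k.succ)) * f x :=
    fun a => by rw [← hw a]; rfl
  rw [Finset.sum_congr rfl fun a _ => ht a]
  rw [← Finset.sum_mul, ← Finset.sum_mul, pathWeight]
  rfl

theorem sum_pathWeight (v : Fin n → ℝ) (N : ℕ → Matrix (Fin n) (Fin n) ℝ) (K : ℕ) :
    ∑ x : Fin (K + 1) → Fin n, pathWeight v N K x = v ⬝ᵥ discBackward N K 0 := by
  induction K generalizing v N with
  | zero =>
    rw [← (Equiv.funUnique (Fin 1) (Fin n)).symm.sum_comp]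
    simp [pathWeight, discBackward, dotProduct]
  | succ K ih =>
    have h := sum_cons_pathWeight v N K fun _ => 1
    simp only [mul_one] at h
    rw [h, ih, discBackward_shift, ← Matrix.dotProduct_mulVec]
    rfl

/-- States before index `k` are summed out one at a time. Once the marked state is the first one,
the indicator just replaces the initial vector by its `i`-th component, and the rest of the sum is
the backward recursion. -/
theorem sum_pathWeight_indicator (v : Fin n → ℝ) (N : ℕ → Matrix (Fin n) (Fin n) ℝ) {K k : ℕ}
    (hk : k < K + 1) (i : Fin n) :
    ∑ x : Fin (K + 1) → Fin n, pathWeight v N K x * (if x ⟨k, hk⟩ = i then 1 else 0) =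
      discForward N v k i * discBackward N (K - k) k i := by
  induction k generalizing v N K with
  | zero =>
    have hw : ∀ x : Fin (K + 1) → Fin n, pathWeight v N K x * (if x ⟨0, hk⟩ = i then 1 else 0) =
        pathWeight (Pi.single i (v i)) N K x := fun x => by
      change pathWeight v N K x * (if x 0 = i then 1 else 0) = _
      by_cases h : x 0 = i
      · subst h; simp [pathWeight]
      · simp [pathWeight, h]
    simp only [hw, sum_pathWeight, single_dotProduct, discForward, Nat.sub_zero]
  | succ k ih =>
    obtain ⟨K, rfl⟩ : ∃ L, K = L + 1 := ⟨K - 1, by omega⟩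
    have h := sum_cons_pathWeight v N K fun x => if x ⟨k, by omega⟩ = i then 1 else 0
    have ht : ∀ x : Fin (K + 2) → Fin n, Fin.tail x ⟨k, by omega⟩ = x ⟨k + 1, hk⟩ := fun x => rfl
    simp only [ht] at h
    rw [h, ih, discForward_shift, discBackward_shift, Nat.add_sub_add_right]

end PathSums

/-! ### Emission weights of observation sequences on the grid -/

section Sequences

variable {E F : Type*} [DecidableEq E]

theorem changes_mono (x : ℕ → E) {k l : ℕ} (h : k ≤ l) : changes x k ≤ changes x l := by
  induction l, h using Nat.le_induction with
  | base => rfl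
  | succ l _ ih => rw [changes_succ]; omega

theorem changes_congr {x x' : ℕ → E} {k : ℕ} (h : ∀ l ≤ k, x l = x' l) :
    changes x k = changes x' k := by
  refine Finset.sum_congr rfl fun l hl => ?_
  have := Finset.mem_range.1 hl
  rw [h l (by omega), h (l + 1) (by omega)]

theorem exists_changes_eq (x : ℕ → E) {K s : ℕ} (h : s ≤ changes x K) :
    ∃ k ≤ K, changes x k = s := by
  induction K with
  | zero => exact ⟨0, le_rfl, by rw [changes_zero] at *; omega⟩
  | succ K ih =>
    by_cases hs : s ≤ changes x K
    · obtain ⟨k, hk, he⟩ := ih hs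
      exact ⟨k, by omega, he⟩
    · refine ⟨K + 1, le_rfl, ?_⟩
      have h1 := changes_succ x K
      split_ifs at h1 <;> omega

/-- A sequence that changes only where `x` does is a function of the number of changes of `x`. -/
theorem eq_of_changes_eq {x : ℕ → E} {f : ℕ → F} {K : ℕ}
    (hf : ∀ k < K, x k = x (k + 1) → f k = f (k + 1)) {k l : ℕ} (hk : k ≤ K) (hl : l ≤ K)
    (h : changes x k = changes x l) : f k = f l := by
  wlog hkl : k ≤ l generalizing k l
  · exact (this hl hk h.symm (by omega)).symm
  induction l, hkl using Nat.le_induction with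
  | base => rfl
  | succ l hkl ih =>
    have h1 := changes_mono x hkl
    have h2 := changes_succ x l
    split_ifs at h2 with he
    · rw [ih (by omega) (by omega), hf l (by omega) he]
    · omega

/-- The conditional probability of the observations on a grid given the hidden states, if at most
one hidden jump happens per cell. -/
def emissionWeight {n m : ℕ} (r : Fin n → Fin m → ℝ) (x : ℕ → Fin n) (y : ℕ → Fin m) (K : ℕ) : ℝ :=
  r (x 0) (y 0) * ∏ k ∈ Finset.range K,
    if x k = x (k + 1) then (if y k = y (k + 1) then 1 else 0) else r (x (k + 1)) (y (k + 1))

/-- Cells without a hidden change contribute `1`, so one emission per hidden piece remains. Any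
representative `c s` of piece `s` may be used; the right side is the product that occurs in
`IsCTHMM.observe`. -/
theorem emissionWeight_eq_prod {n m : ℕ} (r : Fin n → Fin m → ℝ) {x : ℕ → Fin n} {y : ℕ → Fin m}
    {K : ℕ} (hy : ∀ k < K, x k = x (k + 1) → y k = y (k + 1)) {c : ℕ → ℕ}
    (hc : ∀ s ≤ changes x K, c s ≤ K ∧ changes x (c s) = s) :
    emissionWeight r x y K =
      ∏ s ∈ Finset.range (changes x K + 1), r (x (c s)) (y (c s)) := by
  have hxy : ∀ k ≤ K, x (c (changes x k)) = x k ∧ y (c (changes x k)) = y k := fun k hk => by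
    obtain ⟨h1, h2⟩ := hc _ (changes_mono x hk)
    exact ⟨eq_of_changes_eq (fun _ _ h => h) h1 hk h2, eq_of_changes_eq hy h1 hk h2⟩
  have key : ∀ k ≤ K, emissionWeight r x y k =
      ∏ s ∈ Finset.range (changes x k + 1), r (x (c s)) (y (c s)) := fun k hk => by
    induction k with
    | zero =>
      obtain ⟨h1, h2⟩ := hxy 0 (Nat.zero_le K)
      rw [changes_zero] at h1 h2
      simp [emissionWeight, h1, h2]
    | succ k ih =>
      have hstep : emissionWeight r x y (k + 1) = emissionWeight r x y k *
          if x k = x (k + 1) then (if y k = y (k + 1) then 1 else 0)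
            else r (x (k + 1)) (y (k + 1)) := by
        rw [emissionWeight, emissionWeight, Finset.prod_range_succ, mul_assoc]
      obtain ⟨h1, h2⟩ := hxy (k + 1) hk
      rw [hstep, ih (by omega), changes_succ] at *
      split_ifs at * with he hye
      · simp
      · exact absurd (hy k hk he) hye
      · rw [Finset.prod_range_succ _ (changes x k + 1), h1, h2]
  exact key K le_rfl

theorem emissionWeight_eq_zero {n m : ℕ} (r : Fin n → Fin m → ℝ) {x : ℕ → Fin n} {y : ℕ → Fin m}
    {K k : ℕ} (hk : k < K) (hx : x k = x (k + 1)) (hy : y k ≠ y (k + 1)) :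
    emissionWeight r x y K = 0 := by
  rw [emissionWeight, Finset.prod_eq_zero (Finset.mem_range.2 hk), mul_zero]
  rw [if_pos hx, if_neg hy]

/-- A finite path, extended to all indices. -/
def extendPath {K : ℕ} (x : Fin (K + 1) → F) (k : ℕ) : F := x (Fin.ofNat (K + 1) k)

theorem extendPath_of_lt {K k : ℕ} (x : Fin (K + 1) → F) (hk : k < K + 1) :
    extendPath x k = x ⟨k, hk⟩ := by
  rw [extendPath]
  congr 1
  exact Fin.ext (Nat.mod_eq_of_lt hk)

/-- For fixed hidden states the weight in `y` is that of an inhomogeneous Markov chain with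
stochastic matrices: keep the value, or draw a new one. -/
theorem sum_emissionWeight {n m : ℕ} {r : Fin n → Fin m → ℝ} (hr : ∀ i, ∑ z, r i z = 1)
    (x : ℕ → Fin n) (K : ℕ) :
    ∑ y : Fin (K + 1) → Fin m, emissionWeight r x (extendPath y) K = 1 := by
  set N : ℕ → Matrix (Fin m) (Fin m) ℝ := fun k => Matrix.of fun z z' =>
    if x k = x (k + 1) then (if z = z' then 1 else 0) else r (x (k + 1)) z' with hN
  have h1 : ∀ y : Fin (K + 1) → Fin m, emissionWeight r x (extendPath y) K =
      pathWeight (r (x 0)) N K y := fun y => by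
    rw [emissionWeight, pathWeight, Finset.prod_range]
    congr 1
    refine Finset.prod_congr rfl fun k _ => ?_
    rw [extendPath_of_lt y (by omega : (k : ℕ) < K + 1),
      extendPath_of_lt y (by omega : (k : ℕ) + 1 < K + 1)]
    rfl
  simp only [h1]
  rw [sum_pathWeight, discBackward_eq_one]
  · simpa [dotProduct] using hr (x 0)
  · intro l z
    simp only [hN, Matrix.of_apply]
    split_ifs
    · simp
    · exact hr _

theorem stepMatrix_apply {n m : ℕ} (P : Matrix (Fin n) (Fin n) ℝ) (r : Fin n → Fin m → ℝ)
    (y y' : Fin m) (i j : Fin n) : stepMatrix P r y y' i j =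
      P i j * if i = j then (if y = y' then 1 else 0) else r j y' := by
  unfold stepMatrix
  by_cases hy : y = y'
  · rw [if_pos hy, heldRate_apply]
    by_cases h : i = j
    · subst h; simp [hy]
    · simp [h, hy]
  · rw [if_neg hy, jumpRate_apply]
    by_cases h : i = j
    · simp [h, hy]
    · simp [h]

/-- Transition and emission factors combine cell by cell into `stepMatrix`. -/
theorem prod_mul_emissionWeight {n m : ℕ} (P : Matrix (Fin n) (Fin n) ℝ) (r : Fin n → Fin m → ℝ)
    (π₀ : Fin n → ℝ) {K : ℕ} (x : Fin (K + 1) → Fin n) (y : ℕ → Fin m) :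
    (π₀ (extendPath x 0) * ∏ k ∈ Finset.range K, P (extendPath x k) (extendPath x (k + 1))) *
        emissionWeight r (extendPath x) y K =
      pathWeight (π₀ ᵥ* R r (y 0)) (fun l => stepMatrix P r (y l) (y (l + 1))) K x := by
  rw [emissionWeight, mul_mul_mul_comm, ← Finset.prod_mul_distrib, pathWeight,
    Finset.prod_range]
  congr 1
  · rw [R, Matrix.vecMul_diagonal]; rfl
  · refine Finset.prod_congr rfl fun k _ => ?_
    have h1 : extendPath x k = x k.castSucc := extendPath_of_lt x (by omega)
    have h2 : extendPath x (k + 1) = x k.succ := extendPath_of_lt x (by omega)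
    rw [h1, h2, stepMatrix_apply]

end Sequences

end

end CTHMM

open scoped Matrix

namespace CTHMM

noncomputable section

/-! ### The law of the model on the grid, on the event that the grid sees all hidden jumps -/

section Skeleton

variable {Ω : Type*}

theorem measurable_pathSigma {k : ℕ} {Z : ℝ → Ω → Fin k} {t u : ℝ}
    (hu : u ∈ Icc 0 t) : Measurable[pathSigma Z t] (Z u) :=
  measurable_iff_comap_le.2 (le_iSup₂_of_le u hu le_rfl)

theorem pathSigma_le [MeasurableSpace Ω] {k : ℕ} {Z : ℝ → Ω → Fin k} {t : ℝ}
    (h : ∀ u ∈ Icc 0 t, Measurable (Z u)) : pathSigma Z t ≤ ‹MeasurableSpace Ω› :=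
  iSup₂_le fun u hu => (h u hu).comap_le

theorem measurable_changes [MeasurableSpace Ω] {k : ℕ} {Z : ℕ → Ω → Fin k} {K : ℕ}
    (h : ∀ l ≤ K, Measurable (Z l)) : Measurable fun ω => changes (fun l => Z l ω) K := by
  unfold changes
  refine Finset.measurable_fun_sum _ fun l hl => ?_
  have := Finset.mem_range.1 hl
  exact Measurable.ite (measurableSet_eq_fun (h l (by omega)) (h (l + 1) (by omega)))
    measurable_const measurable_const

theorem measurableSet_forall_eq [MeasurableSpace Ω] {k : ℕ} {Z : ℕ → Ω → Fin k} {K : ℕ}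
    (h : ∀ l ≤ K, Measurable (Z l)) (z : ℕ → Fin k) :
    MeasurableSet {ω | ∀ l ≤ K, Z l ω = z l} := by
  have : {ω | ∀ l ≤ K, Z l ω = z l} = ⋂ l, ⋂ (_ : l ≤ K), Z l ⁻¹' {z l} := by ext; simp
  rw [this]
  exact MeasurableSet.iInter fun l => MeasurableSet.iInter fun hl =>
    h l hl (measurableSet_singleton _)

variable {n m : ℕ} {T : ℝ} {X : ℝ → Ω → Fin n}

/-- The outcomes for which the grid with `K` cells, and every finer one in the sequence of uniform
grids, sees all hidden jumps. -/
def fineSet (T : ℝ) (X : ℝ → Ω → Fin n) (K : ℕ) : Set Ω :=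
  {ω | ∀ K' ≥ K, changes (fun l => X (grid T K' l) ω) K' = changes (fun l => X (grid T K l) ω) K}

/-- Measurability with respect to the hidden path alone is essential: the event becomes part of the
conditioning event in `IsCTHMM.observe`. Comparing with all finer grids, not with the number of
jumps, gives it at once and makes the events increase with `K`. -/
theorem measurableSet_fineSet (hT : 0 ≤ T) {K : ℕ} (hK : 0 < K) :
    MeasurableSet[pathSigma X T] (fineSet T X K) := by
  have hm : ∀ L > 0, Measurable[pathSigma X T] fun ω => changes (fun l => X (grid T L l) ω) L :=
    fun L hL => @measurable_changes _ (pathSigma X T) _ (fun l => X (grid T L l)) L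
      fun l hl => measurable_pathSigma (grid_mem hT hL hl)
  have : fineSet T X K = ⋂ K', ⋂ (_ : K' ≥ K),
      {ω | changes (fun l => X (grid T K' l) ω) K' = changes (fun l => X (grid T K l) ω) K} := by
    ext; simp [fineSet]
  rw [this]
  refine @MeasurableSet.iInter _ _ (pathSigma X T) _ _ fun K' =>
    @MeasurableSet.iInter _ _ (pathSigma X T) _ _ fun hK' => ?_
  exact @measurableSet_eq_fun _ _ (pathSigma X T) _ _ _ _ (hm K' (by omega)) (hm K hK)

theorem fineSet_mono : Monotone (fineSet T X) := fun K L hKL ω hω K' hK' => by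
  rw [hω K' (by omega), hω L hKL]

/-- Sufficiently fine grids count exactly `S` changes, and on this event the count at `K` is already
the eventual one. -/
theorem changes_eq_of_mem_fineSet (hT : 0 ≤ T) {K : ℕ} {ω : Ω} (hω : ω ∈ fineSet T X K) {S : ℕ}
    {τ : ℕ → ℝ} (hp : IsJumpPartition T (fun t => X t ω) S τ) :
    changes (fun l => X (grid T K l) ω) K = S := by
  obtain ⟨L, hL, hge⟩ := ((hp.eventually_changes_eq hT).and (eventually_ge_atTop K)).exists
  rw [← hω L hge, hL]

variable [MeasurableSpace Ω] {μ : Measure Ω}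
  {Q : Matrix (Fin n) (Fin n) ℝ} {r : Fin n → Fin m → ℝ} {π₀ : Fin n → ℝ} {Y : ℝ → Ω → Fin m} {P : ℝ → Matrix (Fin n) (Fin n) ℝ}

/-- The Markov property with transition matrices `P`. -/
def IsMarkov (μ : Measure Ω) (T : ℝ) (P : ℝ → Matrix (Fin n) (Fin n) ℝ) (X : ℝ → Ω → Fin n) :
    Prop :=
  ∀ s t, 0 ≤ s → s ≤ t → t ≤ T → ∀ A, MeasurableSet[pathSigma X s] A → ∀ i j,
    μ.real (A ∩ {ω | X s ω = i} ∩ {ω | X t ω = j}) =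
      μ.real (A ∩ {ω | X s ω = i}) * P (t - s) i j

/-- The Markov property does not determine the rows of `P 0` at states of probability zero, so `P 0`
is redefined as the identity, which changes neither that property nor the limit at `0`. -/
theorem IsJumpProcess.exists_hasGenerator (h : IsJumpProcess μ T Q π₀ X) :
    ∃ P, HasGenerator P Q ∧ IsMarkov μ T P X := by
  obtain ⟨P, hP, hM, hlim⟩ := h.markov
  refine ⟨fun u => if u = 0 then 1 else P u, ⟨by simp, fun u hu => ?_, fun i j hij => ?_, h.diag⟩,
    fun s t hs hst ht A hA i j => ?_⟩
  · split_ifs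
    · exact one_mem _
    · exact hP u hu
  · refine (hlim i j hij).congr' ?_
    filter_upwards [self_mem_nhdsWithin] with u hu
    rw [if_neg (ne_of_gt hu)]
  · dsimp only
    split_ifs with h0
    · have hts : t = s := by linarith
      subst hts
      by_cases hij : i = j
      · subst hij
        rw [inter_assoc, inter_self, Matrix.one_apply_eq, mul_one]
      · have he : A ∩ {ω | X t ω = i} ∩ {ω | X t ω = j} = ∅ := by
          ext ω
          simp only [mem_inter_iff, mem_ofPred_eq, mem_empty_iff_false, iff_false, not_and]
          exact fun h1 h2 => hij (h1.2.symm.trans h2)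
        rw [he, Matrix.one_apply_ne hij]
        simp
    · exact hM s t hs hst ht A hA i j

theorem IsMarkov.measureReal_skeleton (hM : IsMarkov μ T P X) (hT : 0 ≤ T)
    (hinit : ∀ i, μ.real {ω | X 0 ω = i} = π₀ i) {K : ℕ} (hK : 0 < K) (x : ℕ → Fin n) {j : ℕ}
    (hj : j ≤ K) :
    μ.real {ω | ∀ k ≤ j, X (grid T K k) ω = x k} =
      π₀ (x 0) * ∏ k ∈ Finset.range j, P (T / K) (x k) (x (k + 1)) := by
  induction j with
  | zero => simpa using hinit (x 0)
  | succ j ih =>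
    have hA : MeasurableSet[pathSigma X (grid T K j)]
        {ω | ∀ k ≤ j, X (grid T K k) ω = x k} :=
      @measurableSet_forall_eq _ (pathSigma X (grid T K j)) _ (fun k => X (grid T K k)) j
        (fun l hl => measurable_pathSigma
          ⟨(grid_mem hT hK (by omega)).1, grid_mono hT hl⟩) x
    have h := hM (grid T K j) (grid T K (j + 1)) (grid_mem hT hK (by omega)).1
      (grid_mono hT (Nat.le_succ j)) (grid_mem hT hK hj).2 _ hA (x j) (x (j + 1))
    have h1 : {ω | ∀ k ≤ j, X (grid T K k) ω = x k} ∩ {ω | X (grid T K j) ω = x j} =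
        {ω | ∀ k ≤ j, X (grid T K k) ω = x k} :=
      inter_eq_left.2 fun ω hω => hω j le_rfl
    have h2 : {ω | ∀ k ≤ j, X (grid T K k) ω = x k} ∩
        {ω | X (grid T K (j + 1)) ω = x (j + 1)} =
        {ω | ∀ k ≤ j + 1, X (grid T K k) ω = x k} := by
      ext ω
      constructor
      · rintro ⟨ha, hb⟩ k hk
        rcases Nat.lt_or_ge j k with hlt | hge
        · obtain rfl : k = j + 1 := by omega
          exact hb
        · exact ha k hge
      · exact fun ha => ⟨fun k hk => ha k (by omega), ha (j + 1) le_rfl⟩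
    rw [h1, h2, ih (by omega), grid_succ, add_sub_cancel_left] at h
    rw [h, Finset.prod_range_succ, mul_assoc]

theorem iUnion_fineSet (hX : IsJumpProcess μ T Q π₀ X) (hT : 0 ≤ T) :
    ⋃ K, fineSet T X K = univ := by
  refine eq_univ_of_forall fun ω => ?_
  obtain ⟨S, τ, hp⟩ := hX.path ω
  obtain ⟨K, hK⟩ := eventually_atTop.1 (hp.eventually_changes_eq hT)
  exact mem_iUnion.2 ⟨K, fun K' hK' => by rw [hK K' hK', hK K le_rfl]⟩

theorem tendsto_measureReal_compl_fineSet [IsProbabilityMeasure μ] (hX : IsJumpProcess μ T Q π₀ X) (hT : 0 ≤ T) :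
    Tendsto (fun K => μ.real (fineSet T X K)ᶜ) atTop (𝓝 0) := by
  have h1 : Tendsto (fun K => μ.real (fineSet T X K)) atTop (𝓝 1) := by
    have := tendsto_measure_iUnion_atTop (μ := μ) (fineSet_mono (T := T) (X := X))
    rw [iUnion_fineSet hX hT, measure_univ] at this
    exact (ENNReal.tendsto_toReal ENNReal.one_ne_top).comp this
  have h2 : Tendsto (fun K => 1 - μ.real (fineSet T X K)) atTop (𝓝 0) := by
    simpa using h1.const_sub 1
  refine h2.congr' ?_
  filter_upwards [eventually_gt_atTop 0] with K hK
  rw [probReal_compl_eq_one_sub]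
  exact pathSigma_le hX.measurable _ (measurableSet_fineSet hT hK)

/-- On the event `A` the hidden path has exactly `changes x K` jumps and the `k`-th grid point lies
in its piece `changes x k`. The grid observations are therefore the emitted values, whose
conditional law is the product given by `IsCTHMM.observe`. -/
theorem IsCTHMM.measureReal_skeleton_inter_fineSet (h : IsCTHMM μ T Q r π₀ X Y) (hT : 0 ≤ T)
    {K : ℕ} (hK : 0 < K) (x : ℕ → Fin n) (y : ℕ → Fin m) :
    μ.real ({ω | ∀ k ≤ K, X (grid T K k) ω = x k} ∩ fineSet T X K ∩
        {ω | ∀ k ≤ K, Y (grid T K k) ω = y k}) =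
      μ.real ({ω | ∀ k ≤ K, X (grid T K k) ω = x k} ∩ fineSet T X K) *
        emissionWeight r x y K := by
  set A : Set Ω := {ω | ∀ k ≤ K, X (grid T K k) ω = x k} ∩ fineSet T X K with hA
  set S := changes x K with hS
  have hAm : MeasurableSet[pathSigma X T] A :=
    @MeasurableSet.inter _ (pathSigma X T) _ _
      (@measurableSet_forall_eq _ (pathSigma X T) _ (fun k => X (grid T K k)) K
        (fun l hl => measurable_pathSigma (grid_mem hT hK hl)) x)
      (measurableSet_fineSet hT hK)
  have hch : ∀ ω ∈ A, ∀ k ≤ K, changes (fun l => X (grid T K l) ω) k = changes x k :=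
    fun ω hω k hk => changes_congr fun l hl => hω.1 l (by omega)
  have hidx : ∀ ω ∈ A, ∀ τ, IsJumpPartition T (fun t => X t ω) S τ → ∀ k ≤ K,
      X (τ (changes x k)) ω = x k ∧ Y (τ (changes x k)) ω = Y (grid T K k) ω := by
    intro ω hω τ hp k hk
    have h1 := hp.changes_eq_pieceIndex hT hK (hch ω hω K le_rfl) hk
    rw [hch ω hω k hk] at h1
    have hmem := hp.mem_piece (grid_mem hT hK hk)
    rw [h1]
    have h2 := hp.const _ (pieceIndex_le _) _ hmem
    have h3 := h.held ω S τ hp _ (pieceIndex_le _) _ hmem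
    exact ⟨h2.symm.trans (hω.1 k hk), h3.symm⟩
  have hex : ∀ ω ∈ A, ∃ τ, IsJumpPartition T (fun t => X t ω) S τ := fun ω hω => by
    obtain ⟨S₀, τ, hp⟩ := h.hidden.path ω
    have h1 := changes_eq_of_mem_fineSet hT hω.2 hp
    rw [hch ω hω K le_rfl] at h1
    exact ⟨τ, by rw [hS, h1]; exact hp⟩
  -- If `y` changes in a cell where `x` does not, the weight vanishes and the event is empty.
  by_cases hy : ∀ k < K, x k = x (k + 1) → y k = y (k + 1)
  · have hc : ∀ s, ∃ k, s ≤ S → k ≤ K ∧ changes x k = s := fun s => by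
      by_cases hs : s ≤ S
      · obtain ⟨k, h1, h2⟩ := exists_changes_eq x hs
        exact ⟨k, fun _ => ⟨h1, h2⟩⟩
      · exact ⟨0, fun h => absurd h hs⟩
    choose c hc using hc
    have hobs := h.observe A hAm S (fun s => x (c s)) fun s => y (c s)
    rw [← emissionWeight_eq_prod r hy hc] at hobs
    have e1 : A ∩ {ω | ∃ τ, IsJumpPartition T (fun t => X t ω) S τ ∧
        ∀ s ≤ S, X (τ s) ω = x (c s)} = A := by
      refine inter_eq_left.2 fun ω hω => ?_
      obtain ⟨τ, hp⟩ := hex ω hω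
      refine ⟨τ, hp, fun s hs => ?_⟩
      have := (hidx ω hω τ hp (c s) (hc s hs).1).1
      rwa [(hc s hs).2] at this
    have e2 : A ∩ {ω | ∃ τ, IsJumpPartition T (fun t => X t ω) S τ ∧
        ∀ s ≤ S, X (τ s) ω = x (c s) ∧ Y (τ s) ω = y (c s)} =
        A ∩ {ω | ∀ k ≤ K, Y (grid T K k) ω = y k} := by
      ext ω
      refine and_congr_right fun hω => ⟨?_, fun hYω => ?_⟩
      · rintro ⟨τ, hp, hτ⟩ k hk
        have hs := changes_mono x hk
        rw [← (hidx ω hω τ hp k hk).2, (hτ _ hs).2]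
        exact eq_of_changes_eq hy (hc _ hs).1 hk (hc _ hs).2
      · obtain ⟨τ, hp⟩ := hex ω hω
        refine ⟨τ, hp, fun s hs => ?_⟩
        obtain ⟨h1, h2⟩ := hidx ω hω τ hp (c s) (hc s hs).1
        rw [(hc s hs).2] at h1 h2
        exact ⟨h1, h2.trans (hYω _ (hc s hs).1)⟩
    rw [e1, e2] at hobs
    exact hobs
  · push Not at hy
    obtain ⟨k, hk, hxk, hyk⟩ := hy
    rw [emissionWeight_eq_zero r hk hxk hyk, mul_zero]
    have : A ∩ {ω | ∀ k ≤ K, Y (grid T K k) ω = y k} = ∅ := by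
      rw [eq_empty_iff_forall_notMem]
      rintro ω ⟨hω, hYω⟩
      obtain ⟨τ, hp⟩ := hex ω hω
      have h1 := (hidx ω hω τ hp k hk.le).2
      have h2 := (hidx ω hω τ hp (k + 1) hk).2
      rw [changes_succ, if_pos hxk, add_zero, h1] at h2
      rw [hYω k hk.le, hYω (k + 1) hk] at h2
      exact hyk h2
    rw [this]
    simp

end Skeleton

end

end CTHMM

open scoped Matrix

namespace CTHMM

noncomputable section

/-! ### Comparison of the true law on the grid with the discrete model -/

section DiscretePosterior

variable {Ω : Type*} [MeasurableSpace Ω] {μ : Measure Ω} {n m : ℕ}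
  {T : ℝ} {Q : Matrix (Fin n) (Fin n) ℝ} {r : Fin n → Fin m → ℝ} {π₀ : Fin n → ℝ}
  {X : ℝ → Ω → Fin n} {Y : ℝ → Ω → Fin m} {P : ℝ → Matrix (Fin n) (Fin n) ℝ}

theorem IsCTHMM.init_nonneg (h : IsCTHMM μ T Q r π₀ X Y) (z : Fin m) : 0 ≤ π₀ ᵥ* R r z :=
  fun i => by
    rw [R, Matrix.vecMul_diagonal, ← h.hidden.init i]
    exact mul_nonneg measureReal_nonneg ((h.emission i).1 z)

variable [IsProbabilityMeasure μ]

theorem sum_measureReal_inter_preimage {ι : Type*} [Fintype ι] [MeasurableSpace ι]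
    [MeasurableSingletonClass ι] {f : Ω → ι} (hf : Measurable f) (C : Set Ω) :
    ∑ i, μ.real (C ∩ f ⁻¹' {i}) = μ.real C := by
  have h := sum_measureReal_preimage_singleton (μ := μ.restrict C) (Finset.univ : Finset ι)
    (f := f) (fun i _ => hf (measurableSet_singleton i))
  simp only [Finset.coe_univ, preimage_univ, measureReal_restrict_apply MeasurableSet.univ,
    univ_inter] at h
  rw [← h]
  refine Finset.sum_congr rfl fun i _ => ?_
  rw [measureReal_restrict_apply (hf (measurableSet_singleton i)), inter_comm]

/-- The values of a process on the grid with `K` cells. -/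
def gridPath {Ω E : Type*} (T : ℝ) (K : ℕ) (Z : ℝ → Ω → E) (ω : Ω) : Fin (K + 1) → E :=
  fun k => Z (grid T K k) ω

theorem gridPath_preimage {Ω E : Type*} {Z : ℝ → Ω → E} {K : ℕ} (z : Fin (K + 1) → E) :
    gridPath T K Z ⁻¹' {z} = {ω | ∀ k ≤ K, Z (grid T K k) ω = extendPath z k} := by
  ext ω
  simp only [mem_preimage, mem_singleton_iff, mem_ofPred_eq]
  constructor
  · rintro rfl k hk
    rw [extendPath_of_lt _ (Nat.lt_succ_of_le hk)]
    rfl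
  · intro h
    funext k
    have := h k (Nat.lt_succ_iff.1 k.2)
    rwa [extendPath_of_lt _ k.2] at this

theorem measurable_gridPath {k : ℕ} {Z : ℝ → Ω → Fin k} (hT : 0 ≤ T) {K : ℕ} (hK : 0 < K)
    (h : ∀ t ∈ Icc 0 T, Measurable (Z t)) : Measurable (gridPath T K Z) :=
  measurable_pi_lambda _ fun l => h _ (grid_mem hT hK (Nat.lt_succ_iff.1 l.2))

/-- The one-step matrices along a finite observation path. -/
def pathStep (P : Matrix (Fin n) (Fin n) ℝ) (r : Fin n → Fin m → ℝ) {K : ℕ}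
    (y : Fin (K + 1) → Fin m) (l : ℕ) : Matrix (Fin n) (Fin n) ℝ :=
  stepMatrix P r (extendPath y l) (extendPath y (l + 1))

/-- Splitting each term along `fineSet`, the parts inside agree exactly. Outside, the true masses
and the model masses each add up to the probability of the complement, whence the factor `2`. -/
theorem IsCTHMM.sum_abs_sub_le (h : IsCTHMM μ T Q r π₀ X Y) (hM : IsMarkov μ T P X)
    (hT : 0 ≤ T) {K : ℕ} (hK : 0 < K) :
    ∑ y : Fin (K + 1) → Fin m, ∑ x : Fin (K + 1) → Fin n,
      |μ.real (gridPath T K Y ⁻¹' {y} ∩ gridPath T K X ⁻¹' {x}) -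
        pathWeight (π₀ ᵥ* R r (y 0)) (pathStep (P (T / K)) r y) K x| ≤
      2 * μ.real (fineSet T X K)ᶜ := by
  have hXm := measurable_gridPath hT hK h.hidden.measurable
  have hYm := measurable_gridPath hT hK h.measurable
  have hHm : MeasurableSet (fineSet T X K) :=
    pathSigma_le h.hidden.measurable _ (measurableSet_fineSet hT hK)
  set H := fineSet T X K with hH
  have hw0 : ∀ (x : Fin (K + 1) → Fin n) (y : Fin (K + 1) → Fin m),
      0 ≤ emissionWeight r (extendPath x) (extendPath y) K := fun x y => by
    refine mul_nonneg ((h.emission _).1 _) (Finset.prod_nonneg fun k _ => ?_)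
    split_ifs
    · exact zero_le_one
    · exact le_rfl
    · exact (h.emission _).1 _
  have hterm : ∀ (y : Fin (K + 1) → Fin m) (x : Fin (K + 1) → Fin n),
      |μ.real (gridPath T K Y ⁻¹' {y} ∩ gridPath T K X ⁻¹' {x}) -
        pathWeight (π₀ ᵥ* R r (y 0)) (pathStep (P (T / K)) r y) K x| ≤
      μ.real (Hᶜ ∩ gridPath T K Y ⁻¹' {y} ∩ gridPath T K X ⁻¹' {x}) +
        μ.real (Hᶜ ∩ gridPath T K X ⁻¹' {x}) *
          emissionWeight r (extendPath x) (extendPath y) K := by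
    intro y x
    set a := gridPath T K X ⁻¹' {x} with ha
    set b := gridPath T K Y ⁻¹' {y} with hb
    have hp : pathWeight (π₀ ᵥ* R r (y 0)) (pathStep (P (T / K)) r y) K x =
        μ.real a * emissionWeight r (extendPath x) (extendPath y) K := by
      rw [ha, gridPath_preimage, hM.measureReal_skeleton hT h.hidden.init hK _ le_rfl,
        prod_mul_emissionWeight]
      rfl
    have hfine : μ.real (a ∩ H ∩ b) =
        μ.real (a ∩ H) * emissionWeight r (extendPath x) (extendPath y) K := by
      rw [ha, hb, gridPath_preimage, gridPath_preimage]
      exact h.measureReal_skeleton_inter_fineSet hT hK _ _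
    have e1 : μ.real (b ∩ a) = μ.real (a ∩ H ∩ b) + μ.real (Hᶜ ∩ b ∩ a) := by
      rw [← measureReal_inter_add_sdiff (s := b ∩ a) hHm]
      congr 2 <;> (ext; simp; tauto)
    have e2 : μ.real a = μ.real (a ∩ H) + μ.real (Hᶜ ∩ a) := by
      rw [← measureReal_inter_add_sdiff (s := a) hHm]
      congr 2
      ext; simp; tauto
    rw [hp, e1, e2, hfine]
    have h1 : 0 ≤ μ.real (Hᶜ ∩ b ∩ a) := measureReal_nonneg
    have h2 : 0 ≤ μ.real (Hᶜ ∩ a) * emissionWeight r (extendPath x) (extendPath y) K :=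
      mul_nonneg measureReal_nonneg (hw0 x y)
    rw [abs_le]
    constructor <;> linarith
  refine (Finset.sum_le_sum fun y _ => Finset.sum_le_sum fun x _ => hterm y x).trans ?_
  simp only [Finset.sum_add_distrib]
  have s1 : ∑ y, ∑ x, μ.real (Hᶜ ∩ gridPath T K Y ⁻¹' {y} ∩ gridPath T K X ⁻¹' {x}) =
      μ.real Hᶜ := by
    simp only [sum_measureReal_inter_preimage hXm, sum_measureReal_inter_preimage hYm]
  have s2 : ∑ y : Fin (K + 1) → Fin m, ∑ x : Fin (K + 1) → Fin n,
      μ.real (Hᶜ ∩ gridPath T K X ⁻¹' {x}) *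
        emissionWeight r (extendPath x) (extendPath y) K = μ.real Hᶜ := by
    rw [Finset.sum_comm]
    simp only [← Finset.mul_sum, sum_emissionWeight fun i => (h.emission i).2, mul_one,
      sum_measureReal_inter_preimage hXm]
  rw [s1, s2]
  linarith

theorem discPosterior_nonneg {N : ℕ → Matrix (Fin n) (Fin n) ℝ} {v : Fin n → ℝ}
    (hN : ∀ l i j, 0 ≤ N l i j) (hv : 0 ≤ v) (K k : ℕ) (i : Fin n) :
    0 ≤ discPosterior N v K k i :=
  div_nonneg (mul_nonneg (discForward_nonneg hN hv k i) (discBackward_nonneg hN _ k i))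
    (Finset.sum_nonneg fun j _ => mul_nonneg (discForward_nonneg hN hv k j)
      (discBackward_nonneg hN _ k j))

theorem mul_le_dotProduct {N : ℕ → Matrix (Fin n) (Fin n) ℝ} {v : Fin n → ℝ}
    (hN : ∀ l i j, 0 ≤ N l i j) (hv : 0 ≤ v) (K k : ℕ) (i : Fin n) :
    discForward N v k i * discBackward N (K - k) k i ≤
      discForward N v k ⬝ᵥ discBackward N (K - k) k :=
  Finset.single_le_sum (f := fun i => discForward N v k i * discBackward N (K - k) k i)
    (fun j _ => mul_nonneg (discForward_nonneg hN hv k j) (discBackward_nonneg hN _ k j))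
    (Finset.mem_univ i)

theorem discPosterior_le_one {N : ℕ → Matrix (Fin n) (Fin n) ℝ} {v : Fin n → ℝ}
    (hN : ∀ l i j, 0 ≤ N l i j) (hv : 0 ≤ v) (K k : ℕ) (i : Fin n) :
    discPosterior N v K k i ≤ 1 :=
  div_le_one_of_le₀ (mul_le_dotProduct hN hv K k i)
    (Finset.sum_nonneg fun j _ => mul_nonneg (discForward_nonneg hN hv k j)
      (discBackward_nonneg hN _ k j))

theorem discPosterior_mul {N : ℕ → Matrix (Fin n) (Fin n) ℝ} {v : Fin n → ℝ}
    (hN : ∀ l i j, 0 ≤ N l i j) (hv : 0 ≤ v) (K k : ℕ) (i : Fin n) :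
    discPosterior N v K k i * (discForward N v k ⬝ᵥ discBackward N (K - k) k) =
      discForward N v k i * discBackward N (K - k) k i := by
  have h1 := mul_le_dotProduct hN hv K k i
  have h2 := mul_nonneg (discForward_nonneg hN hv k i) (discBackward_nonneg hN (K - k) k i)
  unfold discPosterior
  -- A zero denominator forces a zero numerator by nonnegativity, so the identity survives division
  -- by zero.
  by_cases h0 : discForward N v k ⬝ᵥ discBackward N (K - k) k = 0
  · rw [h0, mul_zero]
    rw [h0] at h1
    linarith
  · exact div_mul_cancel₀ _ h0

theorem sum_pathWeight_eq (v : Fin n → ℝ) (N : ℕ → Matrix (Fin n) (Fin n) ℝ) {K k : ℕ}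
    (hk : k < K + 1) :
    ∑ x : Fin (K + 1) → Fin n, pathWeight v N K x =
      discForward N v k ⬝ᵥ discBackward N (K - k) k := by
  rw [dotProduct]
  simp only [← sum_pathWeight_indicator v N hk]
  rw [Finset.sum_comm]
  simp

theorem stepMatrix_nonneg {P : Matrix (Fin n) (Fin n) ℝ} (hP : ∀ i j, 0 ≤ P i j)
    (hr : ∀ i z, 0 ≤ r i z) (y y' : Fin m) (i j : Fin n) : 0 ≤ stepMatrix P r y y' i j := by
  rw [stepMatrix_apply]
  refine mul_nonneg (hP i j) ?_
  split_ifs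
  · exact zero_le_one
  · exact le_rfl
  · exact hr _ _

theorem integral_comp_fintype {ι : Type*} [Fintype ι] [MeasurableSpace ι]
    [MeasurableSingletonClass ι] {f : Ω → ι} (hf : Measurable f) (g : ι → ℝ) :
    ∫ ω, g (f ω) ∂μ = ∑ i, μ.real (f ⁻¹' {i}) * g i := by
  have hg : Measurable g := measurable_of_finite g
  have : IsProbabilityMeasure (μ.map f) := Measure.isProbabilityMeasure_map hf.aemeasurable
  rw [← integral_map hf.aemeasurable hg.aestronglyMeasurable, integral_fintype .of_finite]
  simp [map_measureReal_apply hf (measurableSet_singleton _)]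

/-- The posterior probabilities of the discretized model are, in the mean, close to the true
ones. -/
theorem IsCTHMM.abs_measureReal_sub_integral_le (h : IsCTHMM μ T Q r π₀ X Y)
    (hM : IsMarkov μ T P X) (hP : HasGenerator P Q) (hT : 0 ≤ T) {K : ℕ} (hK : 0 < K) {k : ℕ}
    (hk : k < K + 1) (i : Fin n) (B : Set (Fin (K + 1) → Fin m)) :
    |μ.real (gridPath T K Y ⁻¹' B ∩ {ω | X (grid T K k) ω = i}) -
      ∫ ω, (B.indicator (fun y => discPosterior (pathStep (P (T / K)) r y) (π₀ ᵥ* R r (y 0))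
        K k i)) (gridPath T K Y ω) ∂μ| ≤ 4 * μ.real (fineSet T X K)ᶜ := by
  classical
  have hXm := measurable_gridPath hT hK h.hidden.measurable
  have hYm := measurable_gridPath hT hK h.measurable
  have hmain := h.sum_abs_sub_le hM hT hK
  set p : (Fin (K + 1) → Fin m) → (Fin (K + 1) → Fin n) → ℝ := fun y x =>
    μ.real (gridPath T K Y ⁻¹' {y} ∩ gridPath T K X ⁻¹' {x}) with hp
  set q : (Fin (K + 1) → Fin m) → (Fin (K + 1) → Fin n) → ℝ := fun y x =>
    pathWeight (π₀ ᵥ* R r (y 0)) (pathStep (P (T / K)) r y) K x with hq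
  set g : (Fin (K + 1) → Fin m) → ℝ := fun y =>
    discPosterior (pathStep (P (T / K)) r y) (π₀ ᵥ* R r (y 0)) K k i with hg
  have hN : ∀ (y : Fin (K + 1) → Fin m) l i j, 0 ≤ pathStep (P (T / K)) r y l i j :=
    fun y l i j => stepMatrix_nonneg (hP.apply_nonneg (by positivity))
      (fun i z => (h.emission i).1 z) _ _ i j
  have hv := fun y : Fin (K + 1) → Fin m => h.init_nonneg (y 0)
  have hg0 : ∀ y, 0 ≤ g y := fun y => discPosterior_nonneg (hN y) (hv y) K k i
  have hg1 : ∀ y, g y ≤ 1 := fun y => discPosterior_le_one (hN y) (hv y) K k i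
  -- Bayes' rule, exact for the model weights `q`; only the passage from `p` to `q` costs an error.
  have hbayes : ∀ y, ∑ x, q y x * (if x ⟨k, hk⟩ = i then 1 else 0) = g y * ∑ x, q y x :=
    fun y => by
      rw [hq, hg]
      dsimp only
      rw [sum_pathWeight_indicator, sum_pathWeight_eq _ _ hk, discPosterior_mul (hN y) (hv y)]
  have e1 : μ.real (gridPath T K Y ⁻¹' B ∩ {ω | X (grid T K k) ω = i}) =
      ∑ y, B.indicator 1 y * ∑ x, p y x * (if x ⟨k, hk⟩ = i then 1 else 0) := by
    rw [← sum_measureReal_inter_preimage hYm]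
    refine Finset.sum_congr rfl fun y _ => ?_
    rw [← sum_measureReal_inter_preimage hXm, Finset.mul_sum]
    refine Finset.sum_congr rfl fun x _ => ?_
    by_cases hy : y ∈ B
    · by_cases hx : x ⟨k, hk⟩ = i
      · rw [indicator_of_mem hy, if_pos hx, Pi.one_apply, one_mul, mul_one]
        congr 1
        ext ω
        simp only [mem_inter_iff, mem_preimage, mem_singleton_iff, mem_ofPred_eq]
        constructor
        · exact fun hω => ⟨hω.1.2, hω.2⟩
        · rintro ⟨h1, h2⟩
          refine ⟨⟨⟨h1 ▸ hy, ?_⟩, h1⟩, h2⟩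
          rw [← hx, ← h2]; rfl
      · rw [if_neg hx, mul_zero, mul_zero]
        convert measureReal_empty (μ := μ)
        rw [eq_empty_iff_forall_notMem]
        rintro ω ⟨⟨⟨-, h1⟩, -⟩, h2⟩
        refine hx ?_
        rw [← h1, ← (h2 : gridPath T K X ω = x)]
        rfl
    · rw [indicator_of_notMem hy, zero_mul]
      convert measureReal_empty (μ := μ)
      rw [eq_empty_iff_forall_notMem]
      rintro ω ⟨⟨⟨h1, -⟩, h2⟩, -⟩
      exact hy ((h2 : gridPath T K Y ω = y) ▸ h1)
  have e2 : ∫ ω, (B.indicator g) (gridPath T K Y ω) ∂μ =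
      ∑ y, B.indicator 1 y * (g y * ∑ x, p y x) := by
    rw [integral_comp_fintype hYm]
    refine Finset.sum_congr rfl fun y _ => ?_
    rw [hp]
    dsimp only
    rw [sum_measureReal_inter_preimage hXm]
    by_cases hy : y ∈ B
    · simp [hy, mul_comm]
    · simp [hy]
  rw [e1, e2, ← Finset.sum_sub_distrib]
  refine (Finset.abs_sum_le_sum_abs _ _).trans ?_
  have hbound : ∀ y, |B.indicator 1 y * ∑ x, p y x * (if x ⟨k, hk⟩ = i then 1 else 0) -
      B.indicator 1 y * (g y * ∑ x, p y x)| ≤ 2 * ∑ x, |p y x - q y x| := fun y => by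
    have hE0 : 0 ≤ ∑ x, |p y x - q y x| := Finset.sum_nonneg fun x _ => abs_nonneg _
    have h1 : |∑ x, (p y x - q y x) * (if x ⟨k, hk⟩ = i then 1 else 0)| ≤
        ∑ x, |p y x - q y x| := by
      refine (Finset.abs_sum_le_sum_abs _ _).trans (Finset.sum_le_sum fun x _ => ?_)
      split_ifs
      · rw [mul_one]
      · rw [mul_zero, abs_zero]; exact abs_nonneg _
    have h2 : |g y * ∑ x, (p y x - q y x)| ≤ ∑ x, |p y x - q y x| := by
      rw [abs_mul, abs_of_nonneg (hg0 y)]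
      exact (mul_le_of_le_one_left (abs_nonneg _) (hg1 y)).trans
        (Finset.abs_sum_le_sum_abs _ _)
    -- Subtracting Bayes' rule for `q` leaves only differences `p - q`. Each of the two terms is at
    -- most their total, and with the bound `2 * μ.real (fineSet T X K)ᶜ` this gives the constant
    -- `4`.
    have h3 : ∑ x, p y x * (if x ⟨k, hk⟩ = i then 1 else 0) - g y * ∑ x, p y x =
        ∑ x, (p y x - q y x) * (if x ⟨k, hk⟩ = i then 1 else 0) -
          g y * ∑ x, (p y x - q y x) := by
      simp only [sub_mul, Finset.sum_sub_distrib, mul_sub, hbayes]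
      ring
    by_cases hy : y ∈ B
    · rw [indicator_of_mem hy, Pi.one_apply, one_mul, one_mul, h3]
      exact (abs_sub _ _).trans (by linarith)
    · rw [indicator_of_notMem hy, zero_mul, zero_mul, sub_zero, abs_zero]
      linarith
  refine (Finset.sum_le_sum fun y _ => hbound y).trans ?_
  rw [← Finset.mul_sum]
  linarith

end DiscretePosterior

end

end CTHMM

open scoped Matrix

namespace CTHMM

noncomputable section

/-! ### Almost surely, only transitions and emissions of positive weight occur -/

section AlmostSure

variable {Ω : Type*} [MeasurableSpace Ω] {μ : Measure Ω} [IsProbabilityMeasure μ] {n m : ℕ}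
  {T : ℝ} {Q : Matrix (Fin n) (Fin n) ℝ} {r : Fin n → Fin m → ℝ} {π₀ : Fin n → ℝ}
  {X : ℝ → Ω → Fin n} {Y : ℝ → Ω → Fin m} {P : ℝ → Matrix (Fin n) (Fin n) ℝ}

theorem IsJumpProcess.ae_init_pos (h : IsJumpProcess μ T Q π₀ X) : ∀ᵐ ω ∂μ, 0 < π₀ (X 0 ω) := by
  have key : ∀ i, ∀ᵐ ω ∂μ, X 0 ω = i → 0 < π₀ i := fun i => by
    by_cases hi : 0 < π₀ i
    · exact Eventually.of_forall fun _ _ => hi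
    · have h0 : μ {ω | X 0 ω = i} = 0 := by
        have h1 := h.init i
        have h2 : 0 ≤ μ.real {ω | X 0 ω = i} := measureReal_nonneg
        exact (measureReal_eq_zero_iff).1 (by linarith)
      filter_upwards [measure_eq_zero_iff_ae_notMem.1 h0] with ω hω hc
      exact absurd hc hω
  filter_upwards [ae_all_iff.2 key] with ω hω
  exact hω _ rfl

theorem IsMarkov.measureReal_exists_le (hM : IsMarkov μ T P X) (hP : HasGenerator P Q)
    (hT : 0 ≤ T) {K : ℕ} (hK : 0 < K) (i j : Fin n) :
    μ.real {ω | ∃ k < K, X (grid T K k) ω = i ∧ X (grid T K (k + 1)) ω = j} ≤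
      K * P (T / K) i j := by
  have hstep : ∀ k ∈ Finset.range K,
      μ.real ({ω | X (grid T K k) ω = i} ∩ {ω | X (grid T K (k + 1)) ω = j}) ≤
        P (T / K) i j := fun k hk => by
    have hk := Finset.mem_range.1 hk
    have h := hM (grid T K k) (grid T K (k + 1)) (grid_mem hT hK hk.le).1
      (grid_mono hT (Nat.le_succ k)) (grid_mem hT hK hk).2 univ MeasurableSet.univ i j
    rw [univ_inter, grid_succ, add_sub_cancel_left] at h
    rw [grid_succ, h]
    exact mul_le_of_le_one_left (hP.apply_nonneg (by positivity) i j) measureReal_le_one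
  have hset : {ω | ∃ k < K, X (grid T K k) ω = i ∧ X (grid T K (k + 1)) ω = j} =
      ⋃ k ∈ Finset.range K,
        ({ω | X (grid T K k) ω = i} ∩ {ω | X (grid T K (k + 1)) ω = j}) := by
    ext ω
    simp only [mem_iUnion, Finset.mem_range, exists_prop]
    rfl
  rw [hset]
  refine (measureReal_biUnion_finset_le _ _).trans ((Finset.sum_le_sum hstep).trans ?_)
  simp

/-- By the union bound the grid sees a transition `i → j` with probability at most `K * P (T / K) i
j`, which tends to `T * Q i j = 0`. A path with such a jump shows it on every sufficiently fine
grid. -/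
theorem IsMarkov.ae_not_jump (hM : IsMarkov μ T P X) (hP : HasGenerator P Q) (hT : 0 ≤ T)
    {i j : Fin n} (hij : i ≠ j) (hQ : Q i j = 0) :
    ∀ᵐ ω ∂μ, ∀ S τ, IsJumpPartition T (fun t => X t ω) S τ → ∀ s < S,
      ¬ (X (τ s) ω = i ∧ X (τ (s + 1)) ω = j) := by
  rcases hT.eq_or_lt with rfl | hTpos
  · refine Eventually.of_forall fun ω S τ hp s hs => ?_
    have h1 := hp.lt s hs
    have h2 := hp.nonneg hs.le
    have h3 := hp.le_T hs
    linarith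
  set E : ℕ → Set Ω := fun K =>
    {ω | ∃ k < K, X (grid T K k) ω = i ∧ X (grid T K (k + 1)) ω = j} with hE
  have hlim : Tendsto (fun K : ℕ => K * P (T / K) i j) atTop (𝓝 0) := by
    have h := ((hP.tendsto i j hij).comp (HasGenerator.tendsto_mesh_nhdsGT hTpos)).const_mul T
    rw [hQ, mul_zero] at h
    refine h.congr' ?_
    filter_upwards [eventually_gt_atTop 0] with K hK
    have hK' : (K : ℝ) ≠ 0 := by positivity
    simp only [Function.comp]
    field_simp
  have hnull : ∀ K₀, μ (⋂ K ≥ K₀, E K) = 0 := fun K₀ => by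
    refine (measureReal_eq_zero_iff).1 (le_antisymm (ge_of_tendsto hlim ?_) measureReal_nonneg)
    filter_upwards [eventually_gt_atTop 0, eventually_ge_atTop K₀] with K hK hge
    exact (measureReal_mono (iInter₂_subset K hge)).trans (hM.measureReal_exists_le hP hT hK i j)
  have hunion := measure_iUnion_null hnull
  filter_upwards [measure_eq_zero_iff_ae_notMem.1 hunion] with ω hω S τ hp s hs hc
  refine hω ?_
  obtain ⟨K₀, hK₀⟩ := eventually_atTop.1
    ((eventually_gridCeil_pred hp hT hs).and (eventually_gt_atTop 0))
  refine mem_iUnion.2 ⟨K₀, mem_iInter₂.2 fun K hK => ?_⟩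
  obtain ⟨⟨h1, h2, h3⟩, hK0⟩ := hK₀ K hK
  have hle := gridCeil_le hK0 (hp.mem_Icc (show s + 1 ≤ S from hs))
  refine ⟨gridCeil T K (τ (s + 1)) - 1, by omega, ?_, ?_⟩
  · have := hp.eq_pieceIndex (grid_mem hT hK0 (by omega : gridCeil T K (τ (s + 1)) - 1 ≤ K))
    rw [h2] at this
    exact this.trans hc.1
  · have := hp.eq_pieceIndex (grid_mem hT hK0 hle)
    rw [h3] at this
    rw [h1]
    exact this.trans hc.2

/-- There are countably many jump counts and finite sequences of states and observations; by
`IsCTHMM.observe` each with a vanishing emission product is a null event. -/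
theorem IsCTHMM.ae_emission_pos (h : IsCTHMM μ T Q r π₀ X Y) :
    ∀ᵐ ω ∂μ, ∀ S τ, IsJumpPartition T (fun t => X t ω) S τ → ∀ s ≤ S,
      0 < r (X (τ s) ω) (Y (τ s) ω) := by
  have key : ∀ S, ∀ x : Fin (S + 1) → Fin n, ∀ y : Fin (S + 1) → Fin m, ∀ᵐ ω ∂μ,
      (∃ τ, IsJumpPartition T (fun t => X t ω) S τ ∧
        ∀ s ≤ S, X (τ s) ω = extendPath x s ∧ Y (τ s) ω = extendPath y s) →
      ∏ s ∈ Finset.range (S + 1), r (extendPath x s) (extendPath y s) ≠ 0 := by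
    intro S x y
    by_cases h0 : ∏ s ∈ Finset.range (S + 1), r (extendPath x s) (extendPath y s) = 0
    · have hobs := h.observe univ MeasurableSet.univ S (extendPath x) (extendPath y)
      rw [h0, mul_zero, univ_inter] at hobs
      filter_upwards [measure_eq_zero_iff_ae_notMem.1 ((measureReal_eq_zero_iff).1 hobs)]
        with ω hω hc
      exact absurd hc hω
    · exact Eventually.of_forall fun _ _ => h0
  filter_upwards [ae_all_iff.2 fun S => ae_all_iff.2 fun x => ae_all_iff.2 (key S x)]
    with ω hω S τ hp s hs
  have hne := hω S (fun k => X (τ k) ω) (fun k => Y (τ k) ω) ⟨τ, hp, fun s hs => by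
    rw [extendPath_of_lt _ (Nat.lt_succ_of_le hs), extendPath_of_lt _ (Nat.lt_succ_of_le hs)]
    exact ⟨rfl, rfl⟩⟩
  have hs' := Finset.prod_ne_zero_iff.1 hne s (Finset.mem_range.2 (Nat.lt_succ_of_le hs))
  rw [extendPath_of_lt _ (Nat.lt_succ_of_le hs), extendPath_of_lt _ (Nat.lt_succ_of_le hs)] at hs'
  exact lt_of_le_of_ne ((h.emission _).1 _) hs'.symm

theorem IsCTHMM.ae_dotProduct_pos (h : IsCTHMM μ T Q r π₀ X Y) (hT : 0 ≤ T) {S : Ω → ℕ}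
    {τ : Ω → ℕ → ℝ} {α β : Ω → ℝ → Fin n → ℝ}
    (hp : ∀ ω, IsJumpPartition T (fun t => Y t ω) (S ω) (τ ω))
    (hα : ∀ ω, IsForwardSolution T Q r π₀ (fun t => Y t ω) (S ω) (τ ω) (α ω))
    (hβ : ∀ ω, IsBackwardSolution T Q r (fun t => Y t ω) (S ω) (τ ω) (β ω)) :
    ∀ᵐ ω ∂μ, 0 < α ω 0 ⬝ᵥ β ω 0 := by
  obtain ⟨P, hP, hM⟩ := h.hidden.exists_hasGenerator
  have hjump : ∀ᵐ ω ∂μ, ∀ i j, i ≠ j → Q i j = 0 → ∀ S τ,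
      IsJumpPartition T (fun t => X t ω) S τ → ∀ s < S,
        ¬ (X (τ s) ω = i ∧ X (τ (s + 1)) ω = j) := by
    refine ae_all_iff.2 fun i => ae_all_iff.2 fun j => ?_
    by_cases hij : i ≠ j ∧ Q i j = 0
    · filter_upwards [hM.ae_not_jump hP hT hij.1 hij.2] with ω hω _ _ using hω
    · exact Eventually.of_forall fun ω h1 h2 => absurd ⟨h1, h2⟩ hij
  filter_upwards [h.hidden.ae_init_pos, hjump, h.ae_emission_pos] with ω h1 h2 h3
  obtain ⟨S', σ, hx⟩ := h.hidden.path ω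
  refine dotProduct_pos_of_path (hp ω) (hα ω) (hβ ω) (x := fun t => X t ω) ?_ hT
  refine (hα ω).pos_of_path (hp ω) hx (h.held ω S' σ hx) (fun i j hij => hP.rate_nonneg hij)
    (fun i z => (h.emission i).1 z) (fun i => ?_) h1 (fun s hs => ?_) (h3 S' σ hx)
  · rw [← h.hidden.init i]
    exact measureReal_nonneg
  · have hne : X (σ s) ω ≠ X (σ (s + 1)) ω := (hx.ne s hs).symm
    exact lt_of_le_of_ne (hP.rate_nonneg hne) fun h0 =>
      h2 _ _ hne h0.symm S' σ hx s hs ⟨rfl, rfl⟩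

end AlmostSure

end

end CTHMM

open scoped Matrix

namespace CTHMM

noncomputable section

/-! ### Passage to the limit and identification of the conditional probability -/

section Posterior

variable {Ω : Type*} {n m : ℕ} {T : ℝ} {r : Fin n → Fin m → ℝ} {π₀ : Fin n → ℝ}
  {Y : ℝ → Ω → Fin m} {P : ℝ → Matrix (Fin n) (Fin n) ℝ}

theorem discPosterior_gridPath (ω : Ω) {K k : ℕ} (hk : k ≤ K) (i : Fin n) :
    discPosterior (pathStep (P (T / K)) r (gridPath T K Y ω)) (π₀ ᵥ* R r (gridPath T K Y ω 0))
        K k i =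
      discPosterior (gridStep P r T (fun t => Y t ω) K) (π₀ ᵥ* R r (Y 0 ω)) K k i := by
  have hstep : ∀ l < K, pathStep (P (T / K)) r (gridPath T K Y ω) l =
      gridStep P r T (fun t => Y t ω) K l := fun l hl => by
    rw [pathStep, extendPath_of_lt _ (by omega : l < K + 1),
      extendPath_of_lt _ (by omega : l + 1 < K + 1)]
    rfl
  have h0 : gridPath T K Y ω 0 = Y 0 ω := by
    have : grid T K ((0 : Fin (K + 1)) : ℕ) = 0 := grid_zero
    rw [gridPath, this]
  rw [discPosterior, discPosterior, h0, discForward_congr _ fun l hl => hstep l (by omega),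
    discBackward_congr fun l _ hl => hstep l (by omega)]

/-- The posterior probability of the discretized model at the grid point following `t`. -/
def gridPosterior (T : ℝ) (r : Fin n → Fin m → ℝ) (π₀ : Fin n → ℝ)
    (P : ℝ → Matrix (Fin n) (Fin n) ℝ) (Y : ℝ → Ω → Fin m) (t : ℝ) (i : Fin n) (K : ℕ)
    (ω : Ω) : ℝ :=
  discPosterior (pathStep (P (T / K)) r (gridPath T K Y ω)) (π₀ ᵥ* R r (gridPath T K Y ω 0))
    K (gridCeil T K t) i

theorem measurable_gridPosterior (hT : 0 ≤ T) {K : ℕ} (hK : 0 < K) (t : ℝ) (i : Fin n) :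
    Measurable[pathSigma Y T] (gridPosterior T r π₀ P Y t i K) := by
  have h1 : Measurable[pathSigma Y T] (gridPath T K Y) :=
    @measurable_gridPath _ (pathSigma Y T) T m Y hT K hK fun u hu => measurable_pathSigma hu
  exact Measurable.comp (measurable_of_finite fun y : Fin (K + 1) → Fin m =>
    discPosterior (pathStep (P (T / K)) r y) (π₀ ᵥ* R r (y 0)) K (gridCeil T K t) i) h1

variable [MeasurableSpace Ω] {μ : Measure Ω} {Q : Matrix (Fin n) (Fin n) ℝ}
  {X : ℝ → Ω → Fin n}

theorem IsCTHMM.exists_isJumpPartition (h : IsCTHMM μ T Q r π₀ X Y) (ω : Ω) :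
    ∃ S τ, IsJumpPartition T (fun t => Y t ω) S τ := by
  obtain ⟨S, τ, hp⟩ := h.hidden.path ω
  exact CTHMM.exists_isJumpPartition S τ hp.zero hp.lt hp.le (h.held ω S τ hp)

theorem IsCTHMM.gridPosterior_mem_Icc (h : IsCTHMM μ T Q r π₀ X Y) (hP : HasGenerator P Q)
    (hT : 0 ≤ T) (t : ℝ) (i : Fin n) (K : ℕ) (ω : Ω) :
    gridPosterior T r π₀ P Y t i K ω ∈ Icc (0 : ℝ) 1 := by
  have hN : ∀ l i j, 0 ≤ pathStep (P (T / K)) r (gridPath T K Y ω) l i j :=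
    fun l i j => stepMatrix_nonneg (hP.apply_nonneg (by positivity))
      (fun i z => (h.emission i).1 z) _ _ i j
  exact ⟨discPosterior_nonneg hN (h.init_nonneg _) _ _ _,
    discPosterior_le_one hN (h.init_nonneg _) _ _ _⟩

variable [IsProbabilityMeasure μ]

/-- The integral identity that characterizes the posterior, on a finite-dimensional event of the
observations. -/
theorem IsCTHMM.setIntegral_eq_of_tendsto (h : IsCTHMM μ T Q r π₀ X Y) (hM : IsMarkov μ T P X)
    (hP : HasGenerator P Q) (hT : 0 ≤ T) {t : ℝ} (ht : t ∈ Icc 0 T) (i : Fin n) {g : Ω → ℝ}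
    (hg : ∀ᵐ ω ∂μ, Tendsto (fun K => gridPosterior T r π₀ P Y t i K ω) atTop (𝓝 (g ω)))
    (F : Finset ℝ) (hF : ∀ u ∈ F, u ∈ Icc 0 T) (B : ℝ → Set (Fin m)) :
    ∫ ω in ⋂ u ∈ F, Y u ⁻¹' B u, g ω ∂μ =
      μ.real ((⋂ u ∈ F, Y u ⁻¹' B u) ∩ {ω | X t ω = i}) := by
  set A : Set Ω := ⋂ u ∈ F, Y u ⁻¹' B u with hA
  -- The event is replaced by one that depends only on grid observations; at each outcome
  -- right-continuity makes the two agree for large `K`.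
  set A' : ℕ → Set Ω := fun K => ⋂ u ∈ F, Y (grid T K (gridCeil T K u)) ⁻¹' B u with hA'
  have hAm : MeasurableSet A :=
    Finset.measurableSet_biInter _ fun u hu => h.measurable u (hF u hu) (MeasurableSet.of_discrete)
  have hgm : ∀ K > 0, ∀ u ∈ Icc 0 T, grid T K (gridCeil T K u) ∈ Icc 0 T :=
    fun K hK u hu => grid_mem hT hK (gridCeil_le hK hu)
  have hA'm : ∀ K > 0, MeasurableSet (A' K) := fun K hK =>
    Finset.measurableSet_biInter _ fun u hu =>
      h.measurable _ (hgm K hK u (hF u hu)) (MeasurableSet.of_discrete)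
  have hpath : ∀ ω, ∀ u ∈ Icc 0 T, ∀ᶠ K in atTop, Y (grid T K (gridCeil T K u)) ω = Y u ω :=
    fun ω u hu => by
      obtain ⟨S, τ, hp⟩ := h.exists_isJumpPartition ω
      exact hp.eventually_grid_gridCeil hT hu
  have hAA' : ∀ ω, ∀ᶠ K in atTop, ω ∈ A' K ↔ ω ∈ A := fun ω => by
    have : ∀ᶠ K in atTop, ∀ u ∈ F, Y (grid T K (gridCeil T K u)) ω = Y u ω :=
      (eventually_all_finset F).2 fun u hu => hpath ω u (hF u hu)
    filter_upwards [this] with K hK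
    simp only [hA, hA', mem_iInter, mem_preimage]
    exact forall₂_congr fun u hu => by rw [hK u hu]
  have hXpath : ∀ ω, ∀ᶠ K in atTop, X (grid T K (gridCeil T K t)) ω = X t ω := fun ω => by
    obtain ⟨S, τ, hp⟩ := h.hidden.path ω
    exact hp.eventually_grid_gridCeil hT ht
  -- The shift to `K + 1` excludes the degenerate grid `K = 0`, so that measurability holds along
  -- the whole sequence.
  have hshift := tendsto_add_atTop_nat 1
  have l1 : Tendsto (fun K => μ.real (A' (K + 1) ∩
      {ω | X (grid T (K + 1 : ℕ) (gridCeil T (K + 1 : ℕ) t)) ω = i})) atTop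
      (𝓝 (μ.real (A ∩ {ω | X t ω = i}))) := by
    refine (ENNReal.tendsto_toReal (measure_ne_top μ _)).comp
      (tendsto_measure_of_tendsto_indicator_of_isFiniteMeasure atTop μ (fun K => ?_) fun ω => ?_)
    · exact (hA'm (K + 1) (Nat.succ_pos K)).inter
        (h.hidden.measurable _ (hgm (K + 1) (Nat.succ_pos K) t ht) (measurableSet_singleton i))
    · filter_upwards [hshift.eventually (hAA' ω), hshift.eventually (hXpath ω)] with K h1 h2
      simp only [mem_inter_iff, mem_ofPred_eq, h1, h2]
  have l2 : Tendsto (fun K => ∫ ω, (A' (K + 1)).indicator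
      (gridPosterior T r π₀ P Y t i (K + 1)) ω ∂μ) atTop (𝓝 (∫ ω, A.indicator g ω ∂μ)) := by
    refine tendsto_integral_of_dominated_convergence (fun _ => 1) (fun K => ?_)
      (integrable_const 1) (fun K => Eventually.of_forall fun ω => ?_) ?_
    · exact (((measurable_gridPosterior hT (Nat.succ_pos K) t i).mono (pathSigma_le h.measurable)
        le_rfl).indicator (hA'm (K + 1) (Nat.succ_pos K))).aestronglyMeasurable
    · have hb := h.gridPosterior_mem_Icc hP hT t i (K + 1) ω
      refine (norm_indicator_le_norm_self _ _).trans ?_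
      rw [Real.norm_of_nonneg hb.1]
      exact hb.2
    · filter_upwards [hg] with ω hω
      have hA'' := hshift.eventually (hAA' ω)
      by_cases hωA : ω ∈ A
      · rw [indicator_of_mem hωA]
        refine (hω.comp hshift).congr' ?_
        filter_upwards [hA''] with K hK
        rw [indicator_of_mem (hK.2 hωA)]
        rfl
      · rw [indicator_of_notMem hωA]
        refine tendsto_const_nhds.congr' ?_
        filter_upwards [hA''] with K hK
        rw [indicator_of_notMem fun hc => hωA (hK.1 hc)]
  have hdiff : ∀ K, |μ.real (A' (K + 1) ∩
      {ω | X (grid T (K + 1 : ℕ) (gridCeil T (K + 1 : ℕ) t)) ω = i}) -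
      ∫ ω, (A' (K + 1)).indicator (gridPosterior T r π₀ P Y t i (K + 1)) ω ∂μ| ≤
      4 * μ.real (fineSet T X (K + 1))ᶜ := fun K => by
    have hK : 0 < K + 1 := Nat.succ_pos K
    have hle : ∀ u ∈ F, gridCeil T (K + 1 : ℕ) u < K + 1 + 1 := fun u hu =>
      Nat.lt_succ_of_le (gridCeil_le hK (hF u hu))
    have hpre : gridPath T (K + 1) Y ⁻¹'
        {y | ∀ u ∈ F, extendPath y (gridCeil T (K + 1 : ℕ) u) ∈ B u} = A' (K + 1) := by
      ext ω
      simp only [hA', mem_iInter, mem_preimage, mem_ofPred_eq]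
      refine forall₂_congr fun u hu => ?_
      rw [extendPath_of_lt _ (hle u hu)]
      rfl
    have hmain := h.abs_measureReal_sub_integral_le hM hP hT hK
      (Nat.lt_succ_of_le (gridCeil_le hK ht)) i
      {y | ∀ u ∈ F, extendPath y (gridCeil T (K + 1 : ℕ) u) ∈ B u}
    rw [hpre] at hmain
    convert hmain using 4 with ω
    funext ω
    rw [← hpre]
    rfl
  have l3 : Tendsto (fun K => 4 * μ.real (fineSet T X (K + 1))ᶜ) atTop (𝓝 0) := by
    simpa using ((tendsto_measureReal_compl_fineSet h.hidden hT).comp hshift).const_mul 4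
  have hzero := tendsto_nhds_unique (l1.sub l2) (squeeze_zero_norm hdiff l3)
  rw [← integral_indicator hAm]
  linarith

theorem IsCTHMM.condProb_ae_eq (h : IsCTHMM μ T Q r π₀ X Y) (hT : 0 ≤ T) {S : Ω → ℕ}
    {τ : Ω → ℕ → ℝ} {α β : Ω → ℝ → Fin n → ℝ}
    (hp : ∀ ω, IsJumpPartition T (fun t => Y t ω) (S ω) (τ ω))
    (hα : ∀ ω, IsForwardSolution T Q r π₀ (fun t => Y t ω) (S ω) (τ ω) (α ω))
    (hβ : ∀ ω, IsBackwardSolution T Q r (fun t => Y t ω) (S ω) (τ ω) (β ω)) {t : ℝ}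
    (ht : t ∈ Icc 0 T) (i : Fin n) :
    μ⟦{ω | X t ω = i} | pathSigma Y T⟧ =ᵐ[μ]
      fun ω => α ω t i * β ω t i / (α ω 0 ⬝ᵥ β ω 0) := by
  obtain ⟨P, hP, hM⟩ := h.hidden.exists_hasGenerator
  set g : Ω → ℝ := fun ω => α ω t i * β ω t i / (α ω 0 ⬝ᵥ β ω 0) with hg_def
  have hm := pathSigma_le h.measurable
  have hlim : ∀ᵐ ω ∂μ, Tendsto (fun K => gridPosterior T r π₀ P Y t i K ω) atTop (𝓝 (g ω)) := by
    filter_upwards [h.ae_dotProduct_pos hT hp hα hβ] with ω hω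
    refine (tendsto_discPosterior hP hT (hp ω) (hα ω) (hβ ω) hω ht i).congr' ?_
    filter_upwards [eventually_gt_atTop 0] with K hK
    exact (discPosterior_gridPath ω (gridCeil_le hK ht) i).symm
  -- The solutions are chosen outcome by outcome, so `g` has no evident measurability; the limsup of
  -- the grid posteriors is a version measurable with respect to the observations.
  have hgm : AEStronglyMeasurable[pathSigma Y T] g μ := by
    have hmeas : ∀ K, Measurable[pathSigma Y T] (gridPosterior T r π₀ P Y t i (K + 1)) :=
      fun K => measurable_gridPosterior hT (Nat.succ_pos K) t i
    refine ⟨fun ω => limsup (fun K => gridPosterior T r π₀ P Y t i (K + 1) ω) atTop,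
      (Measurable.limsup hmeas).stronglyMeasurable, ?_⟩
    filter_upwards [hlim] with ω hω
    exact (hω.comp (tendsto_add_atTop_nat 1)).limsup_eq.symm
  have hg_bound : ∀ᵐ ω ∂μ, ‖g ω‖ ≤ 1 := by
    filter_upwards [hlim] with ω hω
    refine le_of_tendsto hω.norm (Eventually.of_forall fun K => ?_)
    have hb := h.gridPosterior_mem_Icc hP hT t i K ω
    rw [Real.norm_of_nonneg hb.1]
    exact hb.2
  have hg_int : Integrable g μ := Integrable.of_bound (hgm.mono hm) 1 hg_bound
  have hXm : MeasurableSet {ω | X t ω = i} := h.hidden.measurable t ht (measurableSet_singleton i)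
  have hf_int : Integrable ({ω | X t ω = i}.indicator fun _ => (1 : ℝ)) μ :=
    (integrable_const 1).indicator hXm
  have hfA : ∀ A, ∫ ω in A, {ω | X t ω = i}.indicator (fun _ => (1 : ℝ)) ω ∂μ =
      μ.real (A ∩ {ω | X t ω = i}) := fun A => by
    rw [setIntegral_indicator hXm]
    simp
  -- Finite-dimensional events form a π-system that generates `pathSigma Y T`; the identity on them
  -- suffices by the π-λ theorem.
  have hbasic : ∀ A ∈ piiUnionInter
      (fun u => {s | MeasurableSet[MeasurableSpace.comap (Y u) ⊤] s}) (Icc 0 T),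
      ∫ ω in A, g ω ∂μ = ∫ ω in A, {ω | X t ω = i}.indicator (fun _ => (1 : ℝ)) ω ∂μ := by
    rintro A ⟨F, hF, f, hf, rfl⟩
    have hB : ∀ u, ∃ B : Set (Fin m), u ∈ F → Y u ⁻¹' B = f u := fun u => by
      by_cases hu : u ∈ F
      · obtain ⟨B, -, hB⟩ := hf u hu
        exact ⟨B, fun _ => hB⟩
      · exact ⟨∅, fun hc => absurd hc hu⟩
    choose B hB using hB
    have hset : ⋂ u ∈ F, f u = ⋂ u ∈ F, Y u ⁻¹' B u := iInter₂_congr fun u hu => (hB u hu).symm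
    have hFm : ∀ u ∈ F, u ∈ Icc 0 T := fun u hu => hF hu
    rw [hset, h.setIntegral_eq_of_tendsto hM hP hT ht i hlim F hFm B, hfA]
  have huniv : ∫ ω, g ω ∂μ = ∫ ω, {ω | X t ω = i}.indicator (fun _ => (1 : ℝ)) ω ∂μ := by
    have := hbasic univ ⟨∅, by simp, fun _ => univ, by simp, by simp⟩
    simpa using this
  have hall : ∀ A, MeasurableSet[pathSigma Y T] A → ∫ ω in A, g ω ∂μ =
      ∫ ω in A, {ω | X t ω = i}.indicator (fun _ => (1 : ℝ)) ω ∂μ := by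
    refine MeasurableSpace.induction_on_inter
      (generateFrom_piiUnionInter_measurableSet (fun u => MeasurableSpace.comap (Y u) ⊤)
        (Icc 0 T)).symm
      (isPiSystem_piiUnionInter _ (fun u => @MeasurableSpace.isPiSystem_measurableSet _
        (MeasurableSpace.comap (Y u) ⊤)) _) ?_ hbasic ?_ ?_
    · simp
    · intro A hA ih
      rw [setIntegral_compl (hm A hA) hg_int, setIntegral_compl (hm A hA) hf_int, ih, huniv]
    · intro f hd hf ih
      rw [integral_iUnion (fun k => hm _ (hf k)) hd hg_int.integrableOn,
        integral_iUnion (fun k => hm _ (hf k)) hd hf_int.integrableOn]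
      exact tsum_congr ih
  exact (ae_eq_condExp_of_forall_setIntegral_eq hm hf_int (fun _ _ _ => hg_int.integrableOn)
    (fun A hA _ => hall A hA) hgm).symm

end Posterior

end

end CTHMM

open CTHMM MeasureTheory ProbabilityTheory Set
open scoped Matrix

theorem theorem1 {Ω : Type*} [MeasurableSpace Ω] (μ : Measure Ω) [IsProbabilityMeasure μ]
    {n m : ℕ} (T : ℝ) (hT : 0 ≤ T) (Q : Matrix (Fin n) (Fin n) ℝ) (r : Fin n → Fin m → ℝ)
    (π₀ : Fin n → ℝ) (X : ℝ → Ω → Fin n) (Y : ℝ → Ω → Fin m)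
    (hXY : IsCTHMM μ T Q r π₀ X Y) :
    -- every observed path is a step function
    (∀ ω, ∃ S τ, IsJumpPartition T (fun t => Y t ω) S τ) ∧
    -- along any step path both piecewise ODEs have exactly one solution on `[0, T]`
    (∀ (y : ℝ → Fin m) (S : ℕ) (τ : ℕ → ℝ), IsJumpPartition T y S τ →
      (∃ α, IsForwardSolution T Q r π₀ y S τ α ∧
        ∀ α', IsForwardSolution T Q r π₀ y S τ α' → EqOn α' α (Icc 0 T)) ∧
      (∃ β, IsBackwardSolution T Q r y S τ β ∧
        ∀ β', IsBackwardSolution T Q r y S τ β' → EqOn β' β (Icc 0 T)) ∧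
      -- the inner product of the two solutions is constant in time
      (∀ α β, IsForwardSolution T Q r π₀ y S τ α → IsBackwardSolution T Q r y S τ β →
        ∀ t ∈ Icc 0 T, α t ⬝ᵥ β t = α 0 ⬝ᵥ β 0)) ∧
    -- the posterior distribution, with the solutions taken along the observed path
    (∀ (S : Ω → ℕ) (τ : Ω → ℕ → ℝ) (α β : Ω → ℝ → Fin n → ℝ),
      (∀ ω, IsJumpPartition T (fun t => Y t ω) (S ω) (τ ω)) →
      (∀ ω, IsForwardSolution T Q r π₀ (fun t => Y t ω) (S ω) (τ ω) (α ω)) →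
      (∀ ω, IsBackwardSolution T Q r (fun t => Y t ω) (S ω) (τ ω) (β ω)) →
      (∀ᵐ ω ∂μ, 0 < α ω 0 ⬝ᵥ β ω 0) ∧
      ∀ t ∈ Icc 0 T, ∀ i : Fin n,
        μ⟦{ω | X t ω = i} | pathSigma Y T⟧ =ᵐ[μ]
          fun ω => α ω t i * β ω t i / (α ω 0 ⬝ᵥ β ω 0)) := by
  refine ⟨hXY.exists_isJumpPartition, fun y S τ hp => ⟨?_, ?_, fun α β hα hβ t ht =>
    dotProduct_eq hp hα hβ ht⟩, fun S τ α β hp hα hβ =>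
    ⟨hXY.ae_dotProduct_pos hT hp hα hβ, fun t ht i => hXY.condProb_ae_eq hT hp hα hβ ht i⟩⟩
  · exact ⟨_, isForwardSolution_forward hp, fun α' hα' =>
      (isForwardSolution_forward hp).eqOn hp hα'⟩
  · exact ⟨_, isBackwardSolution_backward hp, fun β' hβ' =>
      (isBackwardSolution_backward hp).eqOn hp hβ'⟩
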